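/- Let $\mathcal E$ be an elementary topos (a category with finite limits that is cartesian closed and has a subobject classifier) and let $R$ be an ordered commutative ring object in $\mathcal E$: a commutative ring object with a subobject ${\le}\rightarrowtail R\times R$ that is reflexive, transitive, antisymmetric, total in the sense that the join of $\le$ and its opposite is all of $R\times R$, preserved by addition, and such that products of non-negative elements are non-negative. Put $R_+=\{i:R\mid 0\le i\}$. We use the internal language of $\mathcal E$. *The CwF of $\mathcal E$.* $\mathcal E$ is regarded as a category with families (CwF) by the local universes construction: a family $A\in\mathcal E(\Gamma)$ is a morphism $E\to V$ together with a morphism $\Gamma\to V$, re-indexing is precomposition, $\Gamma.A\to\Gamma$ is the pullback of $E\to V$, and an element of $A$ is a lift $\Gamma\to E$ of $\Gamma\to V$. *Moore paths.* For $x,y:\Gamma$ let $x\sim y=\{(f,i):(R_+\to\Gamma)\times R_+\mid f\,0=x\wedge(\forall j\ge i)\,f\,j=y\}$. For $p=(f,i):x\sim y$ write $p\,j=f\,j$ and $|p|=i$ (the shape of $p$). The degenerate path $\mathsf{idp}\,x$ is constant of shape $0$; $\gamma:\Delta\to\Gamma$ acts on paths by $\gamma{}'(f,i)=(\gamma\circ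 f,i)$; the reversal $\mathsf{rev}\,p:y\sim x$ has shape $|p|$ and $(\mathsf{rev}\,p)\,i=p(|p|-i)$ for $i\le|p|$; for $i\le |p|$ the initial segment $p|_i:x\sim p\,i$ has shape $i$ and agrees with $p$ on all $j\le i$. *Fibrations.* A tap (transport-along-paths) structure on $A\in\mathcal E(\Gamma)$ is a $(\Gamma\times\Gamma)$-indexed family of morphisms $p\mapsto p_*:(x\sim y)\to(A\,x\to A\,y)$ with $(\mathsf{idp}\,x)_*a=a$. $\mathbf{Fib}(\Gamma)$ is the set of families over $\Gamma$ equipped with a tap structure. Re-indexing $A$ along $\gamma$ gives $A\gamma$ the transport $p_*a:=(\gamma{}'p)_*a$. With elements those of the underlying families, and the comprehension of $\mathcal E$, $\mathbf{Fib}$ is a CwF. For $A\in\mathbf{Fib}(\Gamma)$, $p:x\sim y$ and $a:A\,x$, the lift $\mathsf{lift}(p,a):(x,a)\sim(y,p_*a)$ in $\Gamma.A$ is the path of shape $|p|$ with $\mathsf{lift}(p,a)\,i=(p\,i,(p|_i)_*a)$ for $i\le|p|$. **Theorem.** The CwF of $\mathcal E$ has $\Sigma$- and $\Pi$-types strictly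 stable under re-indexing that are dependent sums and dependent products, and for any choice of such $\Sigma$, $\Pi$ the following holds. For all $\Gamma\in\mathcal E$, $A\in\mathbf{Fib}(\Gamma)$ and $B\in\mathbf{Fib}(\Gamma.A)$, the families $$\Sigma AB=\Bigl(\sum_{a:A\,x}B(x,a)\Bigm| x:\Gamma\Bigr),\qquad \Pi AB=\Bigl(\prod_{a:A\,x}B(x,a)\Bigm| x:\Gamma\Bigr)$$ in $\mathcal E(\Gamma)$ have tap structures, given for $p:x\sim y$ by $$p_*(a,b)=\bigl(p_*a,\ \mathsf{lift}(p,a)_*\,b\bigr),\qquad (p_*F)\,a=\bigl(\mathsf{rev}(\mathsf{lift}(\mathsf{rev}\,p,a))\bigr)_*\,F\bigl((\mathsf{rev}\,p)_*a\bigr)\quad(a:A\,y),$$ and these are stable under re-indexing: for every $\gamma:\Delta\to\Gamma$, re-indexing the fibration $\Sigma AB$ (resp. $\Pi AB$) along $\gamma$ gives the fibration formed from the re-indexed $A$ and $B$. Hence the CwF $\mathbf{Fib}$ supports $\Sigma$- and $\Pi$-types in the sense of Hofmann (for $\Sigma$: formation, a pairing morphism and an eliminator with its computation rule; for $\Pi$: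 formation, abstraction and application with the $\beta$-rule; everything stable under re-indexing), where the underlying families, the pairing, the abstraction and the application are those of $\mathcal E$. -/

import Mathlib

open CategoryTheory CategoryTheory.Limits MonoidalCategory CartesianMonoidalCategory

universe w₁ w₂ v u

noncomputable section

namespace MoorePaths

/-! ### Categories with families

Elements of families are kept in one set `Tm Γ` per context, together with the function `tp`
that sends an element to its family; so the set of elements of a family `A` over `Γ` is
`{t : Tm Γ // tp t = A}`. -/

/-- A category with families whose category of contexts is `E`. -/
structure CwF (E : Type u) [Category.{v} E] where
  /-- families over a context -/
  Ty : E → Type w₁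
  /-- elements of families over a context -/
  Tm : E → Type w₂
  tp : ∀ {Γ : E}, Tm Γ → Ty Γ
  /-- re-indexing of families -/
  sub : ∀ {Δ Γ : E}, (Δ ⟶ Γ) → Ty Γ → Ty Δ
  /-- re-indexing of elements -/
  tsub : ∀ {Δ Γ : E}, (Δ ⟶ Γ) → Tm Γ → Tm Δ
  sub_id : ∀ {Γ : E} (A : Ty Γ), sub (𝟙 Γ) A = A
  sub_comp : ∀ {Θ Δ Γ : E} (g : Θ ⟶ Δ) (f : Δ ⟶ Γ) (A : Ty Γ), sub (g ≫ f) A = sub g (sub f A)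
  tsub_id : ∀ {Γ : E} (t : Tm Γ), tsub (𝟙 Γ) t = t
  tsub_comp : ∀ {Θ Δ Γ : E} (g : Θ ⟶ Δ) (f : Δ ⟶ Γ) (t : Tm Γ),
    tsub (g ≫ f) t = tsub g (tsub f t)
  tp_tsub : ∀ {Δ Γ : E} (f : Δ ⟶ Γ) (t : Tm Γ), tp (tsub f t) = sub f (tp t)
  /-- the comprehension object `Γ.A` -/
  ext : ∀ {Γ : E}, Ty Γ → E
  /-- the projection `Γ.A ⟶ Γ` -/
  p : ∀ {Γ : E} (A : Ty Γ), ext A ⟶ Γ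
  /-- the generic element of `A` over `Γ.A` -/
  v : ∀ {Γ : E} (A : Ty Γ), Tm (ext A)
  tp_v : ∀ {Γ : E} (A : Ty Γ), tp (v A) = sub (p A) A
  /-- the morphism `⟨f, t⟩ : Δ ⟶ Γ.A` -/
  cons : ∀ {Δ Γ : E} {A : Ty Γ} (f : Δ ⟶ Γ) (t : Tm Δ), tp t = sub f A → (Δ ⟶ ext A)
  cons_p : ∀ {Δ Γ : E} {A : Ty Γ} (f : Δ ⟶ Γ) (t : Tm Δ) (h : tp t = sub f A),
    cons f t h ≫ p A = f
  cons_v : ∀ {Δ Γ : E} {A : Ty Γ} (f : Δ ⟶ Γ) (t : Tm Δ) (h : tp t = sub f A),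
    tsub (cons f t h) (v A) = t
  cons_uniq : ∀ {Δ Γ : E} {A : Ty Γ} (f : Δ ⟶ Γ) (t : Tm Δ) (h : tp t = sub f A)
    (m : Δ ⟶ ext A), m ≫ p A = f → tsub m (v A) = t → m = cons f t h

namespace CwF

variable {E : Type u} [Category.{v} E] (C : CwF.{w₁, w₂} E)

/-- The morphism `Δ.A' ⟶ Γ.A` induced by `f : Δ ⟶ Γ`, where `A'` is the re-indexing of `A`
along `f`. -/
def wkOf {Δ Γ : E} (f : Δ ⟶ Γ) (A : C.Ty Γ) (A' : C.Ty Δ) (h : A' = C.sub f A) :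
    C.ext A' ⟶ C.ext A :=
  C.cons (C.p A' ≫ f) (C.v A') (by rw [C.tp_v, C.sub_comp, h])

/-- The morphism `Δ.A[f] ⟶ Γ.A` induced by `f : Δ ⟶ Γ`. -/
def wk {Δ Γ : E} (f : Δ ⟶ Γ) (A : C.Ty Γ) : C.ext (C.sub f A) ⟶ C.ext A :=
  C.wkOf f A (C.sub f A) rfl

/-- The morphism `⟨id, t⟩ : Γ ⟶ Γ.A` given by an element `t` of `A`. -/
def inst {Γ : E} {A : C.Ty Γ} (t : C.Tm Γ) (h : C.tp t = A) : Γ ⟶ C.ext A :=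
  C.cons (𝟙 Γ) t (by rw [h, C.sub_id])

lemma wkOf_p {Δ Γ : E} (f : Δ ⟶ Γ) (A : C.Ty Γ) (A' : C.Ty Δ) (h : A' = C.sub f A) :
    C.wkOf f A A' h ≫ C.p A = C.p A' ≫ f := C.cons_p _ _ _

lemma wk_p {Δ Γ : E} (f : Δ ⟶ Γ) (A : C.Ty Γ) :
    C.wk f A ≫ C.p A = C.p (C.sub f A) ≫ f := C.cons_p _ _ _

lemma inst_comp {Δ Γ : E} {A : C.Ty Γ} (f : Δ ⟶ Γ) (t : C.Tm Γ) (h : C.tp t = A)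
    (h' : C.tp (C.tsub f t) = C.sub f A) :
    C.inst (C.tsub f t) h' ≫ C.wk f A = f ≫ C.inst t h := by
  have e : C.tp (C.tsub f t) = C.sub f A := h'
  refine (C.cons_uniq f (C.tsub f t) e _ ?_ ?_).trans (C.cons_uniq f (C.tsub f t) e _ ?_ ?_).symm
  · rw [Category.assoc, wk_p, ← Category.assoc, inst, C.cons_p, Category.id_comp]
  · rw [C.tsub_comp, wk, wkOf, C.cons_v, inst, C.cons_v]
  · rw [Category.assoc, inst, C.cons_p, Category.comp_id]
  · rw [C.tsub_comp, inst, C.cons_v]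

/-- The structure by which a category with families supports `Σ`-types: formation, the pairing
morphism, and the eliminator with its computation rule, all stable under re-indexing. -/
structure SigmaTypes where
  sig : ∀ {Γ : E} (A : C.Ty Γ), C.Ty (C.ext A) → C.Ty Γ
  sig_sub : ∀ {Δ Γ : E} (f : Δ ⟶ Γ) (A : C.Ty Γ) (B : C.Ty (C.ext A)),
    C.sub f (sig A B) = sig (C.sub f A) (C.sub (C.wk f A) B)
  pair : ∀ {Γ : E} (A : C.Ty Γ) (B : C.Ty (C.ext A)), C.ext B ⟶ C.ext (sig A B)
  pair_p : ∀ {Γ : E} (A : C.Ty Γ) (B : C.Ty (C.ext A)),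
    pair A B ≫ C.p (sig A B) = C.p B ≫ C.p A
  pair_sub : ∀ {Δ Γ : E} (f : Δ ⟶ Γ) (A : C.Ty Γ) (B : C.Ty (C.ext A)),
    pair (C.sub f A) (C.sub (C.wk f A) B) ≫ C.wkOf f (sig A B) _ (sig_sub f A B).symm =
      C.wk (C.wk f A) B ≫ pair A B
  elim : ∀ {Γ : E} (A : C.Ty Γ) (B : C.Ty (C.ext A)) (D : C.Ty (C.ext (sig A B)))
    (M : C.Tm (C.ext B)), C.tp M = C.sub (pair A B) D → C.Tm (C.ext (sig A B))
  tp_elim : ∀ {Γ : E} (A : C.Ty Γ) (B : C.Ty (C.ext A)) (D : C.Ty (C.ext (sig A B)))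
    (M : C.Tm (C.ext B)) (h : C.tp M = C.sub (pair A B) D), C.tp (elim A B D M h) = D
  elim_pair : ∀ {Γ : E} (A : C.Ty Γ) (B : C.Ty (C.ext A)) (D : C.Ty (C.ext (sig A B)))
    (M : C.Tm (C.ext B)) (h : C.tp M = C.sub (pair A B) D),
    C.tsub (pair A B) (elim A B D M h) = M
  elim_sub : ∀ {Δ Γ : E} (f : Δ ⟶ Γ) (A : C.Ty Γ) (B : C.Ty (C.ext A))
    (D : C.Ty (C.ext (sig A B))) (M : C.Tm (C.ext B)) (h : C.tp M = C.sub (pair A B) D),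
    C.tsub (C.wkOf f (sig A B) _ (sig_sub f A B).symm) (elim A B D M h) =
      elim (C.sub f A) (C.sub (C.wk f A) B)
        (C.sub (C.wkOf f (sig A B) _ (sig_sub f A B).symm) D)
        (C.tsub (C.wk (C.wk f A) B) M)
        (by rw [C.tp_tsub, h, ← C.sub_comp, ← C.sub_comp, pair_sub])

/-- `Σ A B` is the dependent sum of the family `B`: pairing is an isomorphism
`Γ.A.B ≅ Γ.(Σ A B)`. -/
def SigmaTypes.IsDependentSum {C : CwF.{w₁, w₂} E} (S : C.SigmaTypes) : Prop :=
  ∀ {Γ : E} (A : C.Ty Γ) (B : C.Ty (C.ext A)), IsIso (S.pair A B)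

/-- The structure by which a category with families supports `Π`-types: formation, abstraction,
application and the computation rule, all stable under re-indexing. -/
structure PiTypes where
  pi : ∀ {Γ : E} (A : C.Ty Γ), C.Ty (C.ext A) → C.Ty Γ
  pi_sub : ∀ {Δ Γ : E} (f : Δ ⟶ Γ) (A : C.Ty Γ) (B : C.Ty (C.ext A)),
    C.sub f (pi A B) = pi (C.sub f A) (C.sub (C.wk f A) B)
  lam : ∀ {Γ : E} (A : C.Ty Γ) (B : C.Ty (C.ext A)) (M : C.Tm (C.ext A)), C.tp M = B → C.Tm Γ
  tp_lam : ∀ {Γ : E} (A : C.Ty Γ) (B : C.Ty (C.ext A)) (M : C.Tm (C.ext A)) (h : C.tp M = B),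
    C.tp (lam A B M h) = pi A B
  app : ∀ {Γ : E} (A : C.Ty Γ) (B : C.Ty (C.ext A)) (F N : C.Tm Γ),
    C.tp F = pi A B → C.tp N = A → C.Tm Γ
  tp_app : ∀ {Γ : E} (A : C.Ty Γ) (B : C.Ty (C.ext A)) (F N : C.Tm Γ)
    (hF : C.tp F = pi A B) (hN : C.tp N = A),
    C.tp (app A B F N hF hN) = C.sub (C.inst N hN) B
  app_lam : ∀ {Γ : E} (A : C.Ty Γ) (B : C.Ty (C.ext A)) (M : C.Tm (C.ext A)) (N : C.Tm Γ)
    (hM : C.tp M = B) (hN : C.tp N = A),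
    app A B (lam A B M hM) N (tp_lam A B M hM) hN = C.tsub (C.inst N hN) M
  lam_sub : ∀ {Δ Γ : E} (f : Δ ⟶ Γ) (A : C.Ty Γ) (B : C.Ty (C.ext A)) (M : C.Tm (C.ext A))
    (h : C.tp M = B),
    C.tsub f (lam A B M h) =
      lam (C.sub f A) (C.sub (C.wk f A) B) (C.tsub (C.wk f A) M) (by rw [C.tp_tsub, h])
  app_sub : ∀ {Δ Γ : E} (f : Δ ⟶ Γ) (A : C.Ty Γ) (B : C.Ty (C.ext A)) (F N : C.Tm Γ)
    (hF : C.tp F = pi A B) (hN : C.tp N = A),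
    C.tsub f (app A B F N hF hN) =
      app (C.sub f A) (C.sub (C.wk f A) B) (C.tsub f F) (C.tsub f N)
        (by rw [C.tp_tsub, hF, pi_sub]) (by rw [C.tp_tsub, hN])

/-- `Π A B` is the dependent product of the family `B`: moreover every element of it is the
abstraction of its application to the generic element, so that (everything being stable under
re-indexing) elements of `Π A B` over any stage `Δ ⟶ Γ` correspond bijectively to elements of
`B` over `Δ.A`. -/
def PiTypes.IsDependentProduct {C : CwF.{w₁, w₂} E} (P : C.PiTypes) : Prop :=
  ∀ {Γ : E} (A : C.Ty Γ) (B : C.Ty (C.ext A)) (F : C.Tm Γ), C.tp F = P.pi A B →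
    ∃ M : C.Tm (C.ext A), ∃ h : C.tp M = B, P.lam A B M h = F

end CwF

/-! ### The category with families of a topos -/

section TopoCwF

variable {E : Type u} [Category.{v} E]

/-- A family over `Γ` in the local universes presentation: a morphism `disp : total ⟶ base`
together with `cls : Γ ⟶ base`. It stands for the pullback of `disp` along `cls`. -/
structure Family (Γ : E) where
  base : E
  total : E
  disp : total ⟶ base
  cls : Γ ⟶ base

/-- A family over `Γ` together with an element of it, that is, a lift `elt : Γ ⟶ total` of the
classifying morphism `elt ≫ disp` of the family. -/
structure FamilyElt (Γ : E) where
  base : E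
  total : E
  disp : total ⟶ base
  elt : Γ ⟶ total

namespace FamilyElt

/-- The family that an element belongs to. -/
def fam {Γ : E} (t : FamilyElt Γ) : Family Γ := ⟨t.base, t.total, t.disp, t.elt ≫ t.disp⟩

/-- The lift of the classifying morphism of `A` given by an element of `A`. -/
def lift {Γ : E} (t : FamilyElt Γ) (A : Family Γ) (h : t.fam = A) : Γ ⟶ A.total :=
  t.elt ≫ eqToHom (congrArg Family.total h)

lemma lift_disp {Γ : E} (t : FamilyElt Γ) (A : Family Γ) (h : t.fam = A) :
    t.lift A h ≫ A.disp = A.cls := by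
  subst h; simp [lift, fam]

lemma eq_of_lift {Γ : E} (t : FamilyElt Γ) (A : Family Γ) (h : t.fam = A) :
    (⟨A.base, A.total, A.disp, t.lift A h⟩ : FamilyElt Γ) = t := by
  subst h; simp [lift, fam]

end FamilyElt

variable (E) in
/-- The category with families associated with a category with pullbacks (in particular with a
topos) by the local universes construction. Re-indexing is precomposition, the comprehension
objects are pullbacks, and every morphism `X ⟶ Γ` is the projection of a family over `Γ` up to
isomorphism. -/
def toposCwF [HasPullbacks E] : CwF.{max u v, max u v} E where
  Ty Γ := Family Γ
  Tm Γ := FamilyElt Γ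
  tp t := t.fam
  sub f A := ⟨A.base, A.total, A.disp, f ≫ A.cls⟩
  tsub f t := ⟨t.base, t.total, t.disp, f ≫ t.elt⟩
  sub_id A := by simp
  sub_comp g f A := by simp
  tsub_id t := by simp
  tsub_comp g f t := by simp
  tp_tsub f t := by simp [FamilyElt.fam]
  ext A := pullback A.cls A.disp
  p A := pullback.fst A.cls A.disp
  v A := ⟨A.base, A.total, A.disp, pullback.snd A.cls A.disp⟩
  tp_v A := by simp [FamilyElt.fam, pullback.condition]
  cons {_ _ A} f t h := pullback.lift f (t.lift ⟨A.base, A.total, A.disp, f ≫ A.cls⟩ h)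
    (FamilyElt.lift_disp t _ h).symm
  cons_p f t h := pullback.lift_fst _ _ _
  cons_v f t h := by
    rw [pullback.lift_snd]; exact FamilyElt.eq_of_lift t _ h
  cons_uniq f t h m h₁ h₂ := by
    subst h₂
    apply pullback.hom_ext
    · rw [pullback.lift_fst, h₁]
    · rw [pullback.lift_snd]; simp [FamilyElt.lift]

end TopoCwF

/-! ### Ordered commutative ring objects -/

section OrderedRing

variable (E : Type u) [Category.{v} E] [CartesianMonoidalCategory E] [HasPullbacks E]

/-- An ordered commutative ring object. The equational and Horn axioms of the internal language
are stated for generalized elements `i j k : X ⟶ R`; totality says that the join of the subobject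
`≤` of `R × R` and its opposite is all of `R × R`. -/
structure OrderedCommRingObj where
  R : E
  leSub : Subobject (R ⊗ R)
  zero : 𝟙_ E ⟶ R
  add : R ⊗ R ⟶ R
  neg : R ⟶ R
  one : 𝟙_ E ⟶ R
  mul : R ⊗ R ⟶ R
  le_refl : ∀ {X : E} (i : X ⟶ R), leSub.Factors (lift i i)
  le_trans : ∀ {X : E} (i j k : X ⟶ R),
    leSub.Factors (lift i j) → leSub.Factors (lift j k) → leSub.Factors (lift i k)
  le_antisymm : ∀ {X : E} (i j : X ⟶ R),
    leSub.Factors (lift i j) → leSub.Factors (lift j i) → i = j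
  le_total : IsLUB {leSub, (Subobject.pullback (lift (snd R R) (fst R R))).obj leSub} ⊤
  add_assoc : ∀ {X : E} (i j k : X ⟶ R),
    lift i (lift j k ≫ add) ≫ add = lift (lift i j ≫ add) k ≫ add
  zero_add : ∀ {X : E} (i : X ⟶ R), lift (toUnit X ≫ zero) i ≫ add = i
  add_comm : ∀ {X : E} (i j : X ⟶ R), lift i j ≫ add = lift j i ≫ add
  add_neg : ∀ {X : E} (i : X ⟶ R), lift i (i ≫ neg) ≫ add = toUnit X ≫ zero
  add_le_add : ∀ {X : E} (i j k : X ⟶ R), leSub.Factors (lift i j) →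
    leSub.Factors (lift (lift k i ≫ add) (lift k j ≫ add))
  mul_assoc : ∀ {X : E} (i j k : X ⟶ R),
    lift i (lift j k ≫ mul) ≫ mul = lift (lift i j ≫ mul) k ≫ mul
  one_mul : ∀ {X : E} (i : X ⟶ R), lift (toUnit X ≫ one) i ≫ mul = i
  mul_comm : ∀ {X : E} (i j : X ⟶ R), lift i j ≫ mul = lift j i ≫ mul
  mul_add : ∀ {X : E} (i j k : X ⟶ R),
    lift i (lift j k ≫ add) ≫ mul = lift (lift i j ≫ mul) (lift i k ≫ mul) ≫ add
  mul_nonneg : ∀ {X : E} (i j : X ⟶ R), leSub.Factors (lift (toUnit X ≫ zero) i) →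
    leSub.Factors (lift (toUnit X ≫ zero) j) →
    leSub.Factors (lift (toUnit X ≫ zero) (lift i j ≫ mul))

end OrderedRing

namespace OrderedCommRingObj

variable {E : Type u} [Category.{v} E] [CartesianMonoidalCategory E] [HasPullbacks E]
variable (K : OrderedCommRingObj E)

/-- The positive cone `{i | 0 ≤ i}` as a subobject of `R`. -/
def posSub : Subobject K.R :=
  (Subobject.pullback (lift (toUnit K.R ≫ K.zero) (𝟙 K.R))).obj K.leSub

/-- The positive cone `R₊`. -/
def pos : E := Subobject.underlying.obj K.posSub

/-- The inclusion of the positive cone. -/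
def incl : K.pos ⟶ K.R := K.posSub.arrow

instance : Mono K.incl := inferInstanceAs (Mono K.posSub.arrow)

/-- `i ≤ j` for generalized elements of the positive cone. -/
def Le {X : E} (i j : X ⟶ K.pos) : Prop := K.leSub.Factors (lift (i ≫ K.incl) (j ≫ K.incl))

lemma posSub_factors_iff {X : E} (i : X ⟶ K.R) :
    K.posSub.Factors i ↔ K.leSub.Factors (lift (toUnit X ≫ K.zero) i) := by
  have e : i ≫ lift (toUnit K.R ≫ K.zero) (𝟙 K.R) = lift (toUnit X ≫ K.zero) i := by
    ext <;> simp [← Category.assoc]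
  have hp := Subobject.isPullback (lift (toUnit K.R ≫ K.zero) (𝟙 K.R)) K.leSub
  rw [← e]
  constructor
  · intro h
    have h' : K.leSub.Factors ((K.posSub.factorThru i h ≫ Subobject.pullbackπ _ K.leSub) ≫
        K.leSub.arrow) := Subobject.factors_comp_arrow _
    have w : (K.posSub.factorThru i h ≫ Subobject.pullbackπ _ K.leSub) ≫ K.leSub.arrow =
        i ≫ lift (toUnit K.R ≫ K.zero) (𝟙 K.R) := by
      refine (Category.assoc _ _ _).trans ((congrArg (K.posSub.factorThru i h ≫ ·) hp.w).trans ?_)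
      refine (Category.assoc _ _ _).symm.trans ?_
      exact congrArg (· ≫ lift (toUnit K.R ≫ K.zero) (𝟙 K.R)) (Subobject.factorThru_arrow _ i h)
    rwa [w] at h'
  · intro h
    have h' : K.posSub.Factors
        (hp.lift (K.leSub.factorThru _ h) i (by rw [Subobject.factorThru_arrow]) ≫
          K.posSub.arrow) := Subobject.factors_comp_arrow _
    have e' : hp.lift (K.leSub.factorThru _ h) i (by rw [Subobject.factorThru_arrow]) ≫
          K.posSub.arrow = i := hp.lift_snd _ _ _
    rwa [e'] at h'

/-- Zero, as a global element of the positive cone. -/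
def posZero : 𝟙_ E ⟶ K.pos :=
  K.posSub.factorThru K.zero ((K.posSub_factors_iff _).2 (by
    have h := K.le_refl K.zero
    rwa [show toUnit (𝟙_ E) = 𝟙 _ from toUnit_unique _ _, Category.id_comp]))

/-- Addition on the positive cone. -/
def posAdd : K.pos ⊗ K.pos ⟶ K.pos :=
  K.posSub.factorThru (lift (fst _ _ ≫ K.incl) (snd _ _ ≫ K.incl) ≫ K.add)
    ((K.posSub_factors_iff _).2 (by
      have h1 : K.leSub.Factors (lift (toUnit _ ≫ K.zero) (fst K.pos K.pos ≫ K.incl)) :=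
        (K.posSub_factors_iff _).1 (Subobject.factors_comp_arrow _)
      have h2 : K.leSub.Factors (lift (toUnit _ ≫ K.zero) (snd K.pos K.pos ≫ K.incl)) :=
        (K.posSub_factors_iff _).1 (Subobject.factors_comp_arrow _)
      have h3 := K.add_le_add _ _ (fst K.pos K.pos ≫ K.incl) h2
      rw [K.add_comm _ (toUnit _ ≫ K.zero), K.zero_add] at h3
      exact K.le_trans _ _ _ h1 h3))

/-- Zero as a generalized element of the positive cone. -/
def z (X : E) : X ⟶ K.pos := toUnit X ≫ K.posZero

/-- Addition of generalized elements of the positive cone. -/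
def plus {X : E} (i j : X ⟶ K.pos) : X ⟶ K.pos := lift i j ≫ K.posAdd

lemma comp_z {X Y : E} (f : Y ⟶ X) : f ≫ K.z X = K.z Y := by
  rw [z, z, ← Category.assoc, toUnit_unique (f ≫ toUnit X)]

lemma comp_plus {X Y : E} (f : Y ⟶ X) (i j : X ⟶ K.pos) :
    f ≫ K.plus i j = K.plus (f ≫ i) (f ≫ j) := by
  rw [plus, plus, ← Category.assoc, comp_lift]

end OrderedCommRingObj

/-! ### Moore paths -/

section Paths

variable {E : Type u} [Category.{v} E] [CartesianMonoidalCategory E] [HasFiniteLimits E]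
variable [MonoidalClosed E] (K : OrderedCommRingObj E)

/-- The value `f i`, for generalized elements `f` of the exponential `R₊ ⇨ Γ` and `i` of `R₊`. -/
def appFn {Γ X : E} (f : X ⟶ (ihom K.pos).obj Γ) (i : X ⟶ K.pos) : X ⟶ Γ :=
  lift i f ≫ (ihom.ev K.pos).app Γ

/-- The map `(f, i) ↦ (λ k, f (i + k))`. -/
def shifted (Γ : E) : (ihom K.pos).obj Γ ⊗ K.pos ⟶ (ihom K.pos).obj Γ :=
  MonoidalClosed.curry (appFn K (snd _ _ ≫ fst _ _) (K.plus (snd _ _ ≫ snd _ _) (fst _ _)))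

/-- The map `(f, i) ↦ (λ k, f i)`. -/
def stopped (Γ : E) : (ihom K.pos).obj Γ ⊗ K.pos ⟶ (ihom K.pos).obj Γ :=
  MonoidalClosed.curry (appFn K (snd K.pos _ ≫ fst _ _) (snd _ _ ≫ snd _ _))

/-- The object of all Moore paths in `Γ`: the subobject of `(R₊ ⇨ Γ) × R₊` of those `(f, i)`
with `f (i + k) = f i` for all `k`, that is, with `f j` equal to the end point `f i` for all
`j ≥ i`. With the end points `(src, tgt)` it is the family `x ∼ y` over `Γ × Γ`. -/
def PathObj (Γ : E) : E := equalizer (shifted K Γ) (stopped K Γ)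

namespace PathObj

variable {K}

/-- The inclusion of Moore paths into `(R₊ ⇨ Γ) × R₊`. -/
def incl (Γ : E) : PathObj K Γ ⟶ (ihom K.pos).obj Γ ⊗ K.pos := equalizer.ι _ _

/-- The shape of a path. -/
def shape {X Γ : E} (q : X ⟶ PathObj K Γ) : X ⟶ K.pos := q ≫ incl Γ ≫ snd _ _

/-- The value `q i` of a path `q` at `i`. -/
def val {X Γ : E} (q : X ⟶ PathObj K Γ) (i : X ⟶ K.pos) : X ⟶ Γ :=
  appFn K (q ≫ incl Γ ≫ fst _ _) i

/-- The starting point of a path. -/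
def src {X Γ : E} (q : X ⟶ PathObj K Γ) : X ⟶ Γ := val q (K.z X)

/-- The end point of a path. -/
def tgt {X Γ : E} (q : X ⟶ PathObj K Γ) : X ⟶ Γ := val q (shape q)

lemma comp_appFn {Γ X Y : E} (g : Y ⟶ X) (f : X ⟶ (ihom K.pos).obj Γ) (i : X ⟶ K.pos) :
    g ≫ appFn K f i = appFn K (g ≫ f) (g ≫ i) := by
  rw [appFn, appFn, ← Category.assoc, comp_lift]

lemma appFn_curry {Γ X Y : E} (g : K.pos ⊗ X ⟶ Γ) (f : Y ⟶ X) (i : Y ⟶ K.pos) :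
    appFn K (f ≫ MonoidalClosed.curry g) i = lift i f ≫ g := by
  have : lift i (f ≫ MonoidalClosed.curry g) = lift i f ≫ (K.pos ◁ MonoidalClosed.curry g) := by
    ext <;> simp
  rw [appFn, this, Category.assoc, ← MonoidalClosed.uncurry_eq, MonoidalClosed.uncurry_curry]

lemma hom_ext_fn {Γ X : E} (f g : X ⟶ (ihom K.pos).obj Γ)
    (h : ∀ {Y : E} (a : Y ⟶ X) (i : Y ⟶ K.pos), appFn K (a ≫ f) i = appFn K (a ≫ g) i) :
    f = g := by
  apply MonoidalClosed.uncurry_injective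
  have := h (snd K.pos X) (fst K.pos X)
  have e : ∀ f : X ⟶ (ihom K.pos).obj Γ, appFn K (snd K.pos X ≫ f) (fst K.pos X) =
      MonoidalClosed.uncurry f := by
    intro f
    rw [appFn, MonoidalClosed.uncurry_eq]
    congr 1
    ext <;> simp
  rwa [e, e] at this

lemma comp_shape {X Y Γ : E} (a : Y ⟶ X) (q : X ⟶ PathObj K Γ) : shape (a ≫ q) = a ≫ shape q :=
  Category.assoc _ _ _

lemma comp_val {X Y Γ : E} (a : Y ⟶ X) (q : X ⟶ PathObj K Γ) (i : X ⟶ K.pos) :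
    a ≫ val q i = val (a ≫ q) (a ≫ i) := by
  rw [val, val, comp_appFn, Category.assoc]

lemma comp_src {X Y Γ : E} (a : Y ⟶ X) (q : X ⟶ PathObj K Γ) : src (a ≫ q) = a ≫ src q := by
  rw [src, src, comp_val, K.comp_z]

lemma comp_tgt {X Y Γ : E} (a : Y ⟶ X) (q : X ⟶ PathObj K Γ) : tgt (a ≫ q) = a ≫ tgt q := by
  rw [tgt, tgt, comp_val, comp_shape]

lemma shifted_apply {Γ X Y : E} (a : Y ⟶ X) (f : X ⟶ (ihom K.pos).obj Γ) (i : X ⟶ K.pos)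
    (k : Y ⟶ K.pos) :
    appFn K (a ≫ lift f i ≫ shifted K Γ) k = appFn K (a ≫ f) (K.plus (a ≫ i) k) := by
  rw [← Category.assoc, shifted, appFn_curry, comp_appFn, K.comp_plus]
  simp

lemma stopped_apply {Γ X Y : E} (a : Y ⟶ X) (f : X ⟶ (ihom K.pos).obj Γ) (i : X ⟶ K.pos)
    (k : Y ⟶ K.pos) :
    appFn K (a ≫ lift f i ≫ stopped K Γ) k = appFn K (a ≫ f) (a ≫ i) := by
  rw [← Category.assoc, stopped, appFn_curry, comp_appFn]
  simp

/-- A generalized path from its two components. -/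
def mk {Γ X : E} (f : X ⟶ (ihom K.pos).obj Γ) (i : X ⟶ K.pos)
    (h : ∀ (Y : E) (a : Y ⟶ X) (k : Y ⟶ K.pos),
      appFn K (a ≫ f) (K.plus (a ≫ i) k) = appFn K (a ≫ f) (a ≫ i)) : X ⟶ PathObj K Γ :=
  equalizer.lift (lift f i) (hom_ext_fn _ _ fun a k => by
    rw [shifted_apply, stopped_apply, h])

lemma mk_incl {Γ X : E} (f : X ⟶ (ihom K.pos).obj Γ) (i : X ⟶ K.pos)
    (h : ∀ (Y : E) (a : Y ⟶ X) (k : Y ⟶ K.pos),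
      appFn K (a ≫ f) (K.plus (a ≫ i) k) = appFn K (a ≫ f) (a ≫ i)) :
    mk f i h ≫ incl Γ = lift f i := equalizer.lift_ι _ _

lemma shape_mk {Γ X : E} (f : X ⟶ (ihom K.pos).obj Γ) (i : X ⟶ K.pos)
    (h : ∀ (Y : E) (a : Y ⟶ X) (k : Y ⟶ K.pos),
      appFn K (a ≫ f) (K.plus (a ≫ i) k) = appFn K (a ≫ f) (a ≫ i)) :
    shape (mk f i h) = i := by
  rw [shape, ← Category.assoc, mk_incl, lift_snd]

lemma val_mk {Γ X : E} (f : X ⟶ (ihom K.pos).obj Γ) (i : X ⟶ K.pos)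
    (h : ∀ (Y : E) (a : Y ⟶ X) (k : Y ⟶ K.pos),
      appFn K (a ≫ f) (K.plus (a ≫ i) k) = appFn K (a ≫ f) (a ≫ i)) (j : X ⟶ K.pos) :
    val (mk f i h) j = appFn K f j := by
  rw [val, ← Category.assoc, mk_incl, lift_fst]

lemma stable {Γ X : E} (q : X ⟶ PathObj K Γ) (k : X ⟶ K.pos) :
    val q (K.plus (shape q) k) = tgt q := by
  have e : lift (incl Γ ≫ fst _ _) (incl Γ ≫ snd _ _) = incl (K := K) Γ := by ext <;> simp
  have w : incl Γ ≫ shifted K Γ = incl Γ ≫ stopped K Γ := equalizer.condition _ _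
  have h1 := shifted_apply q (incl (K := K) Γ ≫ fst _ _) (incl Γ ≫ snd _ _) k
  have h2 := stopped_apply q (incl (K := K) Γ ≫ fst _ _) (incl Γ ≫ snd _ _) k
  rw [e] at h1 h2
  rw [w, h2] at h1
  exact h1.symm

lemma ext_path {Γ X : E} (q r : X ⟶ PathObj K Γ) (hs : shape q = shape r)
    (h : ∀ {Y : E} (a : Y ⟶ X) (i : Y ⟶ K.pos), val (a ≫ q) i = val (a ≫ r) i) : q = r := by
  apply equalizer.hom_ext
  change q ≫ incl Γ = r ≫ incl Γ
  ext
  · rw [Category.assoc, Category.assoc]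
    apply hom_ext_fn
    intro Y a i
    have := h a i
    rwa [val, val, Category.assoc, Category.assoc] at this
  · rw [Category.assoc, Category.assoc]; exact hs

/-- The degenerate path at a generalized element: constant, of shape `0`. -/
def idp {Γ X : E} (x : X ⟶ Γ) : X ⟶ PathObj K Γ :=
  mk (MonoidalClosed.curry (snd _ _ ≫ x)) (K.z X) (by intros; simp [appFn_curry])

/-- The action of a morphism on paths: `γ ' (f, i) = (γ ∘ f, i)`. -/
def map {Δ Γ X : E} (γ : Δ ⟶ Γ) (q : X ⟶ PathObj K Δ) : X ⟶ PathObj K Γ :=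
  mk (q ≫ incl Δ ≫ fst _ _ ≫ (ihom K.pos).map γ) (shape q) (by
    intro Y a k
    have key : ∀ i : Y ⟶ K.pos, appFn K (a ≫ q ≫ incl Δ ≫ fst _ _ ≫ (ihom K.pos).map γ) i =
        val (a ≫ q) i ≫ γ := by
      intro i
      have : lift i (a ≫ q ≫ incl Δ ≫ fst _ _ ≫ (ihom K.pos).map γ) =
        lift i ((a ≫ q) ≫ incl Δ ≫ fst _ _) ≫ (K.pos ◁ (ihom K.pos).map γ) := by ext <;> simp
      rw [appFn, this, Category.assoc, ihom.ev_naturality, val, appFn,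
        Category.assoc, Category.assoc]
    rw [key, key, ← comp_shape, stable, tgt])

lemma shape_idp {Γ X : E} (x : X ⟶ Γ) : shape (idp (K := K) x) = K.z X := shape_mk _ _ _

lemma val_idp {Γ X : E} (x : X ⟶ Γ) (i : X ⟶ K.pos) : val (idp (K := K) x) i = x := by
  rw [idp, val_mk, ← Category.id_comp (MonoidalClosed.curry _), appFn_curry]; simp

lemma shape_map {Δ Γ X : E} (γ : Δ ⟶ Γ) (q : X ⟶ PathObj K Δ) : shape (map γ q) = shape q :=
  shape_mk _ _ _

lemma val_map {Δ Γ X : E} (γ : Δ ⟶ Γ) (q : X ⟶ PathObj K Δ) (i : X ⟶ K.pos) :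
    val (map γ q) i = val q i ≫ γ := by
  have : lift i (q ≫ incl Δ ≫ fst _ _ ≫ (ihom K.pos).map γ) =
    lift i (q ≫ incl Δ ≫ fst _ _) ≫ (K.pos ◁ (ihom K.pos).map γ) := by ext <;> simp
  rw [map, val_mk, appFn, this, Category.assoc, ihom.ev_naturality, val, appFn, Category.assoc]

lemma src_idp {Γ X : E} (x : X ⟶ Γ) : src (idp (K := K) x) = x := val_idp _ _

lemma tgt_idp {Γ X : E} (x : X ⟶ Γ) : tgt (idp (K := K) x) = x := val_idp _ _

lemma src_map {Δ Γ X : E} (γ : Δ ⟶ Γ) (q : X ⟶ PathObj K Δ) : src (map γ q) = src q ≫ γ :=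
  val_map _ _ _

lemma tgt_map {Δ Γ X : E} (γ : Δ ⟶ Γ) (q : X ⟶ PathObj K Δ) : tgt (map γ q) = tgt q ≫ γ := by
  rw [tgt, val_map, shape_map, tgt]

lemma comp_idp {Γ X Y : E} (a : Y ⟶ X) (x : X ⟶ Γ) :
    a ≫ idp (K := K) x = idp (a ≫ x) := by
  apply ext_path
  · rw [comp_shape, shape_idp, shape_idp, K.comp_z]
  · intro Z b i
    have e : ∀ {W : E} (c : W ⟶ X) (i : W ⟶ K.pos), val (c ≫ idp (K := K) x) i = c ≫ x := by
      intro W c i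
      rw [val, ← Category.assoc, Category.assoc c, idp, mk_incl]
      rw [Category.assoc, lift_fst, appFn_curry, ← Category.assoc, lift_snd]
    have e2 : val (b ≫ idp (K := K) (a ≫ x)) i = b ≫ a ≫ x := by
      rw [val, ← Category.assoc, Category.assoc b, idp, mk_incl]
      rw [Category.assoc, lift_fst, appFn_curry, ← Category.assoc, lift_snd]
    rw [← Category.assoc, e, e2, Category.assoc]

lemma comp_map {Δ Γ X Y : E} (a : Y ⟶ X) (γ : Δ ⟶ Γ) (q : X ⟶ PathObj K Δ) :
    a ≫ map γ q = map γ (a ≫ q) := by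
  apply equalizer.hom_ext
  change (a ≫ map γ q) ≫ incl Γ = map γ (a ≫ q) ≫ incl Γ
  rw [Category.assoc, map, mk_incl, map, mk_incl, comp_lift, ← comp_shape, Category.assoc]

lemma map_idp {Δ Γ X : E} (γ : Δ ⟶ Γ) (x : X ⟶ Δ) :
    map γ (idp (K := K) x) = idp (x ≫ γ) := by
  apply ext_path
  · rw [shape_map, shape_idp, shape_idp]
  · intro Y a i
    rw [comp_map, val_map, comp_idp, val_idp, comp_idp, val_idp, Category.assoc]

lemma map_id {Γ X : E} (q : X ⟶ PathObj K Γ) : map (𝟙 Γ) q = q := by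
  apply ext_path
  · rw [shape_map]
  · intro Y a i
    rw [comp_map, val_map, Category.comp_id]

lemma map_comp {Θ Δ Γ X : E} (g : Θ ⟶ Δ) (f : Δ ⟶ Γ) (q : X ⟶ PathObj K Θ) :
    map (g ≫ f) q = map f (map g q) := by
  apply ext_path
  · rw [shape_map, shape_map, shape_map]
  · intro Y a i
    rw [comp_map, val_map, comp_map, val_map, comp_map, val_map, Category.assoc]

/-- `r` is the reversal of the path `q`: it has the same shape, and `r i = q (|q| - i)` for
`i ≤ |q|`, that is, `r i = q j` whenever `i + j = |q|`. -/
def IsRev {Γ X : E} (q r : X ⟶ PathObj K Γ) : Prop :=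
  shape r = shape q ∧ ∀ {Y : E} (a : Y ⟶ X) (i j : Y ⟶ K.pos),
    K.plus i j = a ≫ shape q → val (a ≫ r) i = val (a ≫ q) j

/-- `r` is the initial segment of `q` up to `i` (where `i ≤ |q|`): it has shape `i` and
`r j = q j` for `j ≤ i`. -/
def IsUpTo {Γ X : E} (q : X ⟶ PathObj K Γ) (i : X ⟶ K.pos) (r : X ⟶ PathObj K Γ) : Prop :=
  shape r = i ∧ ∀ {Y : E} (a : Y ⟶ X) (j : Y ⟶ K.pos),
    K.Le j (a ≫ i) → val (a ≫ r) j = val (a ≫ q) j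

end PathObj

/-! ### Transport along paths -/

/-- A transport-along-paths structure on a family `A` over `Γ`: a family of morphisms
`(x ∼ y) → (A x → A y)` indexed by `(x, y)` in `Γ × Γ`, sending degenerate paths to identities.
It is given through its action on generalized elements: a path `q` and an element `a` of
`A (src q)` at stage `X` are sent to an element of `A (tgt q)` at stage `X`, naturally in `X`.
By the Yoneda lemma this is the same as a single morphism on the object of all pairs `(q, a)`. -/
structure Tap (C : CwF.{w₁, w₂} E) {Γ : E} (A : C.Ty Γ) where
  tr : ∀ {X : E} (q : X ⟶ PathObj K Γ) (a : C.Tm X), C.tp a = C.sub (PathObj.src q) A → C.Tm X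
  tp_tr : ∀ {X : E} (q : X ⟶ PathObj K Γ) (a : C.Tm X) (h : C.tp a = C.sub (PathObj.src q) A),
    C.tp (tr q a h) = C.sub (PathObj.tgt q) A
  tr_nat : ∀ {X Y : E} (f : Y ⟶ X) (q : X ⟶ PathObj K Γ) (a : C.Tm X)
    (h : C.tp a = C.sub (PathObj.src q) A),
    C.tsub f (tr q a h) =
      tr (f ≫ q) (C.tsub f a) (by rw [C.tp_tsub, h, PathObj.comp_src, C.sub_comp])
  tr_idp : ∀ {X : E} (x : X ⟶ Γ) (a : C.Tm X) (h : C.tp a = C.sub x A),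
    tr (PathObj.idp x) a (by rw [PathObj.src_idp, h]) = a

/-- A fibration over `Γ`: a family equipped with a tap structure. -/
structure Fib (C : CwF.{w₁, w₂} E) (Γ : E) where
  ty : C.Ty Γ
  tap : Tap K C ty

namespace Fib

variable {K} {C : CwF.{w₁, w₂} E}

/-- Re-indexing of fibrations: transport along `q` in `A[γ]` is transport along `γ ' q` in `A`. -/
def sub {Δ Γ : E} (γ : Δ ⟶ Γ) (A : Fib K C Γ) : Fib K C Δ where
  ty := C.sub γ A.ty
  tap :=
    { tr := fun q a h => A.tap.tr (PathObj.map γ q) a (by rw [h, PathObj.src_map, C.sub_comp])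
      tp_tr := fun q a h => by rw [A.tap.tp_tr, PathObj.tgt_map, C.sub_comp]
      tr_nat := fun f q a h => by
        rw [A.tap.tr_nat]
        congr 1
        exact PathObj.comp_map f γ q
      tr_idp := fun x a h => by
        have h' : C.tp a = C.sub (x ≫ γ) A.ty := by rw [h, C.sub_comp]
        refine Eq.trans ?_ (A.tap.tr_idp (x ≫ γ) a h')
        congr 1
        exact PathObj.map_idp γ x }

lemma ext_fib {Γ : E} {A B : Fib K C Γ} (h : A.ty = B.ty)
    (ht : ∀ {X : E} (q : X ⟶ PathObj K Γ) (a : C.Tm X) (h₁ : C.tp a = C.sub (PathObj.src q) A.ty)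
      (h₂ : C.tp a = C.sub (PathObj.src q) B.ty), A.tap.tr q a h₁ = B.tap.tr q a h₂) : A = B := by
  obtain ⟨A, tA⟩ := A
  obtain ⟨B, tB⟩ := B
  dsimp only at h
  subst h
  obtain ⟨trA, _, _, _⟩ := tA
  obtain ⟨trB, _, _, _⟩ := tB
  have : @trA = @trB := by
    funext X q a h
    exact ht q a h h
  subst this
  rfl

lemma tr_congr {Γ X : E} {A : C.Ty Γ} (t : Tap K C A) {q r : X ⟶ PathObj K Γ} (e : q = r)
    (a : C.Tm X) (h : C.tp a = C.sub (PathObj.src q) A) (h' : C.tp a = C.sub (PathObj.src r) A) :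
    t.tr q a h = t.tr r a h' := by
  subst e; rfl

/-- `l` is the lift of the path `q` to the comprehension object of `A` starting at `a`: it has
the shape of `q`, and at `i ≤ |q|` its value is `(q i, u_* a)`, where `u` is the initial segment
of `q` up to `i`. -/
def IsLift {Γ X : E} (A : Fib K C Γ) (q : X ⟶ PathObj K Γ) (a : C.Tm X)
    (l : X ⟶ PathObj K (C.ext A.ty)) : Prop :=
  PathObj.shape l = PathObj.shape q ∧ ∀ {Y : E} (f : Y ⟶ X) (i : Y ⟶ K.pos), K.Le i (f ≫ PathObj.shape q) →
    ∃ u : Y ⟶ PathObj K Γ, PathObj.IsUpTo (f ≫ q) i u ∧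
      ∃ h : C.tp (C.tsub f a) = C.sub (PathObj.src u) A.ty,
        PathObj.val (f ≫ l) i =
          C.cons (PathObj.tgt u) (A.tap.tr u (C.tsub f a) h) (A.tap.tp_tr u (C.tsub f a) h)

end Fib

/-- An element of a fibration, together with the fibration that it belongs to: it is an element
of the underlying family. -/
structure FibElt (C : CwF.{w₁, w₂} E) (Γ : E) where
  fib : Fib K C Γ
  tm : C.Tm Γ
  tp_tm : C.tp tm = fib.ty

/-- The category with families of fibrations. -/
def fibCwF (C : CwF.{w₁, w₂} E) : CwF.{max u v w₁ w₂, max u v w₁ w₂} E where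
  Ty Γ := Fib K C Γ
  Tm Γ := FibElt K C Γ
  tp t := t.fib
  sub f A := A.sub f
  tsub f t := ⟨t.fib.sub f, C.tsub f t.tm, by rw [C.tp_tsub, t.tp_tm]; rfl⟩
  sub_id A := Fib.ext_fib (C.sub_id _) fun q a h₁ h₂ => Fib.tr_congr _ (PathObj.map_id q) _ _ _
  sub_comp g f A := Fib.ext_fib (C.sub_comp _ _ _) fun q a h₁ h₂ =>
    Fib.tr_congr _ (PathObj.map_comp g f q) _ _ _
  tsub_id t := by
    obtain ⟨A, t, h⟩ := t
    have : A.sub (𝟙 _) = A :=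
      Fib.ext_fib (C.sub_id _) fun q a h₁ h₂ => Fib.tr_congr _ (PathObj.map_id q) _ _ _
    simp only [FibElt.mk.injEq]
    exact ⟨this, C.tsub_id t⟩
  tsub_comp g f t := by
    obtain ⟨A, t, h⟩ := t
    have : A.sub (g ≫ f) = (A.sub f).sub g :=
      Fib.ext_fib (C.sub_comp _ _ _) fun q a h₁ h₂ =>
        Fib.tr_congr _ (PathObj.map_comp g f q) _ _ _
    simp only [FibElt.mk.injEq]
    exact ⟨this, C.tsub_comp g f t⟩
  tp_tsub f t := rfl
  ext A := C.ext A.ty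
  p A := C.p A.ty
  v A := ⟨A.sub (C.p A.ty), C.v A.ty, C.tp_v A.ty⟩
  tp_v A := rfl
  cons {_ _ A} f t h := C.cons f t.tm (by rw [t.tp_tm, h]; rfl)
  cons_p f t h := C.cons_p _ _ _
  cons_v f t h := by
    obtain ⟨A, t, h'⟩ := t
    dsimp only at h
    subst h
    simp only [FibElt.mk.injEq]
    refine ⟨?_, C.cons_v _ _ _⟩
    rename_i Δ Γ A
    have e : C.cons f t h' ≫ C.p A.ty = f := C.cons_p _ _ _
    have e2 : (A.sub (C.p A.ty)).sub (C.cons f t h') = A.sub (C.cons f t h' ≫ C.p A.ty) :=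
      (Fib.ext_fib (C.sub_comp _ _ _) fun q a h₁ h₂ =>
        Fib.tr_congr _ (PathObj.map_comp _ _ q) _ _ _).symm
    exact e2.trans (by rw [e])
  cons_uniq f t h m h₁ h₂ := C.cons_uniq _ _ _ _ h₁ (congrArg FibElt.tm h₂)

/-! ### Transport in dependent sums and products -/

/-- The element `(a, b)` of `Σ A B` at stage `X` given by `x : X ⟶ Γ.A` (that is, a point of `Γ`
and an element `a` of `A` over it) and an element `b` of `B` over `x`. -/
def pairElt {C : CwF.{w₁, w₂} E} (S : C.SigmaTypes) {X Γ : E} {A : C.Ty Γ} {B : C.Ty (C.ext A)}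
    (x : X ⟶ C.ext A) (b : C.Tm X) (hb : C.tp b = C.sub x B) : C.Tm X :=
  C.tsub (C.cons x b hb ≫ S.pair A B) (C.v (S.sig A B))

lemma tp_pairElt {C : CwF.{w₁, w₂} E} (S : C.SigmaTypes) {X Γ : E} {A : C.Ty Γ}
    {B : C.Ty (C.ext A)} (x : X ⟶ C.ext A) (b : C.Tm X) (hb : C.tp b = C.sub x B) (y : X ⟶ Γ)
    (hy : x ≫ C.p A = y) : C.tp (pairElt S x b hb) = C.sub y (S.sig A B) := by
  rw [pairElt, C.tp_tsub, C.tp_v, ← C.sub_comp, Category.assoc, S.pair_p, ← Category.assoc,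
    C.cons_p, hy]

/-- The element `F a` of `B` over `(x, a)` at stage `X`, for elements `F` of `(Π A B) x` and `a`
of `A x`. -/
def appElt {C : CwF.{w₁, w₂} E} (P : C.PiTypes) {X Γ : E} {A : C.Ty Γ} {B : C.Ty (C.ext A)}
    (x : X ⟶ Γ) (F a : C.Tm X) (hF : C.tp F = C.sub x (P.pi A B)) (ha : C.tp a = C.sub x A) :
    C.Tm X :=
  P.app (C.sub x A) (C.sub (C.wk x A) B) F a (by rw [hF, P.pi_sub]) ha

/-- Transport in `Σ A B` is `q_* (a, b) = (q_* a, l_* b)`, where `l` is the lift of `q` at `a`,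
a path from `(src q, a)` to `(tgt q, q_* a)`. -/
def IsSigmaTap {C : CwF.{w₁, w₂} E} (S : C.SigmaTypes) {Γ : E} (A : Fib K C Γ)
    (B : Fib K C (C.ext A.ty)) (t : Tap K C (S.sig A.ty B.ty)) : Prop :=
  ∀ {X : E} (q : X ⟶ PathObj K Γ) (a b : C.Tm X) (ha : C.tp a = C.sub (PathObj.src q) A.ty)
    (hb : C.tp b = C.sub (C.cons (PathObj.src q) a ha) B.ty),
    ∃ l : X ⟶ PathObj K (C.ext A.ty), A.IsLift q a l ∧
      ∃ (hl : C.tp b = C.sub (PathObj.src l) B.ty)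
        (hl' : C.tp (B.tap.tr l b hl) = C.sub
          (C.cons (PathObj.tgt q) (A.tap.tr q a ha) (A.tap.tp_tr q a ha)) B.ty),
        t.tr q (pairElt S (C.cons (PathObj.src q) a ha) b hb)
            (tp_pairElt S _ b hb _ (C.cons_p _ _ _)) =
          pairElt S (C.cons (PathObj.tgt q) (A.tap.tr q a ha) (A.tap.tp_tr q a ha))
            (B.tap.tr l b hl) hl'

/-- Transport in `Π A B` is `(q_* F) a = m_* (F (r_* a))`, where `r` is the reversal of `q` and
`m` is the reversal of the lift of `r` at `a`, a path from `(src q, r_* a)` to `(tgt q, a)`. -/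
def IsPiTap {C : CwF.{w₁, w₂} E} (P : C.PiTypes) {Γ : E} (A : Fib K C Γ)
    (B : Fib K C (C.ext A.ty)) (t : Tap K C (P.pi A.ty B.ty)) : Prop :=
  ∀ {X : E} (q : X ⟶ PathObj K Γ) (F a : C.Tm X)
    (hF : C.tp F = C.sub (PathObj.src q) (P.pi A.ty B.ty))
    (ha : C.tp a = C.sub (PathObj.tgt q) A.ty),
    ∃ (r : X ⟶ PathObj K Γ) (l m : X ⟶ PathObj K (C.ext A.ty)),
      PathObj.IsRev q r ∧ A.IsLift r a l ∧ PathObj.IsRev l m ∧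
      ∃ (hr : C.tp a = C.sub (PathObj.src r) A.ty)
        (hr' : C.tp (A.tap.tr r a hr) = C.sub (PathObj.src q) A.ty)
        (hm : C.tp (appElt P (PathObj.src q) F (A.tap.tr r a hr) hF hr') =
          C.sub (PathObj.src m) B.ty),
        appElt P (PathObj.tgt q) (t.tr q F hF) a (t.tp_tr q F hF) ha =
          B.tap.tr m (appElt P (PathObj.src q) F (A.tap.tr r a hr) hF hr') hm

end Paths

end MoorePaths

end

open MoorePaths

/-!
# Dependent sums and products of Moore-path fibrations in a topos

**The order.** Totality says only that a join of two subobjects is everything. It is used in two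
ways. First, pairs of elements of `R` have minima (`exists_inf`): the pairs that have an infimum
form a subobject containing `≤` and its opposite. Secondly, an equation at any stage may be
checked where `i ≤ j` and where `j ≤ i` (`eq_of_le_total`), because joins are stable under pullback
(`eq_of_isLUB_top`); the right adjoint to pullback that shows this is built inside a power object.

**Paths.** With `min` and truncated subtraction, initial segments, reversals and lifts are given by
explicit formulas: `q|_i` is `j ↦ q (min i j)`, `rev q` is `i ↦ q (|q| - min i |q|)`, and the lift
of `q` at `a` is `i ↦ (u, u_* a)` with `u` the segment of `q` up to `min |q| i`. All of these commute
with change of stage and with the action of morphisms, and are trivial on degenerate paths. The one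
equation that needs the case distinction is `q|_{|q|} = q` (`PathObj.upTo_shape`); it makes the
lift of `q` at `a` end at `(tgt q, q_* a)`.

**Dependent sums and products in the topos.** Both are obtained from partial products: for
`d : T ⟶ V` and `W`, the pairs of `v : V` and a map from the fibre of `d` over `v` to `W` form an
object (`exists_partialProduct`), a subobject of `V` times the exponential by `T` of the object
classifying partial maps into `W`. In the local universes presentation, a pair `A`, `B` of families
is classified by a map into the partial product of `A.disp` and `B.base`, and this object is the
base of both `Σ A B` and `Π A B`. Since their classifying morphisms come from a universal property,
the formers are strictly stable under re-indexing.

**Fibrations.** For dependent sums with invertible pairing, a path acts on a point of `Γ.A.B`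
(`Fib.pairEndPt`), and this action is moved along pairing. For dependent products, the transported
function is the abstraction of its value at the generic argument (`Fib.piVal`); that degenerate
paths act trivially is the `η`-rule, which holds for dependent products. Stability under re-indexing
holds because the lift of `γ ' q` in `A` is the image of the lift of `q` in `A[γ]`
(`Fib.liftPath_map`). The rules for `Σ` and `Π` in the category of fibrations are then those of the
topos, since elements of fibrations are elements of the underlying families.
-/

noncomputable section

namespace MoorePaths

/-! ### Truth values and power objects -/

section Topos

variable {E : Type u} [Category.{v} E]

section Omega

variable [HasSubobjectClassifier E]

/-- The generalized truth value `φ` is true. -/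
def Holds {X : E} (φ : X ⟶ HasSubobjectClassifier.Ω E) : Prop :=
  φ = Subobject.Classifier.χ₀ _ X ≫ HasSubobjectClassifier.truth E

lemma holds_comp {X Y : E} (a : Y ⟶ X) {φ : X ⟶ HasSubobjectClassifier.Ω E} (h : Holds φ) :
    Holds (a ≫ φ) := by
  rw [Holds, h, ← Category.assoc]
  congr 1
  exact Subsingleton.elim _ _

lemma holds_comp_χ_iff {U X Y : E} (m : U ⟶ X) [Mono m] (a : Y ⟶ X) :
    Holds (a ≫ HasSubobjectClassifier.χ m) ↔ ∃ b : Y ⟶ U, b ≫ m = a := by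
  constructor
  · intro h
    exact ⟨_, (HasSubobjectClassifier.isPullback_χ m).lift_fst a _ h⟩
  · rintro ⟨b, rfl⟩
    rw [Category.assoc]
    refine holds_comp b ?_
    exact HasSubobjectClassifier.comm m

/-- Propositional extensionality: truth values that hold at the same stages are equal. -/
lemma omega_ext [HasPullbacks E] {X : E} (φ ψ : X ⟶ HasSubobjectClassifier.Ω E)
    (h : ∀ {Y : E} (a : Y ⟶ X), Holds (a ≫ φ) ↔ Holds (a ≫ ψ)) : φ = ψ := by
  have hp := IsPullback.of_hasPullback φ (HasSubobjectClassifier.truth E)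
  have e0 : pullback.snd φ (HasSubobjectClassifier.truth E) = Subobject.Classifier.χ₀ _ _ :=
    Subsingleton.elim _ _
  rw [e0] at hp
  have key : IsPullback (pullback.fst φ (HasSubobjectClassifier.truth E))
      (Subobject.Classifier.χ₀ _ _) ψ (HasSubobjectClassifier.truth E) := by
    refine ⟨⟨(h _).1 hp.w⟩, ⟨PullbackCone.IsLimit.mk _
      (fun s => hp.lift s.fst s.snd ?_) (fun s => hp.lift_fst _ _ _)
      (fun s => Subsingleton.elim _ _) (fun s m h₁ _ => ?_)⟩⟩
    · have h1 : Holds (s.fst ≫ ψ) :=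
        s.condition.trans (congrArg (· ≫ _) (Subsingleton.elim _ _))
      exact ((h _).2 h1).trans (congrArg (· ≫ _) (Subsingleton.elim _ _))
    · apply hp.hom_ext
      · rw [hp.lift_fst, h₁]
      · exact Subsingleton.elim _ _
  rw [HasSubobjectClassifier.unique _ φ hp, HasSubobjectClassifier.unique _ ψ key]

end Omega

section Exponential

variable [CartesianMonoidalCategory E] [MonoidalClosed E]

/-- The value `f w`, for generalized elements `f` of the exponential `W ⇨ Γ` and `w` of `W`. -/
def evalAt {W Γ X : E} (f : X ⟶ (ihom W).obj Γ) (w : X ⟶ W) : X ⟶ Γ :=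
  lift w f ≫ (ihom.ev W).app Γ

lemma comp_evalAt {W Γ X Y : E} (a : Y ⟶ X) (f : X ⟶ (ihom W).obj Γ) (w : X ⟶ W) :
    a ≫ evalAt f w = evalAt (a ≫ f) (a ≫ w) := by
  rw [evalAt, evalAt, ← Category.assoc, comp_lift]

lemma evalAt_comp_curry {W Γ X Y : E} (g : W ⊗ X ⟶ Γ) (a : Y ⟶ X) (w : Y ⟶ W) :
    evalAt (a ≫ MonoidalClosed.curry g) w = lift w a ≫ g := by
  have : lift w (a ≫ MonoidalClosed.curry g) = lift w a ≫ (W ◁ MonoidalClosed.curry g) := by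
    ext <;> simp
  rw [evalAt, this, Category.assoc, ← MonoidalClosed.uncurry_eq, MonoidalClosed.uncurry_curry]

lemma evalAt_comp_map {W Γ Γ' X : E} (f : X ⟶ (ihom W).obj Γ) (γ : Γ ⟶ Γ') (w : X ⟶ W) :
    evalAt (f ≫ (ihom W).map γ) w = evalAt f w ≫ γ := by
  have : lift w (f ≫ (ihom W).map γ) = lift w f ≫ (W ◁ (ihom W).map γ) := by ext <;> simp
  rw [evalAt, this, Category.assoc, ihom.ev_naturality, evalAt, Category.assoc]

lemma ihom_hom_ext {W Γ X : E} (f g : X ⟶ (ihom W).obj Γ)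
    (h : ∀ {Y : E} (a : Y ⟶ X) (w : Y ⟶ W), evalAt (a ≫ f) w = evalAt (a ≫ g) w) :
    f = g := by
  apply MonoidalClosed.uncurry_injective
  have := h (snd W X) (fst W X)
  have e : ∀ f : X ⟶ (ihom W).obj Γ, evalAt (snd W X ≫ f) (fst W X) =
      MonoidalClosed.uncurry f := by
    intro f
    rw [evalAt, MonoidalClosed.uncurry_eq]
    congr 1
    ext <;> simp
  rwa [e, e] at this

variable [HasSubobjectClassifier E]

/-- The generalized element `w` of `W` belongs to the generalized subset `S` of `W`. -/
def Mem {W X : E} (w : X ⟶ W) (S : X ⟶ (ihom W).obj (HasSubobjectClassifier.Ω E)) : Prop :=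
  Holds (evalAt S w)

/-- The subset of `W`, depending on a parameter in `X`, that is given by a subobject
of `W ⊗ X`. -/
def slices {W X U : E} (m : U ⟶ W ⊗ X) [Mono m] :
    X ⟶ (ihom W).obj (HasSubobjectClassifier.Ω E) :=
  MonoidalClosed.curry (HasSubobjectClassifier.χ m)

lemma mem_comp_slices_iff {W X U Y : E} (m : U ⟶ W ⊗ X) [Mono m] (a : Y ⟶ X) (w : Y ⟶ W) :
    Mem w (a ≫ slices m) ↔ ∃ b : Y ⟶ U, b ≫ m = lift w a := by
  rw [Mem, slices, evalAt_comp_curry, holds_comp_χ_iff]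

/-- Extensionality of subsets. -/
lemma power_ext [HasPullbacks E] {W X : E}
    (S T : X ⟶ (ihom W).obj (HasSubobjectClassifier.Ω E))
    (h : ∀ {Y : E} (a : Y ⟶ X) (w : Y ⟶ W), Mem w (a ≫ S) ↔ Mem w (a ≫ T)) : S = T := by
  refine ihom_hom_ext _ _ fun {Y} a w => omega_ext _ _ fun {Z} b => ?_
  rw [comp_evalAt, comp_evalAt, ← Category.assoc, ← Category.assoc]
  exact h _ _

/-! ### Joins of subobjects -/

/-- If two subobjects of `Y` have join `⊤`, then an equation at stage `X` may be checked where
either of them holds of a given generalized element `f : X ⟶ Y`. That is, joins are stable under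
pullback along `f`: the right adjoint of the pullback is formed in the power object of `X`, as
the object of those `y` for which every point of the fibre of `f` over `y` satisfies the
equation. -/
lemma eq_of_isLUB_top [HasFiniteLimits E] {X Y Γ : E} {A B : Subobject Y} (hAB : IsLUB {A, B} ⊤)
    (f : X ⟶ Y) (g h : X ⟶ Γ)
    (hA : ∀ {Z : E} (a : Z ⟶ X), A.Factors (a ≫ f) → a ≫ g = a ≫ h)
    (hB : ∀ {Z : E} (a : Z ⟶ X), B.Factors (a ≫ f) → a ≫ g = a ≫ h) : g = h := by
  have m₁ : Mono (lift (𝟙 X) f) := ⟨fun a b e => by simpa using congrArg (· ≫ fst _ _) e⟩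
  have m₂ : Mono (equalizer.ι g h ≫ lift (𝟙 X) f) := mono_comp _ _
  let D : Subobject Y := Subobject.mk
    (equalizer.ι (slices (lift (𝟙 X) f)) (slices (equalizer.ι g h ≫ lift (𝟙 X) f)))
  have key : ∀ C : Subobject Y,
      (∀ {Z : E} (a : Z ⟶ X), C.Factors (a ≫ f) → a ≫ g = a ≫ h) → C ≤ D := by
    intro C hC
    refine Subobject.le_mk_of_comm (equalizer.lift C.arrow ?_) (equalizer.lift_ι _ _)
    refine power_ext _ _ fun {Z} a x => ?_
    rw [← Category.assoc, ← Category.assoc, mem_comp_slices_iff, mem_comp_slices_iff]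
    constructor
    · rintro ⟨b, hb⟩
      have h1 : b = x := by simpa using congrArg (· ≫ fst _ _) hb
      have h2 : b ≫ f = a ≫ C.arrow := by simpa using congrArg (· ≫ snd _ _) hb
      refine ⟨equalizer.lift b (hC b ?_), ?_⟩
      · rw [h2]; exact Subobject.factors_comp_arrow _
      · rw [equalizer.lift_ι_assoc, hb]
    · rintro ⟨b, hb⟩
      exact ⟨b ≫ equalizer.ι g h, by rw [Category.assoc, hb]⟩
  have hD : D = ⊤ := top_le_iff.1 (hAB.2 (by
    rintro C (rfl | rfl)
    · exact key _ hA
    · exact key _ hB))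
  have hf : D.Factors f := by rw [hD]; exact Subobject.top_factors f
  obtain ⟨c, hc⟩ := (Subobject.mk_factors_iff _ _).1 hf
  have e : f ≫ slices (lift (𝟙 X) f) = f ≫ slices (equalizer.ι g h ≫ lift (𝟙 X) f) := by
    have hc' : c ≫ equalizer.ι (slices (lift (𝟙 X) f))
      (slices (equalizer.ι g h ≫ lift (𝟙 X) f)) = f := hc
    have w := congrArg (c ≫ ·) (equalizer.condition (slices (lift (𝟙 X) f))
      (slices (equalizer.ι g h ≫ lift (𝟙 X) f)))
    exact (congrArg (· ≫ _) hc'.symm).trans ((Category.assoc _ _ _).trans (w.trans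
      ((Category.assoc _ _ _).symm.trans (congrArg (· ≫ _) hc'))))
  have hm : Mem (𝟙 X) (f ≫ slices (lift (𝟙 X) f)) :=
    (mem_comp_slices_iff _ _ _).2 ⟨𝟙 X, Category.id_comp _⟩
  rw [e, mem_comp_slices_iff] at hm
  obtain ⟨b, hb⟩ := hm
  have h1 : b ≫ equalizer.ι g h = 𝟙 X := by simpa using congrArg (· ≫ fst _ _) hb
  rw [← Category.id_comp g, ← Category.id_comp h, ← h1, Category.assoc, Category.assoc,
    equalizer.condition]

/-! ### Partial maps and partial products -/

/-- Partial maps are representable: there is `η : W ⟶ L` such that maps `X ⟶ L` are the same as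
partial maps from `X` to `W`. Here `L` consists of the subsets `S` of `W` such that
`w ∈ S` if and only if `S = {w}`, for all `w`. -/
lemma exists_partialMapClassifier [HasFiniteLimits E] (W : E) :
    ∃ (L : E) (η : W ⟶ L), Mono η ∧ ∀ {X U : E} (m : U ⟶ X) (_ : Mono m) (f : U ⟶ W),
      ∃! g : X ⟶ L, IsPullback f m η g := by
  have m₁ : Mono (lift (𝟙 W) (𝟙 W)) := ⟨fun a b e => by simpa using congrArg (· ≫ fst _ _) e⟩
  -- the singleton map `w ↦ {w}`
  let sing : W ⟶ (ihom W).obj (HasSubobjectClassifier.Ω E) := slices (lift (𝟙 W) (𝟙 W))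
  have mem_sing : ∀ {Y : E} (w w' : Y ⟶ W), Mem w' (w ≫ sing) ↔ w' = w := by
    intro Y w w'
    rw [mem_comp_slices_iff]
    constructor
    · rintro ⟨b, hb⟩
      have h1 : b = w' := by simpa using congrArg (· ≫ fst _ _) hb
      have h2 : b = w := by simpa using congrArg (· ≫ snd _ _) hb
      rw [← h1, h2]
    · rintro rfl
      exact ⟨w', by simp [comp_lift]⟩
  have sing_inj : ∀ {Y : E} (w w' : Y ⟶ W), w ≫ sing = w' ≫ sing → w = w' := by
    intro Y w w' h
    rw [← mem_sing w' w, ← h, mem_sing]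
  have m₂ : Mono (lift (𝟙 W) sing) := ⟨fun a b e => by simpa using congrArg (· ≫ fst _ _) e⟩
  -- the map `S ↦ {w | S = {w}}`
  let κ := slices (lift (𝟙 W) sing)
  have mem_κ : ∀ {Y : E} (S : Y ⟶ (ihom W).obj (HasSubobjectClassifier.Ω E)) (w : Y ⟶ W),
      Mem w (S ≫ κ) ↔ w ≫ sing = S := by
    intro Y S w
    rw [mem_comp_slices_iff]
    constructor
    · rintro ⟨b, hb⟩
      have h1 : b = w := by simpa using congrArg (· ≫ fst _ _) hb
      have h2 : b ≫ sing = S := by simpa using congrArg (· ≫ snd _ _) hb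
      rw [← h1, h2]
    · rintro rfl
      exact ⟨w, by simp [comp_lift]⟩
  have hL : ∀ {X : E} (S : X ⟶ (ihom W).obj (HasSubobjectClassifier.Ω E)),
      S ≫ κ = S ≫ 𝟙 _ ↔
        ∀ {Y : E} (a : Y ⟶ X) (w : Y ⟶ W), Mem w (a ≫ S) ↔ w ≫ sing = a ≫ S := by
    intro X S
    rw [Category.comp_id]
    constructor
    · intro h Y a w
      rw [← mem_κ, Category.assoc, h]
    · intro h
      refine power_ext _ _ fun a w => ?_
      rw [h, ← mem_κ, Category.assoc]
  have hη : sing ≫ κ = sing ≫ 𝟙 _ := (hL sing).2 fun a w => by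
    rw [mem_sing]
    exact ⟨fun h => by rw [h], fun h => sing_inj _ _ h⟩
  let ι := equalizer.ι κ (𝟙 _)
  let η : W ⟶ equalizer κ (𝟙 _) := equalizer.lift sing hη
  have η_ι : η ≫ ι = sing := equalizer.lift_ι _ _
  have mem_ι : ∀ {Y : E} (s : Y ⟶ equalizer κ (𝟙 _)) (w : Y ⟶ W),
      Mem w (s ≫ ι) ↔ w ≫ η = s := by
    intro Y s w
    have := (hL (s ≫ ι)).1 (by
      rw [Category.assoc, Category.assoc]
      exact congrArg (s ≫ ·) (equalizer.condition κ (𝟙 _))) (𝟙 Y) w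
    rw [Category.id_comp] at this
    rw [this, ← η_ι, ← Category.assoc]
    exact cancel_mono ι
  have mη : Mono η := ⟨fun a b e => sing_inj _ _ (by
    rw [← η_ι, ← Category.assoc, e, Category.assoc])⟩
  refine ⟨equalizer κ (𝟙 _), η, mη, fun {X U} m hm f => ?_⟩
  have m₃ : Mono (lift f m) := ⟨fun a b e => by
    rw [← cancel_mono m]; simpa using congrArg (· ≫ snd _ _) e⟩
  -- the subset `{f u | m u = x}` of `W`, for `x` in `X`
  let S := slices (lift f m)
  have mem_S : ∀ {Y : E} (a : Y ⟶ X) (w : Y ⟶ W),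
      Mem w (a ≫ S) ↔ ∃ b : Y ⟶ U, b ≫ f = w ∧ b ≫ m = a := by
    intro Y a w
    rw [mem_comp_slices_iff]
    refine exists_congr fun b => ?_
    rw [comp_lift]
    constructor
    · intro h
      exact ⟨by simpa using congrArg (· ≫ fst _ _) h, by simpa using congrArg (· ≫ snd _ _) h⟩
    · rintro ⟨rfl, rfl⟩
      rfl
  have hS : S ≫ κ = S ≫ 𝟙 _ := (hL S).2 fun {Y} a w => by
    constructor
    · intro h
      obtain ⟨b, rfl, rfl⟩ := (mem_S a w).1 h
      refine power_ext _ _ fun c w' => ?_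
      rw [← Category.assoc, mem_sing, ← Category.assoc c (b ≫ m), mem_S]
      constructor
      · rintro rfl
        exact ⟨c ≫ b, by simp, by simp⟩
      · rintro ⟨b', rfl, hb'⟩
        rw [← Category.assoc, cancel_mono] at hb'
        rw [hb', Category.assoc]
    · intro h
      rw [← h, mem_sing]
  have lift_ι : equalizer.lift S hS ≫ ι = S := equalizer.lift_ι _ _
  have pb : ∀ {g : X ⟶ equalizer κ (𝟙 _)}, IsPullback f m η g ↔ g = equalizer.lift S hS := by
    intro g
    rw [← cancel_mono ι, lift_ι]
    constructor
    · intro h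
      refine power_ext _ _ fun {Y} a w => ?_
      rw [mem_S, ← Category.assoc, mem_ι]
      constructor
      · intro e
        exact ⟨h.lift _ _ e, h.lift_fst _ _ e, h.lift_snd _ _ e⟩
      · rintro ⟨b, rfl, rfl⟩
        rw [Category.assoc, Category.assoc, h.w]
    · intro hg
      have ex : ∀ {Y : E} (a : Y ⟶ X) (w : Y ⟶ W),
          w ≫ η = a ≫ g ↔ ∃ b : Y ⟶ U, b ≫ f = w ∧ b ≫ m = a := by
        intro Y a w
        rw [← mem_S, ← hg, ← Category.assoc, mem_ι]
      refine ⟨⟨(ex m f).2 ⟨𝟙 U, Category.id_comp _, Category.id_comp _⟩⟩,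
        ⟨PullbackCone.IsLimit.mk _
          (fun s => ((ex s.snd s.fst).1 s.condition).choose)
          (fun s => ((ex s.snd s.fst).1 s.condition).choose_spec.1)
          (fun s => ((ex s.snd s.fst).1 s.condition).choose_spec.2) (fun s k h₁ h₂ => ?_)⟩⟩
      rw [← cancel_mono m, h₂, ((ex s.snd s.fst).1 s.condition).choose_spec.2]
  exact ⟨equalizer.lift S hS, pb.2 rfl, fun g hg => pb.1 hg⟩

/-- A topos has partial products: for `d : T ⟶ V` and an object `W`, there is a universal
morphism `π : P ⟶ V` equipped with a morphism from the pullback of `π` and `d` to `W`.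
A point of `P` over `v : V` is a map to `W` from the fibre of `d` over `v`; it is given as a
partial map from `T` to `W` whose domain is that fibre. -/
lemma exists_partialProduct [HasFiniteLimits E] {T V : E} (d : T ⟶ V) (W : E) :
    ∃ (P : E) (π : P ⟶ V) (e : pullback π d ⟶ W), ∀ {X : E} (c : X ⟶ V) (h : pullback c d ⟶ W),
      ∃! k : X ⟶ P, ∃ hk : k ≫ π = c,
        pullback.lift (pullback.fst c d ≫ k) (pullback.snd c d)
          (by rw [Category.assoc, hk, pullback.condition]) ≫ e = h := by
  obtain ⟨L, η, mη, hL⟩ := exists_partialMapClassifier W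
  have m₁ : Mono (lift (𝟙 T) d) := ⟨fun a b e => by simpa using congrArg (· ≫ fst _ _) e⟩
  let fib : V ⟶ (ihom T).obj (HasSubobjectClassifier.Ω E) := slices (lift (𝟙 T) d)
  have mem_fib : ∀ {Y : E} (v : Y ⟶ V) (t : Y ⟶ T), Mem t (v ≫ fib) ↔ t ≫ d = v := by
    intro Y v t
    rw [mem_comp_slices_iff]
    constructor
    · rintro ⟨b, hb⟩
      have h1 : b = t := by simpa using congrArg (· ≫ fst _ _) hb
      have h2 : b ≫ d = v := by simpa using congrArg (· ≫ snd _ _) hb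
      rw [← h1, h2]
    · rintro rfl
      exact ⟨t, by simp [comp_lift]⟩
  let dom : (ihom T).obj L ⟶ (ihom T).obj (HasSubobjectClassifier.Ω E) :=
    (ihom T).map (HasSubobjectClassifier.χ η)
  have mem_dom : ∀ {Y : E} (G : Y ⟶ (ihom T).obj L) (t : Y ⟶ T),
      Mem t (G ≫ dom) ↔ ∃ w : Y ⟶ W, w ≫ η = evalAt G t := by
    intro Y G t
    rw [Mem, evalAt_comp_map, holds_comp_χ_iff]
  have ex : ∃ w : pullback (pullback.fst fib dom) d ⟶ W, w ≫ η =
      evalAt (pullback.fst (pullback.fst fib dom) d ≫ pullback.snd fib dom)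
        (pullback.snd (pullback.fst fib dom) d) := by
    rw [← mem_dom, Category.assoc, ← pullback.condition, ← Category.assoc, mem_fib,
      pullback.condition]
  obtain ⟨e, he⟩ := ex
  refine ⟨pullback fib dom, pullback.fst fib dom, e, fun {X} c h => ?_⟩
  have m₂ : Mono (lift (pullback.snd c d) (pullback.fst c d)) := ⟨fun a b e => by
    apply pullback.hom_ext
    · simpa using congrArg (· ≫ snd _ _) e
    · simpa using congrArg (· ≫ fst _ _) e⟩
  obtain ⟨g, hg, hgu⟩ := hL (lift (pullback.snd c d) (pullback.fst c d)) m₂ h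
  have cond : c ≫ fib = MonoidalClosed.curry g ≫ dom := by
    refine power_ext _ _ fun {Y} a t => ?_
    rw [← Category.assoc, ← Category.assoc, mem_fib, mem_dom, evalAt_comp_curry]
    constructor
    · intro e
      refine ⟨pullback.lift a t e.symm ≫ h, ?_⟩
      rw [Category.assoc, hg.w, ← Category.assoc, comp_lift, pullback.lift_fst, pullback.lift_snd]
    · rintro ⟨w, hw⟩
      have h1 := hg.lift_snd _ _ hw
      rw [comp_lift] at h1
      have h2 : hg.lift _ _ hw ≫ pullback.snd c d = t := by
        simpa using congrArg (· ≫ fst _ _) h1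
      have h3 : hg.lift _ _ hw ≫ pullback.fst c d = a := by
        simpa using congrArg (· ≫ snd _ _) h1
      have h4 := congrArg (hg.lift _ _ hw ≫ ·) (pullback.condition (f := c) (g := d))
      exact (congrArg (· ≫ d) h2).symm.trans ((Category.assoc _ _ _).trans (h4.symm.trans
        ((Category.assoc _ _ _).symm.trans (congrArg (· ≫ c) h3))))
  refine ⟨pullback.lift c (MonoidalClosed.curry g) cond, ⟨pullback.lift_fst _ _ _, ?_⟩, ?_⟩
  · rw [← cancel_mono η, Category.assoc, he, comp_evalAt, pullback.lift_snd,
      pullback.lift_fst_assoc, Category.assoc, pullback.lift_snd, evalAt_comp_curry, hg.w]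
  · rintro k ⟨hk, hk'⟩
    apply pullback.hom_ext
    · rw [hk, pullback.lift_fst]
    · rw [pullback.lift_snd]
      apply MonoidalClosed.uncurry_injective
      rw [MonoidalClosed.uncurry_curry]
      apply hgu
      have ev : ∀ {Y : E} (a : Y ⟶ X) (t : Y ⟶ T),
          lift t a ≫ MonoidalClosed.uncurry (k ≫ pullback.snd fib dom) =
            evalAt (a ≫ k ≫ pullback.snd fib dom) t := by
        intro Y a t
        rw [← evalAt_comp_curry, MonoidalClosed.curry_uncurry]
      refine ⟨⟨?_⟩, ⟨PullbackCone.IsLimit.mk _ (fun s => pullback.lift (s.snd ≫ snd _ _)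
        (s.snd ≫ fst _ _) ?_) (fun s => ?_) (fun s => ?_) (fun s l h₁ h₂ => ?_)⟩⟩
      · rw [← hk', Category.assoc, he, comp_evalAt, pullback.lift_snd, pullback.lift_fst_assoc,
          ev, Category.assoc]
      · have hs : s.fst ≫ η = _ := s.condition
        have e1 : s.snd = lift (s.snd ≫ fst _ _) (s.snd ≫ snd _ _) := by ext <;> simp
        rw [e1, ev] at hs
        have := (mem_dom _ _).2 ⟨_, hs⟩
        have e2 : ((s.snd ≫ snd _ _) ≫ k ≫ pullback.snd fib dom) ≫ dom =
            ((s.snd ≫ snd _ _) ≫ c) ≫ fib := by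
          rw [← hk]
          simp only [Category.assoc, pullback.condition]
        rw [e2, mem_fib] at this
        exact this.symm
      · have hs : s.fst ≫ η = _ := s.condition
        rw [← cancel_mono η]
        refine Eq.trans ?_ hs.symm
        rw [← hk']
        simp only [Category.assoc]
        rw [he]
        simp only [comp_evalAt, pullback.lift_snd, pullback.lift_fst_assoc, Category.assoc]
        have := ev (s.snd ≫ snd _ _) (s.snd ≫ fst _ _)
        rw [Category.assoc] at this
        rw [← this]
        congr 1
        ext <;> simp
      · rw [comp_lift, pullback.lift_fst, pullback.lift_snd]
        ext <;> simp
      · apply pullback.hom_ext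
        · rw [pullback.lift_fst, ← h₂]; simp
        · rw [pullback.lift_snd, ← h₂]; simp

end Exponential

end Topos

/-! ### Minima and truncated subtraction -/

lemma factors_pullback_iff {E : Type u} [Category.{v} E] [HasPullbacks E] {X Y Z : E}
    (f : X ⟶ Y) (A : Subobject Y) (g : Z ⟶ X) :
    ((Subobject.pullback f).obj A).Factors g ↔ A.Factors (g ≫ f) := by
  have hp := Subobject.isPullback f A
  refine ⟨fun h => ?_, fun h => ?_⟩
  swap
  · have e : hp.lift _ g (Subobject.factorThru_arrow _ _ h) ≫
        ((Subobject.pullback f).obj A).arrow = g := hp.lift_snd _ _ _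
    rw [← e]
    exact Subobject.factors_comp_arrow _
  rw [← Subobject.factorThru_arrow _ g h, Category.assoc]
  have w : Subobject.pullbackπ f A ≫ A.arrow = ((Subobject.pullback f).obj A).arrow ≫ f := hp.w
  rw [← w, ← Category.assoc]
  exact Subobject.factors_comp_arrow _

namespace OrderedCommRingObj

section Order

variable {E : Type u} [Category.{v} E] [CartesianMonoidalCategory E] [HasFiniteLimits E]
variable (K : OrderedCommRingObj E)

lemma Le.antisymm {K : OrderedCommRingObj E} {X : E} {i j : X ⟶ K.pos} (h : K.Le i j)
    (h' : K.Le j i) : i = j := by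
  rw [← cancel_mono K.incl]
  exact K.le_antisymm _ _ h h'

lemma le_rfl {X : E} (i : X ⟶ K.pos) : K.Le i i := K.le_refl _

lemma posZero_incl : K.posZero ≫ K.incl = K.zero := Subobject.factorThru_arrow _ _ _

lemma z_incl (X : E) : K.z X ≫ K.incl = toUnit X ≫ K.zero := by
  rw [z, Category.assoc, posZero_incl]

lemma plus_incl {X : E} (i j : X ⟶ K.pos) :
    K.plus i j ≫ K.incl = lift (i ≫ K.incl) (j ≫ K.incl) ≫ K.add := by
  have h : K.posAdd ≫ K.incl = lift (fst _ _ ≫ K.incl) (snd _ _ ≫ K.incl) ≫ K.add :=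
    Subobject.factorThru_arrow _ _ _
  rw [plus, Category.assoc, h, ← Category.assoc, comp_lift, ← Category.assoc, ← Category.assoc,
    lift_fst, lift_snd]

lemma nonneg_incl {X : E} (i : X ⟶ K.pos) :
    K.leSub.Factors (lift (toUnit X ≫ K.zero) (i ≫ K.incl)) :=
  (K.posSub_factors_iff _).1 (Subobject.factors_comp_arrow _)

lemma z_le {X : E} (i : X ⟶ K.pos) : K.Le (K.z X) i := by
  rw [Le, z_incl]
  exact K.nonneg_incl i

lemma le_plus {X : E} (i j : X ⟶ K.pos) : K.Le i (K.plus i j) := by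
  have h := K.add_le_add _ _ (i ≫ K.incl) (K.nonneg_incl j)
  rw [K.add_comm _ (toUnit X ≫ K.zero), K.zero_add] at h
  rwa [Le, plus_incl]

lemma neg_add_cancel_left {X : E} (i j : X ⟶ K.R) :
    lift (i ≫ K.neg) (lift i j ≫ K.add) ≫ K.add = j := by
  rw [K.add_assoc, K.add_comm (i ≫ K.neg), K.add_neg, K.zero_add]

lemma add_neg_cancel_left {X : E} (i j : X ⟶ K.R) :
    lift i (lift (i ≫ K.neg) j ≫ K.add) ≫ K.add = j := by
  rw [K.add_assoc, K.add_neg, K.zero_add]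

lemma posSub_factors_sub {X : E} {i j : X ⟶ K.R} (h : K.leSub.Factors (lift i j)) :
    K.posSub.Factors (lift (i ≫ K.neg) j ≫ K.add) := by
  rw [posSub_factors_iff]
  have h := K.add_le_add _ _ (i ≫ K.neg) h
  rwa [K.add_comm (i ≫ K.neg) i, K.add_neg] at h

lemma exists_plus_of_le {X : E} {i j : X ⟶ K.pos} (h : K.Le i j) : ∃ k, K.plus i k = j := by
  let k : X ⟶ K.pos := K.posSub.factorThru _ (K.posSub_factors_sub h)
  have e : k ≫ K.incl = lift ((i ≫ K.incl) ≫ K.neg) (j ≫ K.incl) ≫ K.add :=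
    Subobject.factorThru_arrow _ _ _
  exact ⟨k, by rw [← cancel_mono K.incl, plus_incl, e, add_neg_cancel_left]⟩

lemma z_plus {X : E} (i : X ⟶ K.pos) : K.plus (K.z X) i = i := by
  rw [← cancel_mono K.incl, plus_incl, z_incl, K.zero_add]

lemma plus_z {X : E} (i : X ⟶ K.pos) : K.plus i (K.z X) = i := by
  rw [← cancel_mono K.incl, plus_incl, z_incl, K.add_comm, K.zero_add]

end Order

section Inf

variable {E : Type u} [Category.{v} E] [CartesianMonoidalCategory E] [HasFiniteLimits E]
variable [MonoidalClosed E] [HasSubobjectClassifier E] (K : OrderedCommRingObj E)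

/-- Binary infima exist. The pairs `(i, j)` that have an infimum form a subobject of `R × R`,
since infima are unique; the subobject contains `≤` and its opposite, so it is everything. That
`m` is the infimum of `i` and `j` is expressed by an equation `↓m = ↓i ∩ ↓j` of subsets of `R`. -/
lemma exists_inf : ∃ μ : K.R ⊗ K.R ⟶ K.R, ∀ {X : E} (i j k : X ⟶ K.R),
    K.leSub.Factors (lift k (lift i j ≫ μ)) ↔
      K.leSub.Factors (lift k i) ∧ K.leSub.Factors (lift k j) := by
  let down := slices K.leSub.arrow
  have mem_down : ∀ {X : E} (i k : X ⟶ K.R), Mem k (i ≫ down) ↔ K.leSub.Factors (lift k i) := by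
    intro X i k
    rw [mem_comp_slices_iff]
    refine ⟨fun ⟨b, hb⟩ => ?_, fun h => ⟨_, Subobject.factorThru_arrow _ _ h⟩⟩
    rw [← hb]
    exact Subobject.factors_comp_arrow _
  let A : Subobject (K.R ⊗ (K.R ⊗ K.R)) :=
    (Subobject.pullback (lift (fst _ _) (snd _ _ ≫ fst _ _))).obj K.leSub ⊓
      (Subobject.pullback (lift (fst _ _) (snd _ _ ≫ snd _ _))).obj K.leSub
  let lower := slices A.arrow
  have mem_lower : ∀ {X : E} (y : X ⟶ K.R ⊗ K.R) (k : X ⟶ K.R), Mem k (y ≫ lower) ↔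
      K.leSub.Factors (lift k (y ≫ fst _ _)) ∧ K.leSub.Factors (lift k (y ≫ snd _ _)) := by
    intro X y k
    have e1 : lift k y ≫ lift (fst _ _) (snd _ _ ≫ fst _ _) = lift k (y ≫ fst K.R K.R) := by
      ext <;> simp
    have e2 : lift k y ≫ lift (fst _ _) (snd _ _ ≫ snd _ _) = lift k (y ≫ snd K.R K.R) := by
      ext <;> simp
    rw [← e1, ← e2, ← factors_pullback_iff, ← factors_pullback_iff, ← Subobject.inf_factors,
      mem_comp_slices_iff]
    refine ⟨fun ⟨b, hb⟩ => ?_, fun h => ⟨_, Subobject.factorThru_arrow _ _ h⟩⟩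
    rw [← hb]
    exact Subobject.factors_comp_arrow _
  have mdown : Mono down := ⟨fun {Z} i j e => by
    have h : ∀ k : Z ⟶ K.R, K.leSub.Factors (lift k i) ↔ K.leSub.Factors (lift k j) := fun k => by
      rw [← mem_down, e, mem_down]
    exact K.le_antisymm _ _ ((h i).1 (K.le_refl i)) ((h j).2 (K.le_refl j))⟩
  have key : ∀ (C : Subobject (K.R ⊗ K.R)) (t : (C : E) ⟶ K.R),
      t ≫ down = C.arrow ≫ lower → C ≤ Subobject.mk (pullback.snd down lower) := fun C t ht =>
    Subobject.le_mk_of_comm (pullback.lift t C.arrow ht) (pullback.lift_snd _ _ _)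
  have top : Subobject.mk (pullback.snd down lower) = ⊤ := by
    refine top_le_iff.1 (K.le_total.2 ?_)
    rintro C (rfl | rfl)
    · refine key _ (K.leSub.arrow ≫ fst _ _) (power_ext _ _ fun a k => ?_)
      have h : K.leSub.Factors (lift (a ≫ K.leSub.arrow ≫ fst _ _)
          (a ≫ K.leSub.arrow ≫ snd _ _)) := by
        rw [← comp_lift, ← comp_lift, lift_fst_snd, Category.comp_id]
        exact Subobject.factors_comp_arrow _
      rw [← Category.assoc, ← Category.assoc a _ lower, mem_down, mem_lower, Category.assoc,
        Category.assoc]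
      exact ⟨fun h' => ⟨h', K.le_trans _ _ _ h' h⟩, And.left⟩
    · set C := (Subobject.pullback (lift (snd K.R K.R) (fst K.R K.R))).obj K.leSub
      refine key _ (C.arrow ≫ snd _ _) (power_ext _ _ fun a k => ?_)
      have h : K.leSub.Factors (lift (a ≫ C.arrow ≫ snd _ _) (a ≫ C.arrow ≫ fst _ _)) := by
        rw [← comp_lift, ← comp_lift, ← Category.assoc, ← factors_pullback_iff]
        exact Subobject.factors_comp_arrow _
      rw [← Category.assoc, ← Category.assoc a _ lower, mem_down, mem_lower, Category.assoc,
        Category.assoc]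
      exact ⟨fun h' => ⟨K.le_trans _ _ _ h' h, h'⟩, And.right⟩
  have iso : IsIso (pullback.snd down lower) := (Subobject.isIso_iff_mk_eq_top _).2 top
  refine ⟨inv (pullback.snd down lower) ≫ pullback.fst down lower, fun {X} i j k => ?_⟩
  rw [← mem_down, Category.assoc, Category.assoc, pullback.condition, IsIso.inv_hom_id_assoc,
    mem_lower, lift_fst, lift_snd]

/-- The minimum of two generalized elements of the positive cone. -/
def pmin {X : E} (i j : X ⟶ K.pos) : X ⟶ K.pos :=
  K.posSub.factorThru (lift (i ≫ K.incl) (j ≫ K.incl) ≫ K.exists_inf.choose) (by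
    rw [posSub_factors_iff, K.exists_inf.choose_spec]
    exact ⟨K.nonneg_incl i, K.nonneg_incl j⟩)

lemma pmin_incl {X : E} (i j : X ⟶ K.pos) :
    K.pmin i j ≫ K.incl = lift (i ≫ K.incl) (j ≫ K.incl) ≫ K.exists_inf.choose :=
  Subobject.factorThru_arrow _ _ _

lemma le_pmin_iff {X : E} (i j k : X ⟶ K.pos) : K.Le k (K.pmin i j) ↔ K.Le k i ∧ K.Le k j := by
  rw [Le, pmin_incl, K.exists_inf.choose_spec]
  rfl

lemma comp_pmin {X Y : E} (a : Y ⟶ X) (i j : X ⟶ K.pos) :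
    a ≫ K.pmin i j = K.pmin (a ≫ i) (a ≫ j) := by
  rw [← cancel_mono K.incl, Category.assoc, pmin_incl, pmin_incl, ← Category.assoc, comp_lift,
    Category.assoc, Category.assoc]

lemma pmin_le_left {X : E} (i j : X ⟶ K.pos) : K.Le (K.pmin i j) i :=
  ((K.le_pmin_iff i j _).1 (K.le_rfl _)).1

lemma pmin_le_right {X : E} (i j : X ⟶ K.pos) : K.Le (K.pmin i j) j :=
  ((K.le_pmin_iff i j _).1 (K.le_rfl _)).2

lemma pmin_of_le {X : E} {i j : X ⟶ K.pos} (h : K.Le i j) : K.pmin i j = i :=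
  (K.pmin_le_left i j).antisymm ((K.le_pmin_iff _ _ _).2 ⟨K.le_rfl i, h⟩)

lemma pmin_of_ge {X : E} {i j : X ⟶ K.pos} (h : K.Le j i) : K.pmin i j = j :=
  (K.pmin_le_right i j).antisymm ((K.le_pmin_iff _ _ _).2 ⟨h, K.le_rfl j⟩)

/-- Truncated subtraction `n - min i n` on the positive cone. -/
def monus {X : E} (n i : X ⟶ K.pos) : X ⟶ K.pos :=
  K.posSub.factorThru _ (K.posSub_factors_sub (K.pmin_le_right i n))

lemma monus_incl {X : E} (n i : X ⟶ K.pos) :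
    K.monus n i ≫ K.incl = lift ((K.pmin i n ≫ K.incl) ≫ K.neg) (n ≫ K.incl) ≫ K.add :=
  Subobject.factorThru_arrow _ _ _

lemma comp_monus {X Y : E} (a : Y ⟶ X) (n i : X ⟶ K.pos) :
    a ≫ K.monus n i = K.monus (a ≫ n) (a ≫ i) := by
  rw [← cancel_mono K.incl, Category.assoc, monus_incl, monus_incl, ← Category.assoc, comp_lift,
    ← comp_pmin]
  simp only [Category.assoc]

lemma monus_of_plus_eq {X : E} {n i j : X ⟶ K.pos} (h : K.plus i j = n) : K.monus n i = j := by
  have hi : K.Le i n := h ▸ K.le_plus i j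
  rw [← cancel_mono K.incl, monus_incl, K.pmin_of_le hi, ← h, plus_incl, neg_add_cancel_left]

lemma monus_z {X : E} (n : X ⟶ K.pos) : K.monus n (K.z X) = n := K.monus_of_plus_eq (K.z_plus n)

lemma monus_self {X : E} (n : X ⟶ K.pos) : K.monus n n = K.z X := K.monus_of_plus_eq (K.plus_z n)

lemma monus_plus {X : E} (n k : X ⟶ K.pos) : K.monus n (K.plus n k) = K.monus n n := by
  rw [← cancel_mono K.incl, monus_incl, monus_incl, K.pmin_of_ge (K.le_plus n k),
    K.pmin_of_le (K.le_rfl n)]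

/-- Two morphisms from a stage `X` are equal if they agree where `i ≤ j` and where `j ≤ i`. -/
lemma eq_of_le_total {X Γ : E} (i j : X ⟶ K.pos) (g h : X ⟶ Γ)
    (h₁ : ∀ {Z : E} (a : Z ⟶ X), K.Le (a ≫ i) (a ≫ j) → a ≫ g = a ≫ h)
    (h₂ : ∀ {Z : E} (a : Z ⟶ X), K.Le (a ≫ j) (a ≫ i) → a ≫ g = a ≫ h) : g = h := by
  refine eq_of_isLUB_top K.le_total (lift (i ≫ K.incl) (j ≫ K.incl)) g h (fun a ha => h₁ a ?_)
    (fun a ha => h₂ a ?_)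
  · rwa [Le, Category.assoc, Category.assoc, ← comp_lift]
  · rw [factors_pullback_iff, Category.assoc, comp_lift, lift_snd, lift_fst, comp_lift] at ha
    rwa [Le, Category.assoc, Category.assoc]

end Inf

end OrderedCommRingObj

/-! ### Initial segments, reversals and lifts of paths -/

section PathOperations

variable {E : Type u} [Category.{v} E] [CartesianMonoidalCategory E] [HasFiniteLimits E]
variable [MonoidalClosed E] {K : OrderedCommRingObj E}

namespace PathObj

/-- The path of shape `n` whose value at `i` is `g (i, -)`, for `g` constant from `n` on. -/
def ofFun {X Γ : E} (g : K.pos ⊗ X ⟶ Γ) (n : X ⟶ K.pos)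
    (h : ∀ (Y : E) (a : Y ⟶ X) (k : Y ⟶ K.pos),
      lift (K.plus (a ≫ n) k) a ≫ g = lift (a ≫ n) a ≫ g) : X ⟶ PathObj K Γ :=
  mk (MonoidalClosed.curry g) n (fun Y a k => by rw [appFn_curry, appFn_curry, h])

lemma shape_ofFun {X Γ : E} (g : K.pos ⊗ X ⟶ Γ) (n : X ⟶ K.pos) (h) :
    shape (ofFun g n h) = n := shape_mk _ _ _

lemma val_comp_ofFun {X Y Γ : E} (g : K.pos ⊗ X ⟶ Γ) (n : X ⟶ K.pos) (h) (a : Y ⟶ X)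
    (i : Y ⟶ K.pos) : val (a ≫ ofFun g n h) i = lift i a ≫ g := by
  rw [val, ← Category.assoc, Category.assoc a, ofFun, mk_incl, Category.assoc, lift_fst,
    appFn_curry]

lemma val_comp_idp {X Y Γ : E} (x : X ⟶ Γ) (a : Y ⟶ X) (i : Y ⟶ K.pos) :
    val (a ≫ idp (K := K) x) i = a ≫ x := by
  rw [comp_idp, val_idp]

lemma val_comp_map {X Y Δ Γ : E} (γ : Δ ⟶ Γ) (q : X ⟶ PathObj K Δ) (a : Y ⟶ X) (i : Y ⟶ K.pos) :
    val (a ≫ map γ q) i = val (a ≫ q) i ≫ γ := by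
  rw [comp_map, val_map]

lemma val_of_shape_le {X Γ : E} (q : X ⟶ PathObj K Γ) {j : X ⟶ K.pos} (h : K.Le (shape q) j) :
    val q j = tgt q := by
  obtain ⟨k, rfl⟩ := K.exists_plus_of_le h
  exact stable q k

variable [HasSubobjectClassifier E]

/-- The initial segment `q|_i`, whose value at `j` is `q (min i j)`. -/
def upTo {X Γ : E} (q : X ⟶ PathObj K Γ) (i : X ⟶ K.pos) : X ⟶ PathObj K Γ :=
  ofFun (val (snd _ _ ≫ q) (K.pmin (snd _ _ ≫ i) (fst _ _))) i (fun Y a k => by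
    simp only [comp_val, K.comp_pmin, lift_snd_assoc, lift_fst]
    rw [K.pmin_of_le (K.le_plus _ _), K.pmin_of_le (K.le_rfl _)])

lemma shape_upTo {X Γ : E} (q : X ⟶ PathObj K Γ) (i : X ⟶ K.pos) : shape (upTo q i) = i :=
  shape_ofFun _ _ _

lemma val_comp_upTo {X Y Γ : E} (q : X ⟶ PathObj K Γ) (i : X ⟶ K.pos) (a : Y ⟶ X)
    (j : Y ⟶ K.pos) : val (a ≫ upTo q i) j = val (a ≫ q) (K.pmin (a ≫ i) j) := by
  rw [upTo, val_comp_ofFun]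
  simp only [comp_val, K.comp_pmin, lift_snd_assoc, lift_fst]

lemma val_upTo {X Γ : E} (q : X ⟶ PathObj K Γ) (i j : X ⟶ K.pos) :
    val (upTo q i) j = val q (K.pmin i j) := by
  simpa only [Category.id_comp] using val_comp_upTo q i (𝟙 X) j

lemma comp_upTo {X Y Γ : E} (a : Y ⟶ X) (q : X ⟶ PathObj K Γ) (i : X ⟶ K.pos) :
    a ≫ upTo q i = upTo (a ≫ q) (a ≫ i) := by
  apply ext_path
  · rw [comp_shape, shape_upTo, shape_upTo]
  · intro Z b j
    rw [← Category.assoc, val_comp_upTo, val_comp_upTo, Category.assoc, Category.assoc]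

lemma isUpTo_upTo {X Γ : E} (q : X ⟶ PathObj K Γ) (i : X ⟶ K.pos) : IsUpTo q i (upTo q i) :=
  ⟨shape_upTo q i, fun a j h => by rw [val_comp_upTo, K.pmin_of_ge h]⟩

lemma src_upTo {X Γ : E} (q : X ⟶ PathObj K Γ) (i : X ⟶ K.pos) : src (upTo q i) = src q := by
  rw [src, val_upTo, K.pmin_of_ge (K.z_le i), src]

lemma upTo_z {X Γ : E} (q : X ⟶ PathObj K Γ) : upTo q (K.z X) = idp (src q) := by
  apply ext_path
  · rw [shape_upTo, shape_idp]
  · intro Y a i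
    rw [val_comp_upTo, val_comp_idp, K.comp_z, K.pmin_of_le (K.z_le i), ← comp_src, src]

/-- This is where totality of the order is used: `q (min |q| j) = q j` holds where `j ≤ |q|` and
also where `|q| ≤ j`. -/
lemma upTo_shape {X Γ : E} (q : X ⟶ PathObj K Γ) : upTo q (shape q) = q := by
  apply ext_path
  · rw [shape_upTo]
  · intro Y a j
    rw [val_comp_upTo]
    apply K.eq_of_le_total (a ≫ shape q) j
    · intro Z b h
      rw [comp_val, comp_val, K.comp_pmin, K.pmin_of_le h]
      rw [← comp_shape, ← comp_shape] at h ⊢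
      rw [val_of_shape_le _ h, tgt]
    · intro Z b h
      rw [comp_val, comp_val, K.comp_pmin, K.pmin_of_ge h]

lemma map_upTo {X Δ Γ : E} (γ : Δ ⟶ Γ) (q : X ⟶ PathObj K Δ) (i : X ⟶ K.pos) :
    map γ (upTo q i) = upTo (map γ q) i := by
  apply ext_path
  · rw [shape_map, shape_upTo, shape_upTo]
  · intro Y a j
    rw [val_comp_map, val_comp_upTo, val_comp_upTo, val_comp_map]

/-- The reversal of a path, whose value at `i` is `q (|q| - min i |q|)`. -/
def rev {X Γ : E} (q : X ⟶ PathObj K Γ) : X ⟶ PathObj K Γ :=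
  ofFun (val (snd _ _ ≫ q) (K.monus (snd _ _ ≫ shape q) (fst _ _))) (shape q) (fun Y a k => by
    simp only [comp_val, K.comp_monus, lift_snd_assoc, lift_fst]
    rw [K.monus_plus])

lemma shape_rev {X Γ : E} (q : X ⟶ PathObj K Γ) : shape (rev q) = shape q := shape_ofFun _ _ _

lemma val_comp_rev {X Y Γ : E} (q : X ⟶ PathObj K Γ) (a : Y ⟶ X) (i : Y ⟶ K.pos) :
    val (a ≫ rev q) i = val (a ≫ q) (K.monus (a ≫ shape q) i) := by
  rw [rev, val_comp_ofFun]
  simp only [comp_val, K.comp_monus, lift_snd_assoc, lift_fst]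

lemma val_rev {X Γ : E} (q : X ⟶ PathObj K Γ) (i : X ⟶ K.pos) :
    val (rev q) i = val q (K.monus (shape q) i) := by
  simpa only [Category.id_comp] using val_comp_rev q (𝟙 X) i

lemma isRev_rev {X Γ : E} (q : X ⟶ PathObj K Γ) : IsRev q (rev q) :=
  ⟨shape_rev q, fun a i j h => by rw [val_comp_rev, K.monus_of_plus_eq h]⟩

lemma src_rev {X Γ : E} (q : X ⟶ PathObj K Γ) : src (rev q) = tgt q := by
  rw [src, val_rev, K.monus_z, tgt]

lemma tgt_rev {X Γ : E} (q : X ⟶ PathObj K Γ) : tgt (rev q) = src q := by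
  rw [tgt, val_rev, shape_rev, K.monus_self, src]

lemma comp_rev {X Y Γ : E} (a : Y ⟶ X) (q : X ⟶ PathObj K Γ) : a ≫ rev q = rev (a ≫ q) := by
  apply ext_path
  · rw [comp_shape, shape_rev, shape_rev, comp_shape]
  · intro Z b j
    rw [← Category.assoc, val_comp_rev, val_comp_rev, Category.assoc, Category.assoc, comp_shape]

lemma rev_idp {X Γ : E} (x : X ⟶ Γ) : rev (idp (K := K) x) = idp x := by
  apply ext_path
  · rw [shape_rev]
  · intro Y a i
    rw [val_comp_rev, val_comp_idp, val_comp_idp]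

lemma map_rev {X Δ Γ : E} (γ : Δ ⟶ Γ) (q : X ⟶ PathObj K Δ) : map γ (rev q) = rev (map γ q) := by
  apply ext_path
  · rw [shape_map, shape_rev, shape_rev, shape_map]
  · intro Y a i
    rw [val_comp_map, val_comp_rev, val_comp_rev, val_comp_map, shape_map]

end PathObj

end PathOperations

namespace CwF

variable {E : Type u} [Category.{v} E] (C : CwF.{w₁, w₂} E)

lemma hom_ext {X Γ : E} {A : C.Ty Γ} {x y : X ⟶ C.ext A} (h₁ : x ≫ C.p A = y ≫ C.p A)
    (h₂ : C.tsub x (C.v A) = C.tsub y (C.v A)) : x = y := by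
  have h : C.tp (C.tsub y (C.v A)) = C.sub (y ≫ C.p A) A := by
    rw [C.tp_tsub, C.tp_v, C.sub_comp]
  exact (C.cons_uniq _ _ h x h₁ h₂).trans (C.cons_uniq _ _ h y rfl rfl).symm

lemma comp_cons {X Y Γ : E} {A : C.Ty Γ} (f : Y ⟶ X) (x : X ⟶ Γ) (a : C.Tm X)
    (h : C.tp a = C.sub x A) (h' : C.tp (C.tsub f a) = C.sub (f ≫ x) A) :
    f ≫ C.cons x a h = C.cons (f ≫ x) (C.tsub f a) h' :=
  C.cons_uniq _ _ _ _ (by rw [Category.assoc, C.cons_p]) (by rw [C.tsub_comp, C.cons_v])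

lemma cons_congr {X Γ : E} {A : C.Ty Γ} {x y : X ⟶ Γ} {a b : C.Tm X} (e : x = y) (e' : a = b)
    (h : C.tp a = C.sub x A) (h' : C.tp b = C.sub y A) : C.cons x a h = C.cons y b h' := by
  subst e e'; rfl

lemma cons_eta {X Γ : E} {A : C.Ty Γ} {x : X ⟶ Γ} (y : X ⟶ C.ext A) (hy : y ≫ C.p A = x)
    (h : C.tp (C.tsub y (C.v A)) = C.sub x A) : C.cons x (C.tsub y (C.v A)) h = y :=
  (C.cons_uniq _ _ _ _ hy rfl).symm

lemma tsub_v_wkOf {Δ Γ : E} (f : Δ ⟶ Γ) (A : C.Ty Γ) (A' : C.Ty Δ) (h : A' = C.sub f A) :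
    C.tsub (C.wkOf f A A' h) (C.v A) = C.v A' := C.cons_v _ _ _

lemma tsub_v_wk {Δ Γ : E} (f : Δ ⟶ Γ) (A : C.Ty Γ) :
    C.tsub (C.wk f A) (C.v A) = C.v (C.sub f A) := C.cons_v _ _ _

lemma cons_wkOf {X Δ Γ : E} (f : Δ ⟶ Γ) (A : C.Ty Γ) (A' : C.Ty Δ) (h : A' = C.sub f A)
    (x : X ⟶ Δ) (a : C.Tm X) (ha : C.tp a = C.sub x A') (ha' : C.tp a = C.sub (x ≫ f) A) :
    C.cons x a ha ≫ C.wkOf f A A' h = C.cons (x ≫ f) a ha' :=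
  C.cons_uniq _ _ _ _
    (by rw [Category.assoc, wkOf_p, ← Category.assoc, C.cons_p])
    (by rw [C.tsub_comp, tsub_v_wkOf, C.cons_v])

lemma cons_wk {X Δ Γ : E} (f : Δ ⟶ Γ) (A : C.Ty Γ) (x : X ⟶ Δ) (a : C.Tm X)
    (ha : C.tp a = C.sub x (C.sub f A)) (ha' : C.tp a = C.sub (x ≫ f) A) :
    C.cons x a ha ≫ C.wk f A = C.cons (x ≫ f) a ha' :=
  C.cons_wkOf _ _ _ _ _ _ _ _

/-- `Σ`-types from pairing morphisms that are isomorphisms: the eliminator is re-indexing along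
the inverse of pairing. -/
def SigmaTypes.ofIsIso {C : CwF.{w₁, w₂} E}
    (sig : ∀ {Γ : E} (A : C.Ty Γ), C.Ty (C.ext A) → C.Ty Γ)
    (sig_sub : ∀ {Δ Γ : E} (f : Δ ⟶ Γ) (A : C.Ty Γ) (B : C.Ty (C.ext A)),
      C.sub f (sig A B) = sig (C.sub f A) (C.sub (C.wk f A) B))
    (pair : ∀ {Γ : E} (A : C.Ty Γ) (B : C.Ty (C.ext A)), C.ext B ⟶ C.ext (sig A B))
    (isIso : ∀ {Γ : E} (A : C.Ty Γ) (B : C.Ty (C.ext A)), IsIso (pair A B))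
    (pair_p : ∀ {Γ : E} (A : C.Ty Γ) (B : C.Ty (C.ext A)),
      pair A B ≫ C.p (sig A B) = C.p B ≫ C.p A)
    (pair_sub : ∀ {Δ Γ : E} (f : Δ ⟶ Γ) (A : C.Ty Γ) (B : C.Ty (C.ext A)),
      pair (C.sub f A) (C.sub (C.wk f A) B) ≫ C.wkOf f (sig A B) _ (sig_sub f A B).symm =
        C.wk (C.wk f A) B ≫ pair A B) : C.SigmaTypes where
  sig := sig
  sig_sub := sig_sub
  pair := pair
  pair_p := pair_p
  pair_sub := pair_sub
  elim A B D M h := C.tsub (inv (pair A B)) M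
  tp_elim A B D M h := by rw [C.tp_tsub, h, ← C.sub_comp, IsIso.inv_hom_id, C.sub_id]
  elim_pair A B D M h := by rw [← C.tsub_comp, IsIso.hom_inv_id, C.tsub_id]
  elim_sub f A B D M h := by
    rw [← C.tsub_comp, ← C.tsub_comp]
    congr 1
    rw [IsIso.comp_inv_eq, Category.assoc, IsIso.eq_inv_comp, pair_sub]

end CwF

section Lifts

variable {E : Type u} [Category.{v} E] [CartesianMonoidalCategory E] [HasFiniteLimits E]
variable [MonoidalClosed E] {K : OrderedCommRingObj E} {C : CwF.{w₁, w₂} E}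

lemma Tap.tr_congr {Γ X : E} {A : C.Ty Γ} (t : Tap K C A) {q r : X ⟶ PathObj K Γ} (e : q = r)
    {a b : C.Tm X} (e' : a = b) (h : C.tp a = C.sub (PathObj.src q) A)
    (h' : C.tp b = C.sub (PathObj.src r) A) : t.tr q a h = t.tr r b h' := by
  subst e e'; rfl

namespace Fib

/-- The point `(tgt q, q_* a)` of `Γ.A`. -/
def endPt {X Γ : E} (A : Fib K C Γ) (q : X ⟶ PathObj K Γ) (a : C.Tm X)
    (h : C.tp a = C.sub (PathObj.src q) A.ty) : X ⟶ C.ext A.ty :=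
  C.cons (PathObj.tgt q) (A.tap.tr q a h) (A.tap.tp_tr q a h)

lemma endPt_congr {X Γ : E} (A : Fib K C Γ) {q r : X ⟶ PathObj K Γ} {a b : C.Tm X} (e : q = r)
    (e' : a = b) (h : C.tp a = C.sub (PathObj.src q) A.ty)
    (h' : C.tp b = C.sub (PathObj.src r) A.ty) : A.endPt q a h = A.endPt r b h' := by
  subst e e'; rfl

lemma tp_tsub_src {X Y Γ : E} {A : Fib K C Γ} (f : Y ⟶ X) {q : X ⟶ PathObj K Γ} {a : C.Tm X}
    (h : C.tp a = C.sub (PathObj.src q) A.ty) :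
    C.tp (C.tsub f a) = C.sub (PathObj.src (f ≫ q)) A.ty := by
  rw [C.tp_tsub, h, PathObj.comp_src, C.sub_comp]

lemma comp_endPt {X Y Γ : E} (A : Fib K C Γ) (f : Y ⟶ X) (q : X ⟶ PathObj K Γ) (a : C.Tm X)
    (h : C.tp a = C.sub (PathObj.src q) A.ty) :
    f ≫ A.endPt q a h = A.endPt (f ≫ q) (C.tsub f a) (tp_tsub_src f h) := by
  rw [endPt, C.comp_cons _ _ _ _ (by rw [C.tp_tsub, A.tap.tp_tr, C.sub_comp])]
  exact C.cons_congr (PathObj.comp_tgt f q).symm (A.tap.tr_nat f q a h) _ _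

lemma endPt_idp {X Γ : E} (A : Fib K C Γ) (x : X ⟶ Γ) (a : C.Tm X) (h : C.tp a = C.sub x A.ty)
    (h') : A.endPt (PathObj.idp x) a h' = C.cons x a h :=
  C.cons_congr (PathObj.tgt_idp x) (A.tap.tr_idp x a h) _ _

/-- The morphism `Δ.A[f] ⟶ Γ.A` for a fibration `A` over `Γ`; its domain is the comprehension
object of the re-indexed fibration. -/
def wk {Δ Γ : E} (A : Fib K C Γ) (f : Δ ⟶ Γ) : C.ext (A.sub f).ty ⟶ C.ext A.ty := C.wk f A.ty

lemma endPt_sub_wk {X Δ Γ : E} (f : Δ ⟶ Γ) (A : Fib K C Γ) (q : X ⟶ PathObj K Δ) (a : C.Tm X)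
    (h : C.tp a = C.sub (PathObj.src q) (A.sub f).ty)
    (h' : C.tp a = C.sub (PathObj.src (PathObj.map f q)) A.ty) :
    (A.sub f).endPt q a h ≫ A.wk f = A.endPt (PathObj.map f q) a h' := by
  have e := (A.sub f).tap.tp_tr q a h
  refine (C.cons_wk f A.ty _ _ e (by rw [e, C.sub_comp]; rfl)).trans ?_
  exact C.cons_congr (PathObj.tgt_map f q).symm rfl _ _

variable [HasSubobjectClassifier E]

/-- The lift of the path `q` to `Γ.A` starting at `a`; its value at `i` is the point
`(tgt u, u_* a)` for the initial segment `u` of `q` up to `min |q| i`. -/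
def liftPath {X Γ : E} (A : Fib K C Γ) (q : X ⟶ PathObj K Γ) (a : C.Tm X)
    (h : C.tp a = C.sub (PathObj.src q) A.ty) : X ⟶ PathObj K (C.ext A.ty) :=
  PathObj.ofFun (A.endPt (PathObj.upTo (snd _ _ ≫ q)
      (K.pmin (snd _ _ ≫ PathObj.shape q) (fst _ _))) (C.tsub (snd K.pos X) a)
      (by rw [PathObj.src_upTo, tp_tsub_src (A := A) _ h])) (PathObj.shape q) (fun Y b k => by
    rw [comp_endPt, comp_endPt]
    refine endPt_congr _ ?_ ?_ _ _
    · rw [PathObj.comp_upTo, PathObj.comp_upTo, K.comp_pmin, K.comp_pmin]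
      simp only [lift_snd_assoc, lift_fst]
      rw [K.pmin_of_le (K.le_plus _ _), K.pmin_of_le (K.le_rfl _)]
    · rw [← C.tsub_comp, ← C.tsub_comp, lift_snd, lift_snd])

lemma shape_liftPath {X Γ : E} (A : Fib K C Γ) (q : X ⟶ PathObj K Γ) (a : C.Tm X)
    (h : C.tp a = C.sub (PathObj.src q) A.ty) :
    PathObj.shape (A.liftPath q a h) = PathObj.shape q := PathObj.shape_ofFun _ _ _

lemma val_comp_liftPath {X Y Γ : E} (A : Fib K C Γ) (q : X ⟶ PathObj K Γ) (a : C.Tm X)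
    (h : C.tp a = C.sub (PathObj.src q) A.ty) (f : Y ⟶ X) (i : Y ⟶ K.pos) :
    PathObj.val (f ≫ A.liftPath q a h) i =
      A.endPt (PathObj.upTo (f ≫ q) (K.pmin (f ≫ PathObj.shape q) i)) (C.tsub f a)
        (by rw [PathObj.src_upTo, tp_tsub_src (A := A) _ h]) := by
  rw [liftPath, PathObj.val_comp_ofFun, comp_endPt]
  refine endPt_congr _ ?_ ?_ _ _
  · rw [PathObj.comp_upTo, K.comp_pmin]
    simp only [lift_snd_assoc, lift_fst]
  · rw [← C.tsub_comp, lift_snd]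

lemma val_liftPath {X Γ : E} (A : Fib K C Γ) (q : X ⟶ PathObj K Γ) (a : C.Tm X)
    (h : C.tp a = C.sub (PathObj.src q) A.ty) (i : X ⟶ K.pos) :
    PathObj.val (A.liftPath q a h) i =
      A.endPt (PathObj.upTo q (K.pmin (PathObj.shape q) i)) a (by rw [PathObj.src_upTo, h]) := by
  have e := A.val_comp_liftPath q a h (𝟙 X) i
  rw [Category.id_comp] at e
  rw [e]
  exact endPt_congr _ (by rw [Category.id_comp, Category.id_comp]) (C.tsub_id a) _ _

lemma liftPath_congr {X Γ : E} (A : Fib K C Γ) {q r : X ⟶ PathObj K Γ} {a b : C.Tm X} (e : q = r)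
    (e' : a = b) (h : C.tp a = C.sub (PathObj.src q) A.ty)
    (h' : C.tp b = C.sub (PathObj.src r) A.ty) : A.liftPath q a h = A.liftPath r b h' := by
  subst e e'; rfl

lemma comp_liftPath {X Y Γ : E} (A : Fib K C Γ) (f : Y ⟶ X) (q : X ⟶ PathObj K Γ) (a : C.Tm X)
    (h : C.tp a = C.sub (PathObj.src q) A.ty) :
    f ≫ A.liftPath q a h = A.liftPath (f ≫ q) (C.tsub f a) (tp_tsub_src f h) := by
  apply PathObj.ext_path
  · rw [PathObj.comp_shape, shape_liftPath, shape_liftPath, PathObj.comp_shape]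
  · intro Z g i
    rw [← Category.assoc, val_comp_liftPath, val_comp_liftPath]
    refine endPt_congr _ ?_ (C.tsub_comp _ _ _) _ _
    rw [PathObj.comp_shape, Category.assoc, Category.assoc]

lemma src_liftPath {X Γ : E} (A : Fib K C Γ) (q : X ⟶ PathObj K Γ) (a : C.Tm X)
    (h : C.tp a = C.sub (PathObj.src q) A.ty) :
    PathObj.src (A.liftPath q a h) = C.cons (PathObj.src q) a h := by
  rw [PathObj.src, val_liftPath, ← A.endPt_idp _ a h (by rw [PathObj.src_idp, h])]
  refine endPt_congr _ ?_ rfl _ _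
  rw [K.pmin_of_ge (K.z_le _), PathObj.upTo_z]

lemma tgt_liftPath {X Γ : E} (A : Fib K C Γ) (q : X ⟶ PathObj K Γ) (a : C.Tm X)
    (h : C.tp a = C.sub (PathObj.src q) A.ty) :
    PathObj.tgt (A.liftPath q a h) = A.endPt q a h := by
  rw [PathObj.tgt, val_liftPath]
  refine endPt_congr _ ?_ rfl _ _
  rw [shape_liftPath, K.pmin_of_le (K.le_rfl _), PathObj.upTo_shape]

lemma isLift_liftPath {X Γ : E} (A : Fib K C Γ) (q : X ⟶ PathObj K Γ) (a : C.Tm X)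
    (h : C.tp a = C.sub (PathObj.src q) A.ty) : A.IsLift q a (A.liftPath q a h) := by
  refine ⟨shape_liftPath _ _ _ _, fun {Y} f i hi => ⟨PathObj.upTo (f ≫ q) i,
    PathObj.isUpTo_upTo _ _, by rw [PathObj.src_upTo, tp_tsub_src (A := A) _ h], ?_⟩⟩
  rw [val_comp_liftPath]
  exact endPt_congr _ (by rw [K.pmin_of_ge hi]) rfl _ _

lemma liftPath_idp {X Γ : E} (A : Fib K C Γ) (x : X ⟶ Γ) (a : C.Tm X) (h : C.tp a = C.sub x A.ty)
    (h') : A.liftPath (PathObj.idp x) a h' = PathObj.idp (C.cons x a h) := by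
  apply PathObj.ext_path
  · rw [shape_liftPath, PathObj.shape_idp, PathObj.shape_idp]
  · intro Y f i
    have hf : C.tp (C.tsub f a) = C.sub (f ≫ x) A.ty := by rw [C.tp_tsub, h, C.sub_comp]
    rw [val_comp_liftPath, PathObj.val_comp_idp, C.comp_cons _ _ _ _ hf,
      ← A.endPt_idp _ _ hf (by rw [PathObj.src_idp, hf])]
    refine endPt_congr _ ?_ rfl _ _
    rw [PathObj.shape_idp, K.comp_z, K.pmin_of_le (K.z_le _), PathObj.upTo_z, PathObj.comp_idp,
      PathObj.src_idp]

lemma liftPath_map {X Δ Γ : E} (f : Δ ⟶ Γ) (A : Fib K C Γ) (q : X ⟶ PathObj K Δ) (a : C.Tm X)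
    (h : C.tp a = C.sub (PathObj.src (PathObj.map f q)) A.ty)
    (h' : C.tp a = C.sub (PathObj.src q) (A.sub f).ty) :
    A.liftPath (PathObj.map f q) a h = PathObj.map (A.wk f) ((A.sub f).liftPath q a h') := by
  apply PathObj.ext_path
  · rw [PathObj.shape_map, shape_liftPath, shape_liftPath, PathObj.shape_map]
  · intro Y g i
    have hg : C.tp (C.tsub g a) = C.sub (PathObj.src (PathObj.map f (PathObj.upTo (g ≫ q)
        (K.pmin (g ≫ PathObj.shape q) i)))) A.ty := by
      rw [PathObj.map_upTo, PathObj.src_upTo, ← PathObj.comp_map, tp_tsub_src (A := A) _ h]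
    rw [val_comp_liftPath, PathObj.val_comp_map, val_comp_liftPath, endPt_sub_wk _ _ _ _ _ hg]
    refine endPt_congr _ ?_ rfl _ _
    rw [PathObj.map_upTo, PathObj.shape_map, PathObj.comp_map]

end Fib

end Lifts

/-! ### Dependent sums and products in a topos -/

section Topos

variable {E : Type u} [Category.{v} E] [CartesianMonoidalCategory E]
variable [HasFiniteLimits E] [MonoidalClosed E] [HasSubobjectClassifier E]

/-- The object of pairs `(v, h)` where `v : V` and `h` is a map from the fibre of `d` over `v`
to `W`. -/
def partialProd {T V : E} (d : T ⟶ V) (W : E) : E := (exists_partialProduct d W).choose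

namespace partialProd

variable {T V : E} (d : T ⟶ V) (W : E)

/-- The projection `(v, h) ↦ v`. -/
def proj : partialProd d W ⟶ V := (exists_partialProduct d W).choose_spec.choose

/-- The evaluation morphism `((v, h), t) ↦ h t`. -/
def eval : pullback (proj d W) d ⟶ W := (exists_partialProduct d W).choose_spec.choose_spec.choose

variable {d W}

/-- The family of maps `pullback c d ⟶ W` given by a generalized element of `partialProd d W`
over `c`. -/
def evalOn {X : E} (k : X ⟶ partialProd d W) (c : X ⟶ V) (hk : k ≫ proj d W = c) :
    pullback c d ⟶ W :=
  pullback.lift (pullback.fst c d ≫ k) (pullback.snd c d)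
    (by rw [Category.assoc, hk, pullback.condition]) ≫ eval d W

lemma existsUnique {X : E} (c : X ⟶ V) (h : pullback c d ⟶ W) :
    ∃! k : X ⟶ partialProd d W, ∃ hk : k ≫ proj d W = c, evalOn k c hk = h :=
  (exists_partialProduct d W).choose_spec.choose_spec.choose_spec c h

/-- The generalized element of `partialProd d W` over `c` given by a family of maps. -/
def lift {X : E} (c : X ⟶ V) (h : pullback c d ⟶ W) : X ⟶ partialProd d W :=
  (existsUnique c h).choose

lemma lift_proj {X : E} (c : X ⟶ V) (h : pullback c d ⟶ W) : lift c h ≫ proj d W = c :=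
  (existsUnique c h).choose_spec.1.choose

lemma evalOn_lift {X : E} (c : X ⟶ V) (h : pullback c d ⟶ W) (hk) :
    evalOn (lift c h) c hk = h :=
  (existsUnique c h).choose_spec.1.choose_spec

lemma eq_lift {X : E} (c : X ⟶ V) (h : pullback c d ⟶ W) (k : X ⟶ partialProd d W)
    (hk : k ≫ proj d W = c) (e : evalOn k c hk = h) : k = lift c h :=
  (existsUnique c h).choose_spec.2 k ⟨hk, e⟩

lemma evalOn_congr {X : E} {k k' : X ⟶ partialProd d W} (e : k = k') (c : X ⟶ V)
    (hk : k ≫ proj d W = c) (hk' : k' ≫ proj d W = c) : evalOn k c hk = evalOn k' c hk' := by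
  subst e; rfl

lemma evalOn_comp {X Y : E} (f : Y ⟶ X) (k : X ⟶ partialProd d W) (c : X ⟶ V)
    (hk : k ≫ proj d W = c) (hk' : (f ≫ k) ≫ proj d W = f ≫ c)
    (w : pullback (f ≫ c) d ⟶ pullback c d) (w₁ : w ≫ pullback.fst c d = pullback.fst _ _ ≫ f)
    (w₂ : w ≫ pullback.snd c d = pullback.snd _ _) :
    evalOn (f ≫ k) (f ≫ c) hk' = w ≫ evalOn k c hk := by
  refine (congrArg (· ≫ eval d W) ?_).trans (Category.assoc _ _ _)
  apply pullback.hom_ext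
  · rw [Category.assoc, pullback.lift_fst, pullback.lift_fst, ← Category.assoc, ← Category.assoc,
      w₁]
  · rw [Category.assoc, pullback.lift_snd, pullback.lift_snd, w₂]

lemma comp_lift {X Y : E} (f : Y ⟶ X) (c : X ⟶ V) (h : pullback c d ⟶ W)
    (w : pullback (f ≫ c) d ⟶ pullback c d) (w₁ : w ≫ pullback.fst c d = pullback.fst _ _ ≫ f)
    (w₂ : w ≫ pullback.snd c d = pullback.snd _ _) :
    f ≫ lift c h = lift (f ≫ c) (w ≫ h) := by
  refine eq_lift _ _ _ (by rw [Category.assoc, lift_proj]) ?_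
  rw [evalOn_comp f _ c (lift_proj c h) _ w w₁ w₂, evalOn_lift]

variable (d) in
/-- The morphism `(v, h) ↦ (v, β ∘ h)`. -/
def map {W' : E} (β : W ⟶ W') : partialProd d W ⟶ partialProd d W' :=
  lift (proj d W) (eval d W ≫ β)

lemma map_proj {W' : E} (β : W ⟶ W') : map d β ≫ proj d W' = proj d W := lift_proj _ _

lemma evalOn_map {W' X : E} (β : W ⟶ W') (k : X ⟶ partialProd d W) (c : X ⟶ V)
    (hk : k ≫ proj d W = c) (hk' : (k ≫ map d β) ≫ proj d W' = c) :
    evalOn (k ≫ map d β) c hk' = evalOn k c hk ≫ β := by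
  subst hk
  have e : evalOn (map d β) _ (map_proj β) = eval d W ≫ β := evalOn_lift _ _ _
  rw [evalOn_comp k (map d β) _ (map_proj β) _ (pullback.lift (pullback.fst _ _ ≫ k)
    (pullback.snd _ _) (by rw [Category.assoc, pullback.condition])) (pullback.lift_fst _ _ _)
    (pullback.lift_snd _ _ _), e]
  exact (Category.assoc _ _ _).symm

lemma lift_map {W' X : E} (β : W ⟶ W') (c : X ⟶ V) (h : pullback c d ⟶ W) :
    lift c h ≫ map d β = lift c (h ≫ β) := by
  refine eq_lift _ _ _ (by rw [Category.assoc, map_proj, lift_proj]) ?_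
  rw [evalOn_map β _ c (lift_proj c h), evalOn_lift]

lemma proj_of_map_eq_lift {W' X : E} {β : W ⟶ W'} {k : X ⟶ partialProd d W} {c : X ⟶ V}
    {h : pullback c d ⟶ W'} (e : k ≫ map d β = lift c h) : k ≫ proj d W = c := by
  rw [← map_proj β, ← Category.assoc, e, lift_proj]

lemma evalOn_of_map_eq_lift {W' X : E} {β : W ⟶ W'} {k : X ⟶ partialProd d W} {c : X ⟶ V}
    {h : pullback c d ⟶ W'} (e : k ≫ map d β = lift c h) :
    evalOn k c (proj_of_map_eq_lift e) ≫ β = h := by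
  rw [← evalOn_map β k c _ (by rw [e, lift_proj]), evalOn_congr e c _ (lift_proj c h),
    evalOn_lift]

section Sum

variable {X : E} (c : X ⟶ V) {W' : E} (h : pullback c d ⟶ W') (β : W ⟶ W')

/-- The morphism into the generic pullback along `d` that is induced by the generalized element
`lift c h`. -/
def classify : pullback c d ⟶ pullback (proj d W') d :=
  pullback.lift (pullback.fst _ _ ≫ lift c h) (pullback.snd _ _)
    (by rw [Category.assoc, lift_proj, pullback.condition])

lemma classify_eval : classify c h ≫ eval d W' = h := evalOn_lift c h (lift_proj _ _)

lemma isPullback_classify : IsPullback (classify c h) (pullback.fst c d)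
    (pullback.fst (proj d W') d) (lift c h) := by
  refine IsPullback.of_right (h₁₂ := pullback.snd (proj d W') d) (h₂₂ := proj d W') (v₁₃ := d) ?_
    (pullback.lift_fst _ _ _) (IsPullback.of_hasPullback _ _).flip
  rw [classify, pullback.lift_snd, lift_proj]
  exact (IsPullback.of_hasPullback _ _).flip

/-- The morphism over `classify c h` between the pullbacks of `β`. -/
def classifyTotal : pullback h β ⟶ pullback (eval d W') β :=
  pullback.lift (pullback.fst _ _ ≫ classify c h) (pullback.snd _ _)
    (by rw [Category.assoc, classify_eval, pullback.condition])

lemma isPullback_classifyTotal : IsPullback (classifyTotal c h β) (pullback.fst h β)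
    (pullback.fst (eval d W') β) (classify c h) := by
  refine IsPullback.of_right (h₁₂ := pullback.snd (eval d W') β) (h₂₂ := eval d W') (v₁₃ := β) ?_
    (pullback.lift_fst _ _ _) (IsPullback.of_hasPullback _ _).flip
  rw [classifyTotal, pullback.lift_snd, classify_eval]
  exact (IsPullback.of_hasPullback _ _).flip

/-- The iterated pullback `X.A.B` is the pullback along `lift c h` of a single morphism, the
projection of the triples `((v, h), t, w)` with `h t = β w`. -/
lemma isPullback_sum : IsPullback (pullback.fst h β ≫ pullback.fst c d) (classifyTotal c h β)
    (lift c h) (pullback.fst (eval d W') β ≫ pullback.fst (proj d W') d) :=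
  ((isPullback_classifyTotal c h β).paste_vert (isPullback_classify c h)).flip

variable {Y : E} (f : Y ⟶ X) (w : pullback (f ≫ c) d ⟶ pullback c d)

lemma comp_classifyTotal (w₁ : w ≫ pullback.fst c d = pullback.fst _ _ ≫ f)
    (w₂ : w ≫ pullback.snd c d = pullback.snd _ _) (w' : pullback (w ≫ h) β ⟶ pullback h β)
    (w'₁ : w' ≫ pullback.fst h β = pullback.fst _ _ ≫ w)
    (w'₂ : w' ≫ pullback.snd h β = pullback.snd _ _) :
    w' ≫ classifyTotal c h β = classifyTotal (f ≫ c) (w ≫ h) β := by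
  have e : w ≫ classify c h = classify (f ≫ c) (w ≫ h) := by
    apply pullback.hom_ext
    · rw [classify, classify, Category.assoc, pullback.lift_fst, pullback.lift_fst,
        ← comp_lift f c h w w₁ w₂, ← Category.assoc, w₁, Category.assoc]
    · rw [classify, classify, Category.assoc, pullback.lift_snd, pullback.lift_snd, w₂]
  apply pullback.hom_ext
  · rw [classifyTotal, classifyTotal, Category.assoc, pullback.lift_fst, pullback.lift_fst,
      ← Category.assoc, w'₁, Category.assoc, e]
  · rw [classifyTotal, classifyTotal, Category.assoc, pullback.lift_snd, pullback.lift_snd, w'₂]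

lemma isoPullback_comp (w₁ : w ≫ pullback.fst c d = pullback.fst _ _ ≫ f)
    (w₂ : w ≫ pullback.snd c d = pullback.snd _ _) (w' : pullback (w ≫ h) β ⟶ pullback h β)
    (w'₁ : w' ≫ pullback.fst h β = pullback.fst _ _ ≫ w)
    (w'₂ : w' ≫ pullback.snd h β = pullback.snd _ _)
    (u : pullback (lift (f ≫ c) (w ≫ h))
        (pullback.fst (eval d W') β ≫ pullback.fst (proj d W') d) ⟶
      pullback (lift c h) (pullback.fst (eval d W') β ≫ pullback.fst (proj d W') d))
    (u₁ : u ≫ pullback.fst _ _ = pullback.fst _ _ ≫ f)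
    (u₂ : u ≫ pullback.snd _ _ = pullback.snd _ _) :
    (isPullback_sum (f ≫ c) (w ≫ h) β).isoPullback.hom ≫ u =
      w' ≫ (isPullback_sum c h β).isoPullback.hom := by
  apply pullback.hom_ext
  · rw [Category.assoc, u₁, ← Category.assoc, IsPullback.isoPullback_hom_fst, Category.assoc,
      Category.assoc, IsPullback.isoPullback_hom_fst, ← Category.assoc w', w'₁, Category.assoc, w₁]
  · rw [Category.assoc, u₂, IsPullback.isoPullback_hom_snd, Category.assoc,
      IsPullback.isoPullback_hom_snd, comp_classifyTotal c h β f w w₁ w₂ w' w'₁ w'₂]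

end Sum

end partialProd

omit [CartesianMonoidalCategory E] [MonoidalClosed E] [HasSubobjectClassifier E] in
lemma toposCwF_wkOf_snd {Δ Γ : E} (f : Δ ⟶ Γ) (A : Family Γ) (c : Δ ⟶ A.base)
    (h : (⟨A.base, A.total, A.disp, c⟩ : Family Δ) = ⟨A.base, A.total, A.disp, f ≫ A.cls⟩) :
    (show pullback c A.disp ⟶ pullback A.cls A.disp from
      (toposCwF E).wkOf f A ⟨A.base, A.total, A.disp, c⟩ h) ≫ pullback.snd A.cls A.disp =
      pullback.snd c A.disp :=
  (pullback.lift_snd _ _ _).trans (Category.comp_id _)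

section FamilyPi

variable {Γ : E} (A : Family Γ) (B : Family (pullback A.cls A.disp))

/-- The dependent product of families. Its base classifies pairs of a fibre of `A.disp` and a
family of fibres of `B.disp` over it. -/
def familyPi : Family Γ :=
  ⟨partialProd A.disp B.base, partialProd A.disp B.total, partialProd.map A.disp B.disp,
    partialProd.lift A.cls B.cls⟩

variable {A B}

/-- The point of the total object of `familyPi A B` given by an element of this family. -/
def familyPt (F : FamilyElt Γ) (hF : F.fam = familyPi A B) : Γ ⟶ partialProd A.disp B.total :=
  F.lift _ hF

lemma familyPt_map (F : FamilyElt Γ) (hF : F.fam = familyPi A B) :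
    familyPt F hF ≫ partialProd.map A.disp B.disp = partialProd.lift A.cls B.cls :=
  F.lift_disp _ hF

/-- The value of an element of the dependent product at the generic argument. -/
def familyUncurry (F : FamilyElt Γ) (hF : F.fam = familyPi A B) :
    pullback A.cls A.disp ⟶ B.total :=
  partialProd.evalOn (familyPt F hF) A.cls (partialProd.proj_of_map_eq_lift (familyPt_map F hF))

lemma familyUncurry_disp (F : FamilyElt Γ) (hF : F.fam = familyPi A B) :
    familyUncurry F hF ≫ B.disp = B.cls :=
  partialProd.evalOn_of_map_eq_lift (familyPt_map F hF)

lemma familyUncurry_comp {Δ : E} (f : Δ ⟶ Γ) (F : FamilyElt Γ) (hF : F.fam = familyPi A B)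
    (w : pullback (f ≫ A.cls) A.disp ⟶ pullback A.cls A.disp)
    (w₁ : w ≫ pullback.fst _ _ = pullback.fst _ _ ≫ f)
    (w₂ : w ≫ pullback.snd _ _ = pullback.snd _ _)
    (hF' : (⟨F.base, F.total, F.disp, f ≫ F.elt⟩ : FamilyElt Δ).fam =
      familyPi ⟨A.base, A.total, A.disp, f ≫ A.cls⟩ ⟨B.base, B.total, B.disp, w ≫ B.cls⟩) :
    familyUncurry _ hF' = w ≫ familyUncurry F hF := by
  have hk := partialProd.proj_of_map_eq_lift (familyPt_map F hF)
  refine Eq.trans ?_ (partialProd.evalOn_comp f (familyPt F hF) A.cls hk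
    (by rw [Category.assoc, hk]) w w₁ w₂)
  exact partialProd.evalOn_congr (Category.assoc _ _ _) _ _ _

end FamilyPi

variable (E) in
/-- Dependent products in the category with families of a topos. -/
def toposPi : (toposCwF E).PiTypes where
  pi A B := familyPi A B
  pi_sub f A B := (Family.mk.injEq ..).mpr ⟨rfl, rfl, HEq.rfl, heq_of_eq
    (partialProd.comp_lift f A.cls B.cls _ ((toposCwF E).wk_p f A) (toposCwF_wkOf_snd f A _ rfl))⟩
  lam A B M hM := ⟨partialProd A.disp M.base, partialProd A.disp M.total,
    partialProd.map A.disp M.disp, partialProd.lift A.cls M.elt⟩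
  tp_lam A B M hM := by
    subst hM
    exact (Family.mk.injEq ..).mpr ⟨rfl, rfl, HEq.rfl, heq_of_eq (partialProd.lift_map _ _ _)⟩
  app A B F N hF hN := ⟨B.base, B.total, B.disp, (toposCwF E).inst N hN ≫ familyUncurry F hF⟩
  tp_app A B F N hF hN := (Family.mk.injEq ..).mpr ⟨rfl, rfl, HEq.rfl, heq_of_eq
    ((Category.assoc _ _ _).trans (congrArg (_ ≫ ·) (familyUncurry_disp F hF)))⟩
  app_lam A B M N hM hN := by
    subst hM
    refine (FamilyElt.mk.injEq ..).mpr ⟨rfl, rfl, HEq.rfl, heq_of_eq (congrArg (_ ≫ ·) ?_)⟩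
    exact (partialProd.evalOn_congr (Category.comp_id _) A.cls _
      (partialProd.lift_proj A.cls M.elt)).trans (partialProd.evalOn_lift A.cls M.elt _)
  lam_sub f A B M h := (FamilyElt.mk.injEq ..).mpr ⟨rfl, rfl, HEq.rfl, heq_of_eq
    (partialProd.comp_lift f A.cls M.elt _ ((toposCwF E).wk_p f A)
      (toposCwF_wkOf_snd f A _ rfl))⟩
  app_sub {Δ Γ} f A B F N hF hN := by
    refine (FamilyElt.mk.injEq ..).mpr ⟨rfl, rfl, HEq.rfl, heq_of_eq ?_⟩
    have hN' : (toposCwF E).tp ((toposCwF E).tsub f N) = (toposCwF E).sub f A := by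
      rw [(toposCwF E).tp_tsub, hN]
    refine (Category.assoc _ _ _).symm.trans ((congrArg (· ≫ familyUncurry F hF)
      ((toposCwF E).inst_comp f N hN hN').symm).trans
      ((Category.assoc _ _ _).trans (congrArg (_ ≫ ·) ?_)))
    exact (familyUncurry_comp f F hF _ ((toposCwF E).wk_p f A)
      (toposCwF_wkOf_snd f A _ rfl) _).symm

lemma isDependentProduct_toposPi : (toposPi E).IsDependentProduct := by
  intro Γ A B F hF
  refine ⟨⟨B.base, B.total, B.disp, familyUncurry F hF⟩, ?_, ?_⟩
  · exact (Family.mk.injEq ..).mpr ⟨rfl, rfl, HEq.rfl, heq_of_eq (familyUncurry_disp F hF)⟩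
  · refine Eq.trans ?_ (FamilyElt.eq_of_lift F _ hF)
    exact (FamilyElt.mk.injEq ..).mpr ⟨rfl, rfl, HEq.rfl, heq_of_eq (partialProd.eq_lift _ _
      (familyPt F hF) (partialProd.proj_of_map_eq_lift (familyPt_map F hF)) rfl).symm⟩

/-- The dependent sum of families, with the same base as the dependent product. -/
def familySigma {Γ : E} (A : Family Γ) (B : Family (pullback A.cls A.disp)) : Family Γ :=
  ⟨partialProd A.disp B.base, pullback (partialProd.eval A.disp B.base) B.disp,
    pullback.fst _ _ ≫ pullback.fst _ _, partialProd.lift A.cls B.cls⟩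

/-- The pairing isomorphism of the dependent sum of families. -/
def familyPair {Γ : E} (A : Family Γ) (B : Family (pullback A.cls A.disp)) :
    pullback B.cls B.disp ≅ pullback (partialProd.lift A.cls B.cls)
      (pullback.fst (partialProd.eval A.disp B.base) B.disp ≫ pullback.fst _ _) :=
  (partialProd.isPullback_sum A.cls B.cls B.disp).isoPullback

variable (E) in
/-- Dependent sums in the category with families of a topos. -/
def toposSigma : (toposCwF E).SigmaTypes :=
  CwF.SigmaTypes.ofIsIso (C := toposCwF E) (fun A B => familySigma A B)
    (fun f A B => (Family.mk.injEq ..).mpr ⟨rfl, rfl, HEq.rfl, heq_of_eq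
      (partialProd.comp_lift f A.cls B.cls _ ((toposCwF E).wk_p f A)
        (toposCwF_wkOf_snd f A _ rfl))⟩)
    (fun A B => (familyPair A B).hom) (fun _ _ => Iso.isIso_hom _)
    (fun _ _ => IsPullback.isoPullback_hom_fst _)
    (fun f A B => partialProd.isoPullback_comp A.cls B.cls B.disp f _ ((toposCwF E).wk_p f A)
      (toposCwF_wkOf_snd f A _ rfl) _ ((toposCwF E).wk_p ((toposCwF E).wk f A) B)
      (toposCwF_wkOf_snd _ B _ rfl) _ ((toposCwF E).wkOf_p f (familySigma A B) _ _)
      (toposCwF_wkOf_snd f (familySigma A B) _ _))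

lemma isDependentSum_toposSigma : (toposSigma E).IsDependentSum :=
  fun _ _ => Iso.isIso_hom _

end Topos

/-! ### Transport in dependent sums -/

section Sigma

variable {E : Type u} [Category.{v} E]

lemma pairElt_congr {C : CwF.{w₁, w₂} E} (S : C.SigmaTypes) {X Γ : E} {A : C.Ty Γ}
    {B : C.Ty (C.ext A)} {x y : X ⟶ C.ext A} {b c : C.Tm X} (e : x = y) (e' : b = c)
    (hb : C.tp b = C.sub x B) (hc : C.tp c = C.sub y B) :
    C.tsub (C.cons x b hb ≫ S.pair A B) (C.v (S.sig A B)) =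
      C.tsub (C.cons y c hc ≫ S.pair A B) (C.v (S.sig A B)) := by
  subst e e'; rfl

section Unpair

variable {C : CwF.{w₁, w₂} E} {S : C.SigmaTypes} (hS : S.IsDependentSum)

include hS in
lemma CwF.SigmaTypes.isIso_pair {Γ : E} (A : C.Ty Γ) (B : C.Ty (C.ext A)) : IsIso (S.pair A B) :=
  hS A B

/-- The inverse of the pairing morphism. -/
def CwF.SigmaTypes.pairInv {Γ : E} (A : C.Ty Γ) (B : C.Ty (C.ext A)) :
    C.ext (S.sig A B) ⟶ C.ext B :=
  @inv _ _ _ _ (S.pair A B) (isIso_pair hS A B)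

lemma CwF.SigmaTypes.pair_pairInv {Γ : E} (A : C.Ty Γ) (B : C.Ty (C.ext A)) :
    S.pair A B ≫ CwF.SigmaTypes.pairInv hS A B = 𝟙 _ :=
  @IsIso.hom_inv_id _ _ _ _ (S.pair A B) (isIso_pair hS A B)

lemma CwF.SigmaTypes.pairInv_pair {Γ : E} (A : C.Ty Γ) (B : C.Ty (C.ext A)) :
    CwF.SigmaTypes.pairInv hS A B ≫ S.pair A B = 𝟙 _ :=
  @IsIso.inv_hom_id _ _ _ _ (S.pair A B) (isIso_pair hS A B)

/-- The point of `Γ.A.B` that corresponds to an element of `Σ A B` over `x`. -/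
def CwF.SigmaTypes.unpair {X Γ : E} {A : C.Ty Γ} {B : C.Ty (C.ext A)} (x : X ⟶ Γ) (c : C.Tm X)
    (hc : C.tp c = C.sub x (S.sig A B)) : X ⟶ C.ext B :=
  C.cons x c hc ≫ CwF.SigmaTypes.pairInv hS A B

lemma CwF.SigmaTypes.unpair_pair {X Γ : E} {A : C.Ty Γ} {B : C.Ty (C.ext A)} (x : X ⟶ Γ)
    (c : C.Tm X) (hc : C.tp c = C.sub x (S.sig A B)) :
    CwF.SigmaTypes.unpair hS x c hc ≫ S.pair A B = C.cons x c hc := by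
  change (C.cons x c hc ≫ pairInv hS A B) ≫ S.pair A B = _
  rw [Category.assoc, pairInv_pair, Category.comp_id]

lemma CwF.SigmaTypes.eq_unpair {X Γ : E} {A : C.Ty Γ} {B : C.Ty (C.ext A)} (x : X ⟶ Γ)
    (c : C.Tm X) (hc : C.tp c = C.sub x (S.sig A B)) (w : X ⟶ C.ext B)
    (hw : w ≫ S.pair A B = C.cons x c hc) : w = CwF.SigmaTypes.unpair hS x c hc := by
  change w = C.cons x c hc ≫ pairInv hS A B
  rw [← hw, Category.assoc, pair_pairInv, Category.comp_id]

lemma CwF.SigmaTypes.unpair_p {X Γ : E} {A : C.Ty Γ} {B : C.Ty (C.ext A)} (x : X ⟶ Γ)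
    (c : C.Tm X) (hc : C.tp c = C.sub x (S.sig A B)) :
    CwF.SigmaTypes.unpair hS x c hc ≫ C.p B ≫ C.p A = x := by
  rw [← S.pair_p, ← Category.assoc, unpair_pair, C.cons_p]

lemma CwF.SigmaTypes.unpair_congr {X Γ : E} {A : C.Ty Γ} {B : C.Ty (C.ext A)} {x y : X ⟶ Γ}
    {c d : C.Tm X} (e : x = y) (e' : c = d) (hc : C.tp c = C.sub x (S.sig A B))
    (hd : C.tp d = C.sub y (S.sig A B)) :
    CwF.SigmaTypes.unpair hS x c hc = CwF.SigmaTypes.unpair hS y d hd := by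
  subst e e'; rfl

lemma CwF.SigmaTypes.comp_unpair {X Y Γ : E} {A : C.Ty Γ} {B : C.Ty (C.ext A)} (f : Y ⟶ X)
    (x : X ⟶ Γ) (c : C.Tm X) (hc : C.tp c = C.sub x (S.sig A B))
    (hc' : C.tp (C.tsub f c) = C.sub (f ≫ x) (S.sig A B)) :
    f ≫ CwF.SigmaTypes.unpair hS x c hc = CwF.SigmaTypes.unpair hS (f ≫ x) (C.tsub f c) hc' := by
  apply CwF.SigmaTypes.eq_unpair
  rw [Category.assoc, unpair_pair, C.comp_cons]

lemma CwF.SigmaTypes.unpair_wk {X Δ Γ : E} {A : C.Ty Γ} {B : C.Ty (C.ext A)} (f : Δ ⟶ Γ)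
    (x : X ⟶ Δ) (c : C.Tm X)
    (hc : C.tp c = C.sub x (S.sig (C.sub f A) (C.sub (C.wk f A) B)))
    (hc' : C.tp c = C.sub (x ≫ f) (S.sig A B)) :
    CwF.SigmaTypes.unpair hS x c hc ≫ C.wk (C.wk f A) B =
      CwF.SigmaTypes.unpair hS (x ≫ f) c hc' := by
  apply CwF.SigmaTypes.eq_unpair
  rw [Category.assoc, ← S.pair_sub, ← Category.assoc, unpair_pair, C.cons_wkOf]

lemma CwF.SigmaTypes.tp_tsub_pair {X Γ : E} {A : C.Ty Γ} {B : C.Ty (C.ext A)} {y : X ⟶ Γ}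
    (w : X ⟶ C.ext B) (hw : w ≫ C.p B ≫ C.p A = y) :
    C.tp (C.tsub (w ≫ S.pair A B) (C.v (S.sig A B))) = C.sub y (S.sig A B) := by
  rw [C.tp_tsub, C.tp_v, ← C.sub_comp, Category.assoc, S.pair_p, hw]

end Unpair

variable [CartesianMonoidalCategory E] [HasFiniteLimits E]
variable [MonoidalClosed E] [HasSubobjectClassifier E] {K : OrderedCommRingObj E}
variable {C : CwF.{w₁, w₂} E}

namespace Fib

omit [HasSubobjectClassifier E] in
lemma tp_tsub_fst {X Γ : E} {A : Fib K C Γ} {B : Fib K C (C.ext A.ty)} {x : X ⟶ Γ}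
    {w : X ⟶ C.ext B.ty} (hw : w ≫ C.p B.ty ≫ C.p A.ty = x) :
    C.tp (C.tsub (w ≫ C.p B.ty) (C.v A.ty)) = C.sub x A.ty := by
  rw [C.tp_tsub, C.tp_v, ← C.sub_comp, Category.assoc, hw]

lemma tp_tsub_snd {X Γ : E} {A : Fib K C Γ} {B : Fib K C (C.ext A.ty)}
    {q : X ⟶ PathObj K Γ} {w : X ⟶ C.ext B.ty} (hw : w ≫ C.p B.ty ≫ C.p A.ty = PathObj.src q) :
    C.tp (C.tsub w (C.v B.ty)) =
      C.sub (PathObj.src (A.liftPath q (C.tsub (w ≫ C.p B.ty) (C.v A.ty)) (tp_tsub_fst hw)))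
        B.ty := by
  rw [src_liftPath, C.cons_eta _ (by rw [Category.assoc, hw]), C.tp_tsub, C.tp_v, C.sub_comp]

/-- Transport of a point `w = (x, a, b)` of `Γ.A.B` along a path `q` starting at `x`: the result
is `(tgt q, q_* a, l_* b)`, where `l` is the lift of `q` at `a`. -/
def pairEndPt {X Γ : E} (A : Fib K C Γ) (B : Fib K C (C.ext A.ty)) (q : X ⟶ PathObj K Γ)
    (w : X ⟶ C.ext B.ty) (hw : w ≫ C.p B.ty ≫ C.p A.ty = PathObj.src q) : X ⟶ C.ext B.ty :=
  B.endPt (A.liftPath q (C.tsub (w ≫ C.p B.ty) (C.v A.ty)) (tp_tsub_fst hw)) (C.tsub w (C.v B.ty))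
    (tp_tsub_snd hw)

lemma pairEndPt_congr {X Γ : E} (A : Fib K C Γ) (B : Fib K C (C.ext A.ty))
    {q r : X ⟶ PathObj K Γ} {w w' : X ⟶ C.ext B.ty} (e : q = r) (e' : w = w')
    (hw : w ≫ C.p B.ty ≫ C.p A.ty = PathObj.src q)
    (hw' : w' ≫ C.p B.ty ≫ C.p A.ty = PathObj.src r) :
    A.pairEndPt B q w hw = A.pairEndPt B r w' hw' := by
  subst e e'; rfl

lemma pairEndPt_p {X Γ : E} (A : Fib K C Γ) (B : Fib K C (C.ext A.ty)) (q : X ⟶ PathObj K Γ)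
    (w : X ⟶ C.ext B.ty) (hw : w ≫ C.p B.ty ≫ C.p A.ty = PathObj.src q) :
    A.pairEndPt B q w hw ≫ C.p B.ty ≫ C.p A.ty = PathObj.tgt q := by
  rw [pairEndPt, endPt, ← Category.assoc, C.cons_p, tgt_liftPath, endPt, C.cons_p]

lemma comp_pairEndPt {X Y Γ : E} (A : Fib K C Γ) (B : Fib K C (C.ext A.ty)) (f : Y ⟶ X)
    (q : X ⟶ PathObj K Γ) (w : X ⟶ C.ext B.ty) (hw : w ≫ C.p B.ty ≫ C.p A.ty = PathObj.src q)
    (hw' : (f ≫ w) ≫ C.p B.ty ≫ C.p A.ty = PathObj.src (f ≫ q)) :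
    f ≫ A.pairEndPt B q w hw = A.pairEndPt B (f ≫ q) (f ≫ w) hw' := by
  rw [pairEndPt, comp_endPt]
  refine endPt_congr _ ?_ (C.tsub_comp _ _ _).symm _ _
  rw [comp_liftPath]
  exact liftPath_congr _ rfl (by rw [← C.tsub_comp, Category.assoc]) _ _

lemma pairEndPt_idp {X Γ : E} (A : Fib K C Γ) (B : Fib K C (C.ext A.ty)) (x : X ⟶ Γ)
    (w : X ⟶ C.ext B.ty)
    (hw : w ≫ C.p B.ty ≫ C.p A.ty = PathObj.src (PathObj.idp (K := K) x)) :
    A.pairEndPt B (PathObj.idp x) w hw = w := by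
  have hx : w ≫ C.p B.ty ≫ C.p A.ty = x := by rw [hw, PathObj.src_idp]
  have e : A.liftPath (PathObj.idp x) (C.tsub (w ≫ C.p B.ty) (C.v A.ty)) (tp_tsub_fst hw) =
      PathObj.idp (w ≫ C.p B.ty) := by
    rw [liftPath_idp _ _ _ (tp_tsub_fst hx), C.cons_eta _ (by rw [Category.assoc, hx])]
  have hb : C.tp (C.tsub w (C.v B.ty)) = C.sub (w ≫ C.p B.ty) B.ty := by
    rw [C.tp_tsub, C.tp_v, C.sub_comp]
  have e' := B.endPt_idp _ _ hb (by rw [PathObj.src_idp, hb])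
  rw [C.cons_eta _ rfl] at e'
  exact (endPt_congr _ e rfl _ _).trans e'

lemma pairEndPt_wk {X Δ Γ : E} (f : Δ ⟶ Γ) (A : Fib K C Γ) (B : Fib K C (C.ext A.ty))
    (q : X ⟶ PathObj K Δ) (w : X ⟶ C.ext (B.sub (A.wk f)).ty)
    (hw : w ≫ C.p (B.sub (A.wk f)).ty ≫ C.p (A.sub f).ty = PathObj.src q)
    (hw' : (w ≫ B.wk (A.wk f)) ≫ C.p B.ty ≫ C.p A.ty = PathObj.src (PathObj.map f q)) :
    (A.sub f).pairEndPt (B.sub (A.wk f)) q w hw ≫ B.wk (A.wk f) =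
      A.pairEndPt B (PathObj.map f q) (w ≫ B.wk (A.wk f)) hw' := by
  have e1 : B.wk (A.wk f) ≫ C.p B.ty = C.p (B.sub (A.wk f)).ty ≫ A.wk f := C.wk_p _ _
  have e2 : C.tsub (B.wk (A.wk f)) (C.v B.ty) = C.v (B.sub (A.wk f)).ty := C.tsub_v_wk _ _
  have e3 : C.tsub (A.wk f) (C.v A.ty) = C.v (A.sub f).ty := C.tsub_v_wk _ _
  have ea : C.tsub (w ≫ C.p (B.sub (A.wk f)).ty) (C.v (A.sub f).ty) =
      C.tsub ((w ≫ B.wk (A.wk f)) ≫ C.p B.ty) (C.v A.ty) := by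
    rw [Category.assoc, e1, ← Category.assoc, C.tsub_comp _ (A.wk f), e3]
  have eb : C.tsub w (C.v (B.sub (A.wk f)).ty) = C.tsub (w ≫ B.wk (A.wk f)) (C.v B.ty) := by
    rw [C.tsub_comp, e2]
  have el : PathObj.map (A.wk f) ((A.sub f).liftPath q
      (C.tsub (w ≫ C.p (B.sub (A.wk f)).ty) (C.v (A.sub f).ty)) (tp_tsub_fst hw)) =
      A.liftPath (PathObj.map f q) (C.tsub ((w ≫ B.wk (A.wk f)) ≫ C.p B.ty) (C.v A.ty))
        (tp_tsub_fst hw') := by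
    rw [← liftPath_map f A q _ (by rw [ea]; exact tp_tsub_fst hw')]
    exact liftPath_congr _ rfl ea _ _
  rw [pairEndPt, endPt_sub_wk _ _ _ _ _ (by rw [el, eb]; exact tp_tsub_snd hw')]
  exact endPt_congr _ el eb _ _

/-- The tap structure on `Σ A B`. -/
def sigmaTap {S : C.SigmaTypes} (hS : S.IsDependentSum) {Γ : E} (A : Fib K C Γ)
    (B : Fib K C (C.ext A.ty)) : Tap K C (S.sig A.ty B.ty) where
  tr q c hc := C.tsub (A.pairEndPt B q (CwF.SigmaTypes.unpair hS (PathObj.src q) c hc)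
    (CwF.SigmaTypes.unpair_p hS _ _ _) ≫ S.pair A.ty B.ty) (C.v (S.sig A.ty B.ty))
  tp_tr q c hc := CwF.SigmaTypes.tp_tsub_pair _ (pairEndPt_p _ _ _ _ _)
  tr_nat {X Y} f q c hc := by
    have hc' : C.tp (C.tsub f c) = C.sub (f ≫ PathObj.src q) (S.sig A.ty B.ty) := by
      rw [C.tp_tsub, hc, C.sub_comp]
    have e : f ≫ CwF.SigmaTypes.unpair hS (PathObj.src q) c hc =
        CwF.SigmaTypes.unpair hS (PathObj.src (f ≫ q)) (C.tsub f c)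
          (by rw [PathObj.comp_src, hc']) := by
      rw [CwF.SigmaTypes.comp_unpair hS f _ c hc hc']
      exact CwF.SigmaTypes.unpair_congr hS (PathObj.comp_src f q).symm rfl _ _
    rw [← C.tsub_comp, ← Category.assoc, comp_pairEndPt _ _ _ _ _ _
      (by rw [e, CwF.SigmaTypes.unpair_p])]
    congr 2
    exact pairEndPt_congr _ _ rfl e _ _
  tr_idp x c hc := by
    rw [pairEndPt_idp, CwF.SigmaTypes.unpair_pair, C.cons_v]

lemma isSigmaTap_sigmaTap {S : C.SigmaTypes} (hS : S.IsDependentSum) {Γ : E} (A : Fib K C Γ)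
    (B : Fib K C (C.ext A.ty)) : IsSigmaTap K S A B (sigmaTap hS A B) := by
  intro X q a b ha hb
  have hl : C.tp b = C.sub (PathObj.src (A.liftPath q a ha)) B.ty := by rw [src_liftPath, hb]
  refine ⟨A.liftPath q a ha, isLift_liftPath _ _ _ _, hl, ?_, ?_⟩
  · rw [B.tap.tp_tr, tgt_liftPath, endPt]
  · have e : C.cons (C.cons (PathObj.src q) a ha) b hb =
        CwF.SigmaTypes.unpair hS (PathObj.src q) (pairElt S (C.cons (PathObj.src q) a ha) b hb)
          (tp_pairElt S _ b hb _ (C.cons_p _ _ _)) := by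
      apply CwF.SigmaTypes.eq_unpair
      refine (C.cons_eta _ ?_ _).symm
      rw [Category.assoc, S.pair_p, ← Category.assoc, C.cons_p, C.cons_p]
    have hw : C.cons (C.cons (PathObj.src q) a ha) b hb ≫ C.p B.ty ≫ C.p A.ty =
        PathObj.src q := by
      rw [← Category.assoc, C.cons_p, C.cons_p]
    have key : A.pairEndPt B q (C.cons (C.cons (PathObj.src q) a ha) b hb) hw =
        B.endPt (A.liftPath q a ha) b hl :=
      endPt_congr _ (liftPath_congr _ rfl (by rw [C.cons_p, C.cons_v]) _ _) (C.cons_v _ _ _) _ _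
    have key' : A.pairEndPt B q _ (CwF.SigmaTypes.unpair_p hS _ _ _) = _ :=
      (pairEndPt_congr A B rfl e.symm _ hw).trans key
    refine (congrArg (fun w => C.tsub (w ≫ S.pair A.ty B.ty) (C.v (S.sig A.ty B.ty))) key').trans ?_
    exact pairElt_congr S (tgt_liftPath _ _ _ _) rfl _ _

/-- The fibration `Σ A B`. -/
def sigma {S : C.SigmaTypes} (hS : S.IsDependentSum) {Γ : E} (A : Fib K C Γ)
    (B : Fib K C (C.ext A.ty)) : Fib K C Γ := ⟨S.sig A.ty B.ty, sigmaTap hS A B⟩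

lemma sub_sigma {S : C.SigmaTypes} (hS : S.IsDependentSum) {Δ Γ : E} (f : Δ ⟶ Γ) (A : Fib K C Γ)
    (B : Fib K C (C.ext A.ty)) :
    (sigma hS A B).sub f = sigma hS (A.sub f) (B.sub (A.wk f)) := by
  refine ext_fib (S.sig_sub f A.ty B.ty) fun {X} q c h₁ h₂ => ?_
  have h₃ : C.tp c = C.sub (PathObj.src q ≫ f) (S.sig A.ty B.ty) := by rw [C.sub_comp]; exact h₁
  have h₄ : C.tp c = C.sub (PathObj.src (PathObj.map f q)) (S.sig A.ty B.ty) := by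
    rw [PathObj.src_map, h₃]
  have e : CwF.SigmaTypes.unpair hS (PathObj.src q) c h₂ ≫ B.wk (A.wk f) =
      CwF.SigmaTypes.unpair hS (PathObj.src (PathObj.map f q)) c h₄ :=
    (CwF.SigmaTypes.unpair_wk hS f (PathObj.src q) c h₂ h₃).trans
      (CwF.SigmaTypes.unpair_congr hS (PathObj.src_map f q).symm rfl _ _)
  have hw := CwF.SigmaTypes.unpair_p hS (PathObj.src q) c h₂
  have key := pairEndPt_wk f A B q _ hw (by rw [e]; exact CwF.SigmaTypes.unpair_p hS _ _ _)
  have key' := key.trans (pairEndPt_congr A B rfl e _ (CwF.SigmaTypes.unpair_p hS _ _ _))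
  have ev : C.tsub (C.wkOf f (S.sig A.ty B.ty) _ (S.sig_sub f A.ty B.ty).symm)
      (C.v (S.sig A.ty B.ty)) = C.v (S.sig (C.sub f A.ty) (C.sub (C.wk f A.ty) B.ty)) :=
    C.tsub_v_wkOf _ _ _ _
  refine (congrArg (fun w => C.tsub (w ≫ S.pair A.ty B.ty) (C.v (S.sig A.ty B.ty)))
    key'.symm).trans ?_
  refine (congrArg (fun w => C.tsub w (C.v (S.sig A.ty B.ty)))
    ((Category.assoc _ _ _).trans (congrArg (_ ≫ ·) (S.pair_sub f A.ty B.ty).symm))).trans ?_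
  exact (congrArg (fun w => C.tsub w (C.v (S.sig A.ty B.ty))) (Category.assoc _ _ _).symm).trans
    ((C.tsub_comp _ _ _).trans (congrArg (C.tsub _) ev))

end Fib

variable (K) in
/-- Dependent sums in the category with families of fibrations. -/
def fibSigma {S : C.SigmaTypes} (hS : S.IsDependentSum) : (fibCwF K C).SigmaTypes :=
  CwF.SigmaTypes.ofIsIso (C := fibCwF K C) (fun A B => Fib.sigma hS A B)
    (fun f A B => Fib.sub_sigma hS f A B) (fun A B => S.pair A.ty B.ty)
    (fun A B => hS A.ty B.ty) (fun A B => S.pair_p A.ty B.ty)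
    (fun f A B => S.pair_sub f A.ty B.ty)

end Sigma

/-! ### Transport in dependent products -/

section Pi

variable {E : Type u} [Category.{v} E]

namespace CwF

variable (C : CwF.{w₁, w₂} E)

lemma wk_wkOf {Θ Δ Γ : E} (g : Θ ⟶ Δ) (f : Δ ⟶ Γ) (A : C.Ty Γ) (A' : C.Ty Δ) (h : A' = C.sub f A)
    (h' : C.sub g A' = C.sub (g ≫ f) A) :
    C.wk g A' ≫ C.wkOf f A A' h = C.wkOf (g ≫ f) A (C.sub g A') h' := by
  apply C.hom_ext
  · rw [Category.assoc, wkOf_p, ← Category.assoc, wk_p, wkOf_p, Category.assoc]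
  · rw [C.tsub_comp, tsub_v_wkOf, tsub_v_wk, tsub_v_wkOf]

lemma wkOf_congr {Δ Γ : E} {f g : Δ ⟶ Γ} (e : f = g) (A : C.Ty Γ) (A' : C.Ty Δ)
    (h : A' = C.sub f A) (h' : A' = C.sub g A) : C.wkOf f A A' h = C.wkOf g A A' h' := by
  subst e; rfl

lemma inst_v_wk {Γ : E} (A : C.Ty Γ) (h : C.tp (C.v A) = C.sub (C.p A) A) :
    C.inst (C.v A) h ≫ C.wk (C.p A) A = 𝟙 _ := by
  apply C.hom_ext
  · rw [Category.assoc, wk_p, ← Category.assoc, inst, C.cons_p]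
  · rw [C.tsub_comp, tsub_v_wk, inst, C.cons_v, C.tsub_id]

lemma inst_wk {X Γ : E} (x : X ⟶ Γ) (A : C.Ty Γ) (a : C.Tm X) (h : C.tp a = C.sub x A) :
    C.inst a h ≫ C.wk x A = C.cons x a h := by
  rw [inst, C.cons_wk _ _ _ _ _ (by rw [h, Category.id_comp])]
  exact C.cons_congr (Category.id_comp _) rfl _ _

variable {C} (P : C.PiTypes)

namespace PiTypes

lemma app_congr {Γ : E} {A : C.Ty Γ} {B B' : C.Ty (C.ext A)} (e : B = B') {F F' N N' : C.Tm Γ}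
    (eF : F = F') (eN : N = N') (hF : C.tp F = P.pi A B) (hN : C.tp N = A)
    (hF' : C.tp F' = P.pi A B') (hN' : C.tp N' = A) :
    P.app A B F N hF hN = P.app A B' F' N' hF' hN' := by
  subst e eF eN; rfl

lemma lam_congr {Γ : E} {A : C.Ty Γ} {B B' : C.Ty (C.ext A)} (e : B = B') {M M' : C.Tm (C.ext A)}
    (eM : M = M') (hM : C.tp M = B) (hM' : C.tp M' = B') : P.lam A B M hM = P.lam A B' M' hM' := by
  subst e eM; rfl

lemma lam_eta (hP : P.IsDependentProduct) {Γ : E} (A : C.Ty Γ) (B : C.Ty (C.ext A)) (F : C.Tm Γ)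
    (hF : C.tp F = P.pi A B)
    (hF' : C.tp (C.tsub (C.p A) F) = P.pi (C.sub (C.p A) A) (C.sub (C.wk (C.p A) A) B))
    (hM : C.tp (P.app _ _ (C.tsub (C.p A) F) (C.v A) hF' (C.tp_v A)) = B) :
    P.lam A B (P.app _ _ (C.tsub (C.p A) F) (C.v A) hF' (C.tp_v A)) hM = F := by
  obtain ⟨M, h, rfl⟩ := hP A B F hF
  refine P.lam_congr rfl ?_ _ _
  have hM' : C.tp (C.tsub (C.wk (C.p A) A) M) = C.sub (C.wk (C.p A) A) B := by rw [C.tp_tsub, h]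
  rw [P.app_congr rfl (P.lam_sub (C.p A) A B M h) rfl _ _ (P.tp_lam _ _ _ hM') (C.tp_v A),
    P.app_lam, ← C.tsub_comp, inst_v_wk, C.tsub_id]

end PiTypes

end CwF

section AppElt

variable {C : CwF.{w₁, w₂} E} (P : C.PiTypes)

lemma appElt_congr {X Γ : E} {A : C.Ty Γ} {B : C.Ty (C.ext A)} {x y : X ⟶ Γ} {F G a b : C.Tm X}
    (e : x = y) (eF : F = G) (ea : a = b) (hF : C.tp F = C.sub x (P.pi A B))
    (ha : C.tp a = C.sub x A) (hG : C.tp G = C.sub y (P.pi A B)) (hb : C.tp b = C.sub y A) :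
    appElt P x F a hF ha = appElt P y G b hG hb := by
  subst e eF ea; rfl

/-- Application may be computed in any family `A'` equal to the re-indexed family `A[x]`. -/
lemma app_wkOf {X Γ : E} {A : C.Ty Γ} {B : C.Ty (C.ext A)} (x : X ⟶ Γ) (A' : C.Ty X)
    (h : A' = C.sub x A) (F a : C.Tm X) (hF : C.tp F = C.sub x (P.pi A B))
    (ha : C.tp a = C.sub x A) (hF' : C.tp F = P.pi A' (C.sub (C.wkOf x A A' h) B))
    (ha' : C.tp a = A') :
    P.app A' (C.sub (C.wkOf x A A' h) B) F a hF' ha' = appElt P x F a hF ha := by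
  subst h; rfl

lemma tp_appElt {X Γ : E} {A : C.Ty Γ} {B : C.Ty (C.ext A)} (x : X ⟶ Γ) (F a : C.Tm X)
    (hF : C.tp F = C.sub x (P.pi A B)) (ha : C.tp a = C.sub x A) :
    C.tp (appElt P x F a hF ha) = C.sub (C.cons x a ha) B := by
  rw [appElt, P.tp_app, ← C.sub_comp, C.inst_wk]

lemma tp_tsub_pi {X Y Γ : E} {D : C.Ty Γ} (f : Y ⟶ X) {x : X ⟶ Γ} {F : C.Tm X}
    (hF : C.tp F = C.sub x D) : C.tp (C.tsub f F) = C.sub (f ≫ x) D := by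
  rw [C.tp_tsub, hF, C.sub_comp]

/-- Application computed in the re-indexing along `g` of families re-indexed along `f`. -/
lemma app_sub_wk {X Δ Γ : E} {A : C.Ty Γ} {B : C.Ty (C.ext A)} (g : X ⟶ Δ) (f : Δ ⟶ Γ)
    (A' : C.Ty Δ) (h : A' = C.sub f A) (F a : C.Tm X) (hF : C.tp F = C.sub (g ≫ f) (P.pi A B))
    (ha : C.tp a = C.sub (g ≫ f) A)
    (hF' : C.tp F = P.pi (C.sub g A') (C.sub (C.wk g A') (C.sub (C.wkOf f A A' h) B)))
    (ha' : C.tp a = C.sub g A') :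
    P.app (C.sub g A') (C.sub (C.wk g A') (C.sub (C.wkOf f A A' h) B)) F a hF' ha' =
      appElt P (g ≫ f) F a hF ha := by
  have h' : C.sub g A' = C.sub (g ≫ f) A := by rw [h, C.sub_comp]
  have eB : C.sub (C.wk g A') (C.sub (C.wkOf f A A' h) B) =
      C.sub (C.wkOf (g ≫ f) A (C.sub g A') h') B := by
    rw [← C.sub_comp, C.wk_wkOf g f A A' h h']
  rw [P.app_congr eB rfl rfl _ _ (by rw [hF', eB]) ha', app_wkOf]

lemma tsub_appElt {X Y Γ : E} {A : C.Ty Γ} {B : C.Ty (C.ext A)} (f : Y ⟶ X) (x : X ⟶ Γ)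
    (F a : C.Tm X) (hF : C.tp F = C.sub x (P.pi A B)) (ha : C.tp a = C.sub x A) :
    C.tsub f (appElt P x F a hF ha) =
      appElt P (f ≫ x) (C.tsub f F) (C.tsub f a) (tp_tsub_pi f hF) (tp_tsub_pi f ha) := by
  rw [appElt, P.app_sub]
  exact app_sub_wk P f x _ rfl _ _ _ _ _ _

lemma appElt_sub {X Δ Γ : E} {A : C.Ty Γ} {B : C.Ty (C.ext A)} (g : X ⟶ Δ) (f : Δ ⟶ Γ)
    (F a : C.Tm X) (hF : C.tp F = C.sub (g ≫ f) (P.pi A B)) (ha : C.tp a = C.sub (g ≫ f) A)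
    (hF' : C.tp F = C.sub g (P.pi (C.sub f A) (C.sub (C.wk f A) B)))
    (ha' : C.tp a = C.sub g (C.sub f A)) :
    appElt P g F a hF' ha' = appElt P (g ≫ f) F a hF ha :=
  app_sub_wk P g f _ rfl F a hF ha _ _

end AppElt

variable [CartesianMonoidalCategory E] [HasFiniteLimits E]
variable [MonoidalClosed E] [HasSubobjectClassifier E] {K : OrderedCommRingObj E}
variable {C : CwF.{w₁, w₂} E} (P : C.PiTypes)

namespace Fib

section PiVal

variable {X Γ : E} {A : Fib K C Γ} {B : Fib K C (C.ext A.ty)} {q : X ⟶ PathObj K Γ}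
variable {F a : C.Tm X}

lemma tp_eq_src_rev (ha : C.tp a = C.sub (PathObj.tgt q) A.ty) :
    C.tp a = C.sub (PathObj.src (PathObj.rev q)) A.ty := by rw [PathObj.src_rev, ha]

lemma tp_tr_rev (ha : C.tp a = C.sub (PathObj.tgt q) A.ty) :
    C.tp (A.tap.tr (PathObj.rev q) a (tp_eq_src_rev ha)) = C.sub (PathObj.src q) A.ty := by
  rw [A.tap.tp_tr, PathObj.tgt_rev]

lemma tp_appElt_rev (hF : C.tp F = C.sub (PathObj.src q) (P.pi A.ty B.ty))
    (ha : C.tp a = C.sub (PathObj.tgt q) A.ty) :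
    C.tp (appElt P (PathObj.src q) F _ hF (tp_tr_rev ha)) =
      C.sub (PathObj.src (PathObj.rev (A.liftPath (PathObj.rev q) a (tp_eq_src_rev ha)))) B.ty := by
  rw [tp_appElt, PathObj.src_rev, tgt_liftPath, endPt]
  congr 1
  exact C.cons_congr (PathObj.tgt_rev q).symm rfl _ _

end PiVal

/-- The value `(q_* F) a = (rev (lift (rev q, a)))_* F ((rev q)_* a)` of a transported function. -/
def piVal {X Γ : E} (A : Fib K C Γ) (B : Fib K C (C.ext A.ty)) (q : X ⟶ PathObj K Γ) (F a : C.Tm X)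
    (hF : C.tp F = C.sub (PathObj.src q) (P.pi A.ty B.ty))
    (ha : C.tp a = C.sub (PathObj.tgt q) A.ty) : C.Tm X :=
  B.tap.tr (PathObj.rev (A.liftPath (PathObj.rev q) a (tp_eq_src_rev ha)))
    (appElt P (PathObj.src q) F (A.tap.tr (PathObj.rev q) a (tp_eq_src_rev ha)) hF (tp_tr_rev ha))
    (tp_appElt_rev P hF ha)

lemma tp_piVal {X Γ : E} (A : Fib K C Γ) (B : Fib K C (C.ext A.ty)) (q : X ⟶ PathObj K Γ)
    (F a : C.Tm X) (hF : C.tp F = C.sub (PathObj.src q) (P.pi A.ty B.ty))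
    (ha : C.tp a = C.sub (PathObj.tgt q) A.ty) :
    C.tp (piVal P A B q F a hF ha) = C.sub (C.cons (PathObj.tgt q) a ha) B.ty := by
  rw [piVal, B.tap.tp_tr, PathObj.tgt_rev, src_liftPath]
  congr 1
  exact C.cons_congr (PathObj.src_rev q) rfl _ _

lemma piVal_congr {X Γ : E} (A : Fib K C Γ) (B : Fib K C (C.ext A.ty)) {q r : X ⟶ PathObj K Γ}
    {F G a b : C.Tm X} (e : q = r) (eF : F = G) (ea : a = b)
    (hF : C.tp F = C.sub (PathObj.src q) (P.pi A.ty B.ty))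
    (ha : C.tp a = C.sub (PathObj.tgt q) A.ty)
    (hG : C.tp G = C.sub (PathObj.src r) (P.pi A.ty B.ty))
    (hb : C.tp b = C.sub (PathObj.tgt r) A.ty) :
    piVal P A B q F a hF ha = piVal P A B r G b hG hb := by
  subst e eF ea; rfl

lemma tsub_piVal {X Y Γ : E} (A : Fib K C Γ) (B : Fib K C (C.ext A.ty)) (f : Y ⟶ X)
    (q : X ⟶ PathObj K Γ) (F a : C.Tm X) (hF : C.tp F = C.sub (PathObj.src q) (P.pi A.ty B.ty))
    (ha : C.tp a = C.sub (PathObj.tgt q) A.ty)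
    (hF' : C.tp (C.tsub f F) = C.sub (PathObj.src (f ≫ q)) (P.pi A.ty B.ty))
    (ha' : C.tp (C.tsub f a) = C.sub (PathObj.tgt (f ≫ q)) A.ty) :
    C.tsub f (piVal P A B q F a hF ha) =
      piVal P A B (f ≫ q) (C.tsub f F) (C.tsub f a) hF' ha' := by
  rw [piVal, B.tap.tr_nat]
  refine B.tap.tr_congr ?_ ?_ _ _
  · rw [PathObj.comp_rev, comp_liftPath]
    congr 1
    exact liftPath_congr _ (PathObj.comp_rev f q) rfl _ _
  · rw [tsub_appElt]
    refine appElt_congr P (PathObj.comp_src f q).symm rfl ?_ _ _ _ _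
    rw [A.tap.tr_nat]
    exact A.tap.tr_congr (PathObj.comp_rev f q) rfl _ _

lemma piVal_idp {X Γ : E} (A : Fib K C Γ) (B : Fib K C (C.ext A.ty)) (x : X ⟶ Γ) (F a : C.Tm X)
    (hF : C.tp F = C.sub x (P.pi A.ty B.ty)) (ha : C.tp a = C.sub x A.ty) (hF') (ha') :
    piVal P A B (PathObj.idp x) F a hF' ha' = appElt P x F a hF ha := by
  have er : A.tap.tr (PathObj.rev (PathObj.idp x)) a (tp_eq_src_rev ha') = a :=
    (A.tap.tr_congr (PathObj.rev_idp x) rfl _ (by rw [PathObj.src_idp, ha])).trans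
      (A.tap.tr_idp x a ha)
  have el : PathObj.rev (A.liftPath (PathObj.rev (PathObj.idp x)) a (tp_eq_src_rev ha')) =
      PathObj.idp (C.cons x a ha) := by
    rw [liftPath_congr A (PathObj.rev_idp x) rfl _ (by rw [PathObj.src_idp, ha]),
      liftPath_idp A x a ha, PathObj.rev_idp]
  have eF : appElt P (PathObj.src (PathObj.idp x)) F _ hF' (tp_tr_rev ha') =
      appElt P x F a hF ha := appElt_congr P (PathObj.src_idp x) rfl er _ _ _ _
  have ht := tp_appElt P x F a hF ha
  rw [piVal, B.tap.tr_congr el eF _ (by rw [PathObj.src_idp, ht]), B.tap.tr_idp _ _ ht]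

lemma piVal_map {X Δ Γ : E} (f : Δ ⟶ Γ) (A : Fib K C Γ) (B : Fib K C (C.ext A.ty))
    (q : X ⟶ PathObj K Δ) (F a : C.Tm X)
    (hF : C.tp F = C.sub (PathObj.src (PathObj.map f q)) (P.pi A.ty B.ty))
    (ha : C.tp a = C.sub (PathObj.tgt (PathObj.map f q)) A.ty)
    (hF' : C.tp F = C.sub (PathObj.src q) (P.pi (A.sub f).ty (B.sub (A.wk f)).ty))
    (ha' : C.tp a = C.sub (PathObj.tgt q) (A.sub f).ty) :
    piVal P A B (PathObj.map f q) F a hF ha =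
      piVal P (A.sub f) (B.sub (A.wk f)) q F a hF' ha' := by
  have er : A.tap.tr (PathObj.rev (PathObj.map f q)) a (tp_eq_src_rev ha) =
      (A.sub f).tap.tr (PathObj.rev q) a (tp_eq_src_rev ha') :=
    A.tap.tr_congr (PathObj.map_rev f q).symm rfl _ _
  have ha'' : C.tp a = C.sub (PathObj.src (PathObj.map f (PathObj.rev q))) A.ty := by
    rw [PathObj.map_rev]; exact tp_eq_src_rev ha
  refine B.tap.tr_congr ?_ ?_ _ _
  · rw [liftPath_congr A (PathObj.map_rev f q).symm rfl _ ha'',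
      liftPath_map f A _ a ha'' (tp_eq_src_rev ha'), PathObj.map_rev]
  · refine Eq.trans ?_ (appElt_sub P (PathObj.src q) f F _ ?_ ?_ hF' (tp_tr_rev ha')).symm
    · exact appElt_congr P (PathObj.src_map f q) rfl er _ _ _ _
    · rw [← PathObj.src_map, hF]
    · rw [← er, ← PathObj.src_map]; exact tp_tr_rev ha

section PiTr

variable {X Γ : E} (A : Fib K C Γ) (B : Fib K C (C.ext A.ty)) (q : X ⟶ PathObj K Γ) (F : C.Tm X)
variable (hF : C.tp F = C.sub (PathObj.src q) (P.pi A.ty B.ty))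
variable (A' : C.Ty X) (h : A' = C.sub (PathObj.tgt q) A.ty)

omit [HasSubobjectClassifier E] in
include h in
lemma tp_v_tgt : C.tp (C.v A') = C.sub (PathObj.tgt (C.p A' ≫ q)) A.ty := by
  rw [C.tp_v, PathObj.comp_tgt, C.sub_comp, h]

omit [HasSubobjectClassifier E] in
include hF in
lemma tp_tsub_p_src : C.tp (C.tsub (C.p A') F) =
    C.sub (PathObj.src (C.p A' ≫ q)) (P.pi A.ty B.ty) := by
  rw [C.tp_tsub, hF, PathObj.comp_src, C.sub_comp]

lemma tp_piVal_v :
    C.tp (piVal P A B (C.p A' ≫ q) (C.tsub (C.p A') F) (C.v A')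
      (tp_tsub_p_src P A B q F hF A') (tp_v_tgt A q A' h)) =
      C.sub (C.wkOf (PathObj.tgt q) A.ty A' h) B.ty := by
  rw [tp_piVal, CwF.wkOf]
  congr 1
  exact C.cons_congr (PathObj.comp_tgt _ _) rfl _ _

/-- The transported function `q_* F = λ a, (q_* F) a`, abstracted over a family `A'` equal to the
re-indexed family `A[tgt q]`. -/
def piTr : C.Tm X :=
  P.lam A' (C.sub (C.wkOf (PathObj.tgt q) A.ty A' h) B.ty)
    (piVal P A B (C.p A' ≫ q) (C.tsub (C.p A') F) (C.v A') (tp_tsub_p_src P A B q F hF A')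
      (tp_v_tgt A q A' h)) (tp_piVal_v P A B q F hF A' h)

variable {A'} in
lemma piTr_eq {A'' : C.Ty X} (h' : A'' = C.sub (PathObj.tgt q) A.ty) :
    piTr P A B q F hF A' h = piTr P A B q F hF A'' h' := by
  subst h h'; rfl

lemma tp_piTr : C.tp (piTr P A B q F hF A' h) = C.sub (PathObj.tgt q) (P.pi A.ty B.ty) := by
  rw [piTr, P.tp_lam, P.pi_sub]
  subst h
  rfl

end PiTr

lemma tsub_piTr {X Y Γ : E} (A : Fib K C Γ) (B : Fib K C (C.ext A.ty)) (f : Y ⟶ X)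
    (q : X ⟶ PathObj K Γ) (F : C.Tm X) (hF : C.tp F = C.sub (PathObj.src q) (P.pi A.ty B.ty))
    (A' : C.Ty X) (h : A' = C.sub (PathObj.tgt q) A.ty)
    (hF' : C.tp (C.tsub f F) = C.sub (PathObj.src (f ≫ q)) (P.pi A.ty B.ty))
    (h' : C.sub f A' = C.sub (PathObj.tgt (f ≫ q)) A.ty) :
    C.tsub f (piTr P A B q F hF A' h) = piTr P A B (f ≫ q) (C.tsub f F) hF' (C.sub f A') h' := by
  have e : C.wk f A' ≫ C.p A' = C.p (C.sub f A') ≫ f := C.wk_p f A'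
  have eF : C.tsub (C.wk f A') (C.tsub (C.p A') F) =
      C.tsub (C.p (C.sub f A')) (C.tsub f F) := by
    rw [← C.tsub_comp, e, C.tsub_comp]
  have eq : C.wk f A' ≫ C.p A' ≫ q = C.p (C.sub f A') ≫ f ≫ q := by
    rw [← Category.assoc, e, Category.assoc]
  rw [piTr, P.lam_sub]
  refine P.lam_congr ?_ ?_ _ _
  · rw [← C.sub_comp, C.wk_wkOf f _ _ _ h (by rw [h', PathObj.comp_tgt])]
    congr 1
    exact C.wkOf_congr (PathObj.comp_tgt f q).symm _ _ _ _
  · have hF₁ := tp_tsub_p_src P A B (f ≫ q) (C.tsub f F) hF' (C.sub f A')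
    have ha₁ := tp_v_tgt A (f ≫ q) (C.sub f A') h'
    rw [tsub_piVal P A B _ _ _ _ _ _ (by rw [eF, eq, hF₁]) (by rw [C.tsub_v_wk, eq, ha₁])]
    exact piVal_congr P A B eq eF (C.tsub_v_wk _ _) _ _ _ _

lemma piTr_idp (hP : P.IsDependentProduct) {X Γ : E} (A : Fib K C Γ) (B : Fib K C (C.ext A.ty))
    (x : X ⟶ Γ) (F : C.Tm X) (hF : C.tp F = C.sub x (P.pi A.ty B.ty)) (hF')
    (h : C.sub x A.ty = C.sub (PathObj.tgt (PathObj.idp (K := K) x)) A.ty) :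
    piTr P A B (PathObj.idp x) F hF' (C.sub x A.ty) h = F := by
  have hF₀ : C.tp F = P.pi (C.sub x A.ty) (C.sub (C.wk x A.ty) B.ty) := by rw [hF, P.pi_sub]
  have hF₁ : C.tp (C.tsub (C.p (C.sub x A.ty)) F) = P.pi _ _ :=
    (C.tp_tsub _ _).trans ((congrArg _ hF₀).trans (P.pi_sub _ _ _))
  have hF₂ := tp_tsub_pi (C.p (C.sub x A.ty)) hF
  have ha₂ : C.tp (C.v (C.sub x A.ty)) = C.sub (C.p (C.sub x A.ty) ≫ x) A.ty := by
    rw [C.tp_v, C.sub_comp]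
  have eB : C.wkOf (PathObj.tgt (PathObj.idp (K := K) x)) A.ty (C.sub x A.ty) h = C.wk x A.ty :=
    C.wkOf_congr (PathObj.tgt_idp x) _ _ _ _
  have hM : C.tp (P.app _ _ (C.tsub (C.p (C.sub x A.ty)) F) (C.v (C.sub x A.ty)) hF₁
      (C.tp_v _)) = C.sub (C.wk x A.ty) B.ty := by
    rw [P.tp_app, ← C.sub_comp, C.inst_v_wk, C.sub_id]
  refine Eq.trans ?_ (P.lam_eta hP _ _ F hF₀ hF₁ hM)
  refine P.lam_congr (by rw [eB]) ?_ _ _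
  refine Eq.trans ?_ (app_sub_wk P (C.p (C.sub x A.ty)) x _ rfl _ _ hF₂ ha₂ hF₁ (C.tp_v _)).symm
  have e : C.p (C.sub x A.ty) ≫ PathObj.idp (K := K) x = PathObj.idp (C.p (C.sub x A.ty) ≫ x) :=
    PathObj.comp_idp _ _
  rw [piVal_congr P A B e rfl rfl _ _ (by rw [PathObj.src_idp, hF₂])
    (by rw [PathObj.tgt_idp, ha₂]), piVal_idp]

/-- The tap structure on `Π A B`. -/
def piTap (hP : P.IsDependentProduct) {Γ : E} (A : Fib K C Γ) (B : Fib K C (C.ext A.ty)) :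
    Tap K C (P.pi A.ty B.ty) where
  tr q F hF := piTr P A B q F hF _ rfl
  tp_tr q F hF := tp_piTr P A B q F hF _ rfl
  tr_nat f q F hF := by
    have h' : C.sub f (C.sub (PathObj.tgt q) A.ty) = C.sub (PathObj.tgt (f ≫ q)) A.ty := by
      rw [PathObj.comp_tgt, C.sub_comp]
    rw [tsub_piTr P A B f q F hF _ rfl (by rw [C.tp_tsub, hF, PathObj.comp_src, C.sub_comp]) h']
    exact piTr_eq P A B _ _ _ _ _
  tr_idp x F hF := by
    rw [piTr_eq P A B _ _ _ rfl (A'' := C.sub x A.ty) (by rw [PathObj.tgt_idp]),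
      piTr_idp P hP A B x F hF]

lemma isPiTap_piTap (hP : P.IsDependentProduct) {Γ : E} (A : Fib K C Γ)
    (B : Fib K C (C.ext A.ty)) : IsPiTap K P A B (piTap P hP A B) := by
  intro X q F a hF ha
  refine ⟨PathObj.rev q, A.liftPath (PathObj.rev q) a (tp_eq_src_rev ha), _,
    PathObj.isRev_rev q, isLift_liftPath _ _ _ _, PathObj.isRev_rev _, tp_eq_src_rev ha,
    tp_tr_rev ha, tp_appElt_rev P hF ha, ?_⟩
  refine (P.app_lam _ _ _ a (tp_piVal_v P A B q F hF _ rfl) ha).trans ?_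
  have e : C.inst a ha ≫ C.p (C.sub (PathObj.tgt q) A.ty) = 𝟙 X := C.cons_p _ _ _
  have eq : C.inst a ha ≫ C.p (C.sub (PathObj.tgt q) A.ty) ≫ q = q := by
    rw [← Category.assoc, e, Category.id_comp]
  have eF : C.tsub (C.inst a ha) (C.tsub (C.p (C.sub (PathObj.tgt q) A.ty)) F) = F := by
    rw [← C.tsub_comp, e, C.tsub_id]
  have ea : C.tsub (C.inst a ha) (C.v (C.sub (PathObj.tgt q) A.ty)) = a := C.cons_v _ _ _
  rw [tsub_piVal P A B _ _ _ _ _ _ (by rw [eF, eq, hF]) (by rw [ea, eq, ha])]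
  exact piVal_congr P A B eq eF ea _ _ hF ha

/-- The fibration `Π A B`. -/
def pi (hP : P.IsDependentProduct) {Γ : E} (A : Fib K C Γ) (B : Fib K C (C.ext A.ty)) :
    Fib K C Γ := ⟨P.pi A.ty B.ty, piTap P hP A B⟩

lemma sub_pi (hP : P.IsDependentProduct) {Δ Γ : E} (f : Δ ⟶ Γ) (A : Fib K C Γ)
    (B : Fib K C (C.ext A.ty)) :
    (pi P hP A B).sub f = pi P hP (A.sub f) (B.sub (A.wk f)) := by
  refine ext_fib (P.pi_sub f A.ty B.ty) fun {X} q F h₁ h₂ => ?_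
  have h₃ : C.tp F = C.sub (PathObj.src (PathObj.map f q)) (P.pi A.ty B.ty) := by
    rw [PathObj.src_map, C.sub_comp]; exact h₁
  have hA : C.sub (PathObj.tgt q) (C.sub f A.ty) = C.sub (PathObj.tgt (PathObj.map f q)) A.ty := by
    rw [PathObj.tgt_map, C.sub_comp]
  refine (piTr_eq P A B (PathObj.map f q) F h₃ rfl hA).trans ?_
  refine P.lam_congr ?_ ?_ _ _
  · refine Eq.trans ?_ (C.sub_comp _ _ _)
    congr 1
    refine Eq.trans ?_ (C.wk_wkOf _ _ _ _ rfl (by rw [C.sub_comp])).symm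
    exact C.wkOf_congr (PathObj.tgt_map f q) _ _ _ _
  · set A' := C.sub (PathObj.tgt q) (C.sub f A.ty)
    have e : C.p A' ≫ PathObj.map f q = PathObj.map f (C.p A' ≫ q) := PathObj.comp_map _ _ _
    have hF := tp_tsub_p_src P A B _ F h₃ A'
    have ha := tp_v_tgt A _ A' hA
    rw [piVal_congr P A B e rfl rfl _ _ (by rw [← e]; exact hF) (by rw [← e]; exact ha)]
    exact piVal_map P f A B _ _ _ _ _ _ _

end Fib

variable (K) in
/-- Dependent products in the category with families of fibrations. -/
def fibPi (hP : P.IsDependentProduct) : (fibCwF K C).PiTypes where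
  pi A B := Fib.pi P hP A B
  pi_sub f A B := Fib.sub_pi P hP f A B
  lam A B M h := ⟨Fib.pi P hP A B, P.lam A.ty B.ty M.tm (M.tp_tm.trans (congrArg Fib.ty h)),
    P.tp_lam _ _ _ _⟩
  tp_lam A B M h := rfl
  app A B F N hF hN := ⟨B.sub ((fibCwF K C).inst N hN),
    P.app A.ty B.ty F.tm N.tm (F.tp_tm.trans (congrArg Fib.ty hF))
      (N.tp_tm.trans (congrArg Fib.ty hN)), P.tp_app _ _ _ _ _ _⟩
  tp_app A B F N hF hN := rfl
  app_lam A B M N hM hN := by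
    subst hM
    exact (FibElt.mk.injEq ..).mpr ⟨rfl, P.app_lam A.ty _ M.tm N.tm M.tp_tm _⟩
  lam_sub f A B M h := (FibElt.mk.injEq ..).mpr
    ⟨Fib.sub_pi P hP f A B, P.lam_sub f A.ty B.ty M.tm _⟩
  app_sub f A B F N hF hN := by
    refine (FibElt.mk.injEq ..).mpr ⟨?_, P.app_sub f A.ty B.ty F.tm N.tm _ _⟩
    have e := (fibCwF K C).inst_comp f N hN (((fibCwF K C).tp_tsub f N).trans
      (congrArg ((fibCwF K C).sub f) hN))
    exact ((fibCwF K C).sub_comp f _ B).symm.trans ((congrArg (fun g => (fibCwF K C).sub g B)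
      e.symm).trans ((fibCwF K C).sub_comp _ _ B))

end Pi

end MoorePaths

end

theorem theorem4p3 {E : Type u} [Category.{v} E] [CartesianMonoidalCategory E]
    [HasFiniteLimits E] [MonoidalClosed E] [HasSubobjectClassifier E]
    (K : OrderedCommRingObj E) :
    -- the category with families of the topos has dependent sums and products
    (∃ S : (toposCwF E).SigmaTypes, S.IsDependentSum) ∧
    (∃ P : (toposCwF E).PiTypes, P.IsDependentProduct) ∧
    -- dependent sums of fibrations have tap structures, stable under re-indexing
    (∀ S : (toposCwF E).SigmaTypes, S.IsDependentSum →
      ∃ τ : ∀ {Γ : E} (A : Fib K (toposCwF E) Γ) (B : Fib K (toposCwF E) ((toposCwF E).ext A.ty)),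
          Tap K (toposCwF E) (S.sig A.ty B.ty),
        (∀ {Γ : E} (A : Fib K (toposCwF E) Γ) (B : Fib K (toposCwF E) ((toposCwF E).ext A.ty)),
          IsSigmaTap K S A B (τ A B)) ∧
        (∀ {Δ Γ : E} (f : Δ ⟶ Γ) (A : Fib K (toposCwF E) Γ)
          (B : Fib K (toposCwF E) ((toposCwF E).ext A.ty)),
          Fib.sub f ⟨S.sig A.ty B.ty, τ A B⟩ =
            ⟨_, τ (A.sub f) (B.sub ((toposCwF E).wk f A.ty))⟩) ∧
        -- hence the category with families of fibrations supports Σ-types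
        ∃ σ : (fibCwF K (toposCwF E)).SigmaTypes,
          ∀ {Γ : E} (A : Fib K (toposCwF E) Γ)
            (B : Fib K (toposCwF E) ((toposCwF E).ext A.ty)),
            σ.sig A B = ⟨S.sig A.ty B.ty, τ A B⟩ ∧
            (toposCwF E).tsub (σ.pair A B) ((toposCwF E).v (σ.sig A B).ty) =
              (toposCwF E).tsub (S.pair A.ty B.ty) ((toposCwF E).v (S.sig A.ty B.ty))) ∧
    -- dependent products of fibrations have tap structures, stable under re-indexing
    (∀ P : (toposCwF E).PiTypes, P.IsDependentProduct →
      ∃ τ : ∀ {Γ : E} (A : Fib K (toposCwF E) Γ) (B : Fib K (toposCwF E) ((toposCwF E).ext A.ty)),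
          Tap K (toposCwF E) (P.pi A.ty B.ty),
        (∀ {Γ : E} (A : Fib K (toposCwF E) Γ) (B : Fib K (toposCwF E) ((toposCwF E).ext A.ty)),
          IsPiTap K P A B (τ A B)) ∧
        (∀ {Δ Γ : E} (f : Δ ⟶ Γ) (A : Fib K (toposCwF E) Γ)
          (B : Fib K (toposCwF E) ((toposCwF E).ext A.ty)),
          Fib.sub f ⟨P.pi A.ty B.ty, τ A B⟩ =
            ⟨_, τ (A.sub f) (B.sub ((toposCwF E).wk f A.ty))⟩) ∧
        -- hence the category with families of fibrations supports Π-types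
        ∃ π : (fibCwF K (toposCwF E)).PiTypes,
          (∀ {Γ : E} (A : Fib K (toposCwF E) Γ)
            (B : Fib K (toposCwF E) ((toposCwF E).ext A.ty)),
            π.pi A B = ⟨P.pi A.ty B.ty, τ A B⟩) ∧
          (∀ {Γ : E} (A : Fib K (toposCwF E) Γ)
            (B : Fib K (toposCwF E) ((toposCwF E).ext A.ty))
            (M : FibElt K (toposCwF E) ((toposCwF E).ext A.ty)) (hM : M.fib = B),
            (π.lam A B M hM).tm = P.lam A.ty B.ty M.tm (by rw [M.tp_tm, hM])) ∧
          (∀ {Γ : E} (A : Fib K (toposCwF E) Γ)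
            (B : Fib K (toposCwF E) ((toposCwF E).ext A.ty))
            (F N : FibElt K (toposCwF E) Γ) (hF : F.fib = π.pi A B) (hN : N.fib = A),
            ∃ hF' : (toposCwF E).tp F.tm = P.pi A.ty B.ty, (π.app A B F N hF hN).tm =
              P.app A.ty B.ty F.tm N.tm hF' (by rw [N.tp_tm, hN]))) := by
  refine ⟨⟨toposSigma E, isDependentSum_toposSigma⟩, ⟨toposPi E, isDependentProduct_toposPi⟩,
    fun S hS => ⟨fun A B => Fib.sigmaTap hS A B, fun A B => Fib.isSigmaTap_sigmaTap hS A B,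
      fun f A B => Fib.sub_sigma hS f A B, fibSigma K hS, fun A B => ⟨rfl, rfl⟩⟩,
    fun P hP => ⟨fun A B => Fib.piTap P hP A B, fun A B => Fib.isPiTap_piTap P hP A B,
      fun f A B => Fib.sub_pi P hP f A B, fibPi K P hP, fun A B => rfl, fun A B M hM => rfl,
      fun A B F N hF hN => ⟨F.tp_tm.trans (congrArg Fib.ty hF), rfl⟩⟩⟩
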